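/- **Setting.** There are $n$ clients; client $j$ holds row $\mathbf a_j\in\mathbb R^d$ of a matrix $\mathbf A\in\mathbb R^{n\times d}$. Let $\eta,\varepsilon>0$, $d,m\ge 1$, and let $t'\ge 0$ be an integer with $t'<n/m$. *Sketch.* $\mathbf S=\frac1{\sqrt m}\mathbf R$, where $\mathbf R$ is uniformly distributed on $\{-1,1\}^{m\times n}$. It is published together with a decomposition $\mathbf R=\sum_{i=1}^m\mathbf S_i$, in which each $\mathbf S_i\in\{-1,0,1\}^{m\times n}$ has exactly one non-zero entry per column and exactly $n/m$ non-zero entries per row (so $m\mid n$); the decomposition may be chosen by any deterministic or randomized rule. *Randomizer.* Client $j$, independently of the other clients and of the sketch, sends $m$ concatenated copies of $\mathbf a_j$, with independent noise from $D$ added to each of the $dm$ entries. Here $D$ is the law of $X-Y$ for independent $X,Y\sim\Gamma\big(\frac1{n/m-t'},\,b\big)$ (shape, scale) and $b=2\eta m^2d/\varepsilon$. So the messages are the rows of $\mathbf A+\mathbf G_1,\dots,\mathbf A+\mathbf G_m$, with all entries of all $\mathbf G_i\in\mathbb R^{n\times d}$ i.i.d. from $D$. *Transformation.* The trusted component outputs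 $\mathbf B=\frac1{\sqrt m}\sum_{i=1}^m\mathbf S_i(\mathbf A+\mathbf G_i)\in\mathbb R^{m\times d}$. *Analysis.* $A_k$ is any function that maps $\mathbf B\in\mathbb R^{m\times d}$ to a minimizer $\mathbf X'$ of $\|\mathbf B-\mathbf B\mathbf X\mathbf X^T\|_F^2$ over all $\mathbf X\in\mathbb R^{d\times k}$ with $\mathbf X^T\mathbf X=\mathbf I$. Put $\mathrm{OPT}=\min_{\mathbf X}\|\mathbf A-\mathbf A\mathbf X\mathbf X^T\|_F$ over the same $\mathbf X$. **Theorem.** 1. (Privacy.) For every set $C$ of at most $t'$ corrupt clients, the joint release of $\mathbf S$ with its decomposition, of $\mathbf B$, and of the messages of the clients in $C$ is $\varepsilon$-differentially private, for datasets with all entries in $[-\eta,\eta]$, where neighboring datasets differ in the row of one client outside $C$. 2. (Utility.) There is an absolute constant $c_0>0$ such that for every $c_1\ge c_0$ there is a constant $C>0$, depending only on $c_1$, with the following property. Let $1\le k\le d$, $\alpha_{\mathbf S}\in(0,1]$, $\beta\in(0,1)$, and $$c_0\,\frac{k+\log(1/\beta)}{\alpha_{\mathbf S}^2}\le m\le c_1\,\frac{k+\log(1/\beta)}{\alpha_{\mathbf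 S}^2}.$$ Then for every $\mathbf A\in\mathbb R^{n\times d}$, with probability at least $1-\beta$ over the sketch and the noise, the output $\mathbf X'=A_k(\mathbf B)$ satisfies $\mathbf X'^T\mathbf X'=\mathbf I$ and $$\|\mathbf A-\mathbf A\mathbf X'\mathbf X'^T\|_F\le(1+C\alpha_{\mathbf S})\,\mathrm{OPT}+C\,\eta\,\sqrt{\tfrac{n}{n-mt'}}\;\frac{(k+\log(1/\beta))^3d^{3/2}}{\alpha_{\mathbf S}^6}\,\varepsilon^{-1}\log\frac m\beta .$$ In particular, if $\log(1/\beta)\le k$ and $t'\le n/(2m)$, then with probability at least $1-\beta$ $$\|\mathbf A-\mathbf A\mathbf X'\mathbf X'^T\|_F\le(1+C\alpha_{\mathbf S})\,\mathrm{OPT}+C\,\eta\,\frac{k^3d^{3/2}}{\alpha_{\mathbf S}^6}\,\varepsilon^{-1}\log\frac m\beta .$$ -/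

import Mathlib

open MeasureTheory ProbabilityTheory Matrix

noncomputable section

namespace LTM

/-! ### Rank-`k` approximation -/

/-- The Frobenius norm of a real matrix. -/
def frob {p q : ℕ} (M : Matrix (Fin p) (Fin q) ℝ) : ℝ :=
  √(∑ i, ∑ j, M i j ^ 2)

/-- The `d × k` matrices with orthonormal columns; `X * Xᵀ` is then the orthogonal projection
onto the `k`-dimensional column span of `X`. -/
def Orthonormals (d k : ℕ) : Set (Matrix (Fin d) (Fin k) ℝ) :=
  {X | Xᵀ * X = 1}

/-- The low rank approximation cost `‖A - A X Xᵀ‖_F`. -/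
def cost {p d k : ℕ} (A : Matrix (Fin p) (Fin d) ℝ) (X : Matrix (Fin d) (Fin k) ℝ) : ℝ :=
  frob (A - A * X * Xᵀ)

/-- `OPT`, the optimal rank-`k` approximation cost of `A`. -/
def opt {p d : ℕ} (k : ℕ) (A : Matrix (Fin p) (Fin d) ℝ) : ℝ :=
  ⨅ X : Orthonormals d k, cost A X.1

/-- `solve` is an analysis function that computes
`argmin_X ‖B - B X Xᵀ‖_F ^ 2` over all `d × k` matrices `X` with orthonormal columns
(ties may be broken arbitrarily). -/
def IsArgmin {p d k : ℕ}
    (solve : Matrix (Fin p) (Fin d) ℝ → Matrix (Fin d) (Fin k) ℝ) : Prop :=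
  ∀ B, solve B ∈ Orthonormals d k ∧
    ∀ X ∈ Orthonormals d k, cost B (solve B) ^ 2 ≤ cost B X ^ 2

/-- `X` has orthonormal columns, and it approximates `A` with multiplicative error `mul`
and additive error `add`. -/
def IsApprox {p d k : ℕ} (A : Matrix (Fin p) (Fin d) ℝ) (mul add : ℝ)
    (X : Matrix (Fin d) (Fin k) ℝ) : Prop :=
  X ∈ Orthonormals d k ∧ cost A X ≤ mul * opt k A + add

/-! ### Dense sketches and their decomposition -/

/-- A sign matrix `sign ∈ {-1, 1}^{m × n}` together with a decomposition into `m` matrices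
`part i ∈ {-1, 0, 1}^{m × n}` that sum to it, each with exactly one non-zero entry per column and
exactly `n / m` non-zero entries per row. The sketching matrix is `(1 / √m) • sign`. -/
structure DenseSketch (m n : ℕ) where
  sign : Matrix (Fin m) (Fin n) ℤˣ
  part : Fin m → Matrix (Fin m) (Fin n) SignType
  sum_part : ∀ r j, ∑ i, (part i r j : ℤ) = (sign r j : ℤ)
  one_per_col : ∀ i j, ∃! r, part i r j ≠ 0
  balanced : ∀ i r, m * (Finset.univ.filter fun j => part i r j ≠ 0).card = n

instance (m n : ℕ) : MeasurableSpace (DenseSketch m n) := ⊤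

/-- The sign matrix of the random sketch is uniform on `{-1, 1}^{m × n}`; the decomposition may
be chosen by any rule, deterministic or randomized. -/
def IsRademacher {m n : ℕ} (ν : PMF (DenseSketch m n)) : Prop :=
  ν.map DenseSketch.sign = PMF.uniformOfFintype (Matrix (Fin m) (Fin n) ℤˣ)

/-- The trusted linear transformation `T_S`. Client `j`'s message is the concatenation of the `m`
blocks `y j i`, `i : Fin m`, and the output is `(1 / √m) ∑ i, S_i A_i`, where `A_i` is the
`n × d` matrix of the `i`-th blocks of all clients. -/
def transform {m n d : ℕ} (S : DenseSketch m n) (y : Fin n → Fin m → Fin d → ℝ) :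
    Matrix (Fin m) (Fin d) ℝ :=
  (1 / √(m : ℝ)) • ∑ i,
    (S.part i).map (fun s : SignType => (s : ℝ)) * Matrix.of (fun j c => y j i c)

/-! ### Randomizer -/

/-- The law of `X - Y` for independent `X, Y ∼ Γ(shape, scale)`. (Mathlib's second parameter is
the rate, the inverse of the scale.) -/
def gammaDiff (shape scale : ℝ) : Measure ℝ :=
  ((gammaMeasure shape (1 / scale)).prod (gammaMeasure shape (1 / scale))).map
    fun p => p.1 - p.2

/-- The noise distribution, for `n` clients, `t` of them corrupt, and input values bounded
by `η`. -/
def noise (n d m t : ℕ) (η ε : ℝ) : Measure ℝ :=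
  gammaDiff (1 / ((n : ℝ) / m - t)) (2 * η * (m : ℝ) ^ 2 * d / ε)

/-- The randomizer `R_D`: the law of `m` concatenated copies of `x`, with independent `D`-noise
added to each of the `d * m` entries. -/
def randomizer {d : ℕ} (m : ℕ) (D : Measure ℝ) (x : Fin d → ℝ) : Measure (Fin m → Fin d → ℝ) :=
  (Measure.pi fun _ : Fin m => Measure.pi fun _ : Fin d => D).map fun g i c => x c + g i c

/-- The joint law of the sketch and of all messages on input `A`, whose rows are the clients'
inputs: the clients randomize independently of each other and of the sketch. -/
def experiment {m n d : ℕ} (ν : PMF (DenseSketch m n)) (D : Measure ℝ)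
    (A : Matrix (Fin n) (Fin d) ℝ) :
    Measure (DenseSketch m n × (Fin n → Fin m → Fin d → ℝ)) :=
  ν.toMeasure.prod (Measure.pi fun j => randomizer m D (A j))

/-! ### Privacy -/

/-- `M` is `(ε, δ)`-differentially private for the neighbouring relation `Nbr`. -/
def IsDP {𝒳 𝒴 : Type*} [MeasurableSpace 𝒴] (ε δ : ℝ) (Nbr : 𝒳 → 𝒳 → Prop)
    (M : 𝒳 → Measure 𝒴) : Prop :=
  ∀ x x', Nbr x x' → ∀ E, MeasurableSet E →
    M x E ≤ ENNReal.ofReal (Real.exp ε) * M x' E + ENNReal.ofReal δ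

/-- Two datasets with all values in `[-η, η]` that differ at most in the input of one client
who is not corrupt. -/
def Neighbours {n d : ℕ} (η : ℝ) (Cor : Finset (Fin n)) (A A' : Matrix (Fin n) (Fin d) ℝ) : Prop :=
  (∀ j c, |A j c| ≤ η) ∧ (∀ j c, |A' j c| ≤ η) ∧ ∃ j ∉ Cor, ∀ j' ≠ j, A j' = A' j'

/-- The law of everything an adversary sees: the (public) sketch with its decomposition, the output
of the trusted transformation, and the messages of the corrupt clients. -/
def view {m n d : ℕ} (ν : PMF (DenseSketch m n)) (D : Measure ℝ) (Cor : Finset (Fin n))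
    (A : Matrix (Fin n) (Fin d) ℝ) :
    Measure (DenseSketch m n × (Fin m → Fin d → ℝ) × (Cor → Fin m → Fin d → ℝ)) :=
  (experiment ν D A).map fun ω => (ω.1, fun r c => transform ω.1 ω.2 r c, fun j => ω.2 j)

end LTM

end

/-!
The sketch `R` has independent uniform signs as entries, and the noise in the output is independent
of `R`; so privacy and utility are statements about a fixed or a random sign matrix and one fixed
noise law.

*Noise.* In each entry of `R` exactly one part of the decomposition is non-zero
(`DenseSketch.exists_perm`), so the noise of a client enters the output through a signed
permutation of the rows, which leaves the symmetric noise distribution invariant. Gamma differences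
of a fixed scale are additive in the shape (`gammaDiff_conv`, by moment generating functions), hence
the sum of the noise of `N` clients has independent entries that are gamma differences of
shape `N / (n / m - t)` (`map_noiseSum`).

*Privacy.* The honest clients contribute total shape at least `1`, where the log-density of the
gamma distribution is Lipschitz in the required direction: a shift by `s` changes probabilities at
most by the factor `exp (|s| / b)` (`gammaDiff_map_add_le`). Changing the input of an honest client
shifts each of the `m d` entries of the aggregated noise by at most `2 η` (`viewMap_of_neighbours`),
and the messages of the corrupt clients are independent of that noise (`map_noiseSum_prod`).

*Utility.* With high probability the sketch satisfies
`(1 - 6 δ) ‖A (1 - X Xᵀ)‖² ≤ ‖S A (1 - X Xᵀ)‖²` for all `X` (`signProb_cost_ge`), and does not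
increase the cost of one fixed optimal projection by more than the factor `1 + δ`
(`signProb_cost_le`). This, and a bound on the Frobenius norm of the noise, make a minimizer of the
cost of the noisy sketch an approximate minimizer of the cost of `A` (`cost_argmin_le`). For the
lower bound, rotate so that the columns of `A` are orthogonal, and call a column large if its squared
norm exceeds `OPT² / k`. There are at most `2 k` large columns, and on their span a net argument
bounds the error of the sketch (`signProb_quad_innerErr_le`). The remaining columns have total squared
norm at most `2 OPT²`. All terms that involve them are controlled by the error on that total, and by
the Frobenius norm of the error on the Gram matrix of the columns, each divided by the larger of its
norm and `OPT / √k`; the exponential moments of this Frobenius norm are bounded after decoupling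
(`expect_exp_norm_gramErr_le`). Only `m` of order `(k + log (1 / β)) / δ²`
rows are needed. The bound on the noise comes from `E cosh (t x)` and Jensen's inequality
(`pi_gammaDiff_frob_le`).
-/

namespace LTM

section

open Finset BigOperators

/-! ### Averages over independent signs -/

/-- The inner product of a real vector with a vector of signs. -/
def signDot {ι : Type*} [Fintype ι] (x : ι → ℝ) (σ : ι → ℤˣ) : ℝ :=
  ∑ j, x j * ((σ j : ℤ) : ℝ)

section Signs

variable {ι : Type*} [Fintype ι]

lemma sign_sq (e : ℤˣ) : (((e : ℤ) : ℝ)) ^ 2 = 1 := by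
  rcases Int.units_eq_one_or e with h | h <;> simp [h]

lemma signDot_add (x y : ι → ℝ) (σ : ι → ℤˣ) :
    signDot (x + y) σ = signDot x σ + signDot y σ := by
  simp [signDot, add_mul, sum_add_distrib]

lemma signDot_smul (c : ℝ) (x : ι → ℝ) (σ : ι → ℤˣ) :
    signDot (c • x) σ = c * signDot x σ := by
  simp [signDot, mul_sum, mul_assoc]

lemma expect_sign_prod [DecidableEq ι] (f : ι → ℤˣ → ℝ) :
    𝔼 σ : ι → ℤˣ, ∏ j, f j (σ j) = ∏ j, 𝔼 e : ℤˣ, f j e := by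
  simp_rw [Fintype.expect_eq_sum_div_card, Finset.prod_div_distrib]
  rw [← Fintype.prod_sum]
  simp

/-- A linear form in independent signs is sub-Gaussian. -/
lemma expect_exp_signDot_le [DecidableEq ι] (w : ι → ℝ) :
    𝔼 σ : ι → ℤˣ, Real.exp (signDot w σ) ≤ Real.exp ((∑ j, w j ^ 2) / 2) := by
  have h : ∀ σ : ι → ℤˣ, Real.exp (signDot w σ) =
      ∏ j, (fun j (e : ℤˣ) => Real.exp (w j * ((e : ℤ) : ℝ))) j (σ j) := fun σ => by
    simp [signDot, Real.exp_sum]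
  rw [Finset.expect_congr rfl fun σ _ => h σ,
    expect_sign_prod fun j (e : ℤˣ) => Real.exp (w j * ((e : ℤ) : ℝ)), Finset.sum_div, Real.exp_sum]
  refine Finset.prod_le_prod (fun j _ => expect_nonneg fun e _ => (Real.exp_pos _).le) fun j _ => ?_
  refine le_trans (le_of_eq ?_) (Real.cosh_le_exp_half_sq (w j))
  rw [Fintype.expect_eq_sum_div_card, Real.cosh_eq]
  have : (univ : Finset ℤˣ) = {1, -1} := rfl
  rw [this, sum_pair (by decide)]
  simp

end Signs

/-! ### Quadratic forms with orthogonal vectors -/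

lemma integrable_gaussian_exp_mul (c : ℝ) :
    Integrable (fun g => Real.exp (c * g)) (gaussianReal 0 1) :=
  integrable_exp_mul_gaussianReal c

lemma integral_gaussian_exp_mul (c : ℝ) :
    ∫ g, Real.exp (c * g) ∂(gaussianReal 0 1) = Real.exp (c ^ 2 / 2) := by
  have := mgf_gaussianReal (X := id) (p := gaussianReal 0 1) (μ := 0) (v := 1) (by simp) c
  simpa [mgf] using this

lemma integrable_gaussian_exp_sq {t : ℝ} (ht : t < 1 / 2) :
    Integrable (fun g => Real.exp (t * g ^ 2)) (gaussianReal 0 1) := by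
  rw [gaussianReal_of_var_ne_zero _ one_ne_zero, integrable_withDensity_iff_integrable_smul']
  · have h : ∀ x : ℝ, (gaussianPDF 0 1 x).toReal • Real.exp (t * x ^ 2)
        = (√(2 * Real.pi))⁻¹ * Real.exp (-(1 / 2 - t) * x ^ 2) := fun x => by
      rw [toReal_gaussianPDF]
      simp only [gaussianPDFReal, NNReal.coe_one, mul_one, sub_zero, smul_eq_mul]
      rw [mul_assoc, ← Real.exp_add]
      ring_nf
    simp_rw [h]
    exact (integrable_exp_neg_mul_sq (by linarith)).const_mul _
  · exact measurable_gaussianPDF _ _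
  · exact Filter.Eventually.of_forall fun x => by simp [gaussianPDF]

lemma integral_gaussian_exp_sq_le {t : ℝ} (h0 : 0 ≤ t) (ht : t ≤ 1 / 4) :
    ∫ g, Real.exp (t * g ^ 2) ∂(gaussianReal 0 1) ≤ Real.exp (2 * t) := by
  rw [integral_gaussianReal_eq_integral_smul one_ne_zero]
  have h : ∀ x : ℝ, gaussianPDFReal 0 1 x • Real.exp (t * x ^ 2)
      = (√(2 * Real.pi))⁻¹ * Real.exp (-(1 / 2 - t) * x ^ 2) := fun x => by
    simp only [gaussianPDFReal, NNReal.coe_one, mul_one, sub_zero, smul_eq_mul]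
    rw [mul_assoc, ← Real.exp_add]
    ring_nf
  simp_rw [h]
  rw [integral_const_mul, integral_gaussian]
  have hp := Real.pi_pos
  have h1 : (0:ℝ) < 1 - 2 * t := by linarith
  have e1 : (√(2 * Real.pi))⁻¹ * √(Real.pi / (1 / 2 - t)) = √(1 / (1 - 2 * t)) := by
    rw [← Real.sqrt_inv, ← Real.sqrt_mul (by positivity)]
    congr 1
    have : (1 / 2 - t) ≠ 0 := by linarith
    field_simp
  rw [e1]
  refine Real.sqrt_le_iff.2 ⟨(Real.exp_pos _).le, ?_⟩
  rw [← Real.exp_nat_mul, div_le_iff₀ h1]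
  push_cast
  have h2 := Real.add_one_le_exp (2 * (2 * t))
  nlinarith

/-- A sum of squares of linear forms with orthogonal coefficient vectors has the exponential
moment of a Gaussian one. Each square is linearized by one Gaussian variable `g`, and the linear
term created by it stays orthogonal to the remaining vectors. -/
lemma expect_exp_signDot_add_sq_le {ι κ : Type*} [Fintype ι] [DecidableEq ι]
    (x : κ → ι → ℝ) {l : ℝ} (hl : 0 ≤ l) (s : Finset κ)
    (hx : ∀ i ∈ s, l * ∑ j, x i j ^ 2 ≤ 1 / 4)
    (horth : ∀ i ∈ s, ∀ i' ∈ s, i ≠ i' → ∑ j, x i j * x i' j = 0) :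
    ∀ w : ι → ℝ, (∀ i ∈ s, ∑ j, w j * x i j = 0) →
    𝔼 σ : ι → ℤˣ, Real.exp (signDot w σ + l * ∑ i ∈ s, signDot (x i) σ ^ 2) ≤
      Real.exp ((∑ j, w j ^ 2) / 2 + 2 * l * ∑ i ∈ s, ∑ j, x i j ^ 2) := by
  classical
  induction s using Finset.induction_on with
  | empty =>
    intro w _
    simpa using expect_exp_signDot_le w
  | insert a s ha ih =>
    intro w hw
    have ih' := ih (fun i hi => hx i (mem_insert_of_mem hi))
      (fun i hi i' hi' => horth i (mem_insert_of_mem hi) i' (mem_insert_of_mem hi'))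
    set q : ℝ := √(2 * l) with hq
    have hq2 : q ^ 2 = 2 * l := Real.sq_sqrt (by linarith)
    have key : ∀ σ : ι → ℤˣ, Real.exp (signDot w σ + l * ∑ i ∈ insert a s, signDot (x i) σ ^ 2)
        = ∫ g, Real.exp (signDot (w + (q * g) • x a) σ + l * ∑ i ∈ s, signDot (x i) σ ^ 2)
            ∂(gaussianReal 0 1) := fun σ => by
      have : ∀ g : ℝ, Real.exp (signDot (w + (q * g) • x a) σ
            + l * ∑ i ∈ s, signDot (x i) σ ^ 2)
          = Real.exp (signDot w σ + l * ∑ i ∈ s, signDot (x i) σ ^ 2)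
            * Real.exp ((q * signDot (x a) σ) * g) := fun g => by
        rw [signDot_add, signDot_smul, ← Real.exp_add]
        ring_nf
      simp_rw [this]
      rw [integral_const_mul, integral_gaussian_exp_mul, ← Real.exp_add, sum_insert ha, mul_pow, hq2]
      ring_nf
    have hint : ∀ σ : ι → ℤˣ, Integrable (fun g => Real.exp (signDot (w + (q * g) • x a) σ
        + l * ∑ i ∈ s, signDot (x i) σ ^ 2)) (gaussianReal 0 1) := fun σ => by
      have : ∀ g : ℝ, Real.exp (signDot (w + (q * g) • x a) σ
            + l * ∑ i ∈ s, signDot (x i) σ ^ 2)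
          = Real.exp (signDot w σ + l * ∑ i ∈ s, signDot (x i) σ ^ 2)
            * Real.exp ((q * signDot (x a) σ) * g) := fun g => by
        rw [signDot_add, signDot_smul, ← Real.exp_add]
        ring_nf
      simp_rw [this]
      exact (integrable_gaussian_exp_mul _).const_mul _
    simp_rw [key]
    have swap : 𝔼 σ : ι → ℤˣ, ∫ g, Real.exp (signDot (w + (q * g) • x a) σ
          + l * ∑ i ∈ s, signDot (x i) σ ^ 2) ∂(gaussianReal 0 1)
        = ∫ g, (𝔼 σ : ι → ℤˣ, Real.exp (signDot (w + (q * g) • x a) σ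
          + l * ∑ i ∈ s, signDot (x i) σ ^ 2)) ∂(gaussianReal 0 1) := by
      simp_rw [Fintype.expect_eq_sum_div_card]
      rw [integral_div, integral_finsetSum _ fun σ _ => hint σ]
    rw [swap]
    set t : ℝ := l * ∑ j, x a j ^ 2 with ht
    have ht4 : t ≤ 1 / 4 := hx a (mem_insert_self a s)
    have ht0 : 0 ≤ t := mul_nonneg hl (sum_nonneg fun j _ => sq_nonneg _)
    set c : ℝ := (∑ j, w j ^ 2) / 2 + 2 * l * ∑ i ∈ s, ∑ j, x i j ^ 2 with hc
    have hwa := hw a (mem_insert_self a s)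
    have bound : ∀ g : ℝ, 𝔼 σ : ι → ℤˣ, Real.exp (signDot (w + (q * g) • x a) σ
          + l * ∑ i ∈ s, signDot (x i) σ ^ 2) ≤ Real.exp c * Real.exp (t * g ^ 2) := fun g => by
      refine (ih' (w + (q * g) • x a) fun i hi => ?_).trans (le_of_eq ?_)
      · have h1 := hw i (mem_insert_of_mem hi)
        have h2 := horth a (mem_insert_self a s) i (mem_insert_of_mem hi)
          (fun h => ha (h ▸ hi))
        simp only [Pi.add_apply, Pi.smul_apply, smul_eq_mul, add_mul, sum_add_distrib, h1,
          mul_assoc, ← mul_sum, h2]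
        simp
      · rw [← Real.exp_add]
        congr 1
        have : ∑ j, (w + (q * g) • x a) j ^ 2
            = ∑ j, w j ^ 2 + 2 * (q * g) * (∑ j, w j * x a j) + (q * g) ^ 2 * ∑ j, x a j ^ 2 := by
          rw [mul_sum, mul_sum, ← sum_add_distrib, ← sum_add_distrib]
          exact sum_congr rfl fun j _ => by simp; ring
        rw [this, hwa, mul_pow, hq2, hc, ht]
        ring
    calc _ ≤ ∫ g, Real.exp c * Real.exp (t * g ^ 2) ∂(gaussianReal 0 1) := by
          refine integral_mono ?_ ((integrable_gaussian_exp_sq (by linarith)).const_mul _) bound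
          simp_rw [Fintype.expect_eq_sum_div_card]
          exact (integrable_finsetSum _ fun σ _ => hint σ).div_const _
      _ ≤ Real.exp c * Real.exp (2 * t) := by
          rw [integral_const_mul]
          exact mul_le_mul_of_nonneg_left (integral_gaussian_exp_sq_le ht0 ht4) (Real.exp_pos _).le
      _ = _ := by
          rw [← Real.exp_add, sum_insert ha, hc, ht]
          ring_nf

lemma expect_exp_sum_sq_le {ι κ : Type*} [Fintype ι] [DecidableEq ι] [Fintype κ]
    (x : κ → ι → ℝ) {l : ℝ} (hl : 0 ≤ l) (hx : ∀ i, l * ∑ j, x i j ^ 2 ≤ 1 / 4)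
    (horth : ∀ i i', i ≠ i' → ∑ j, x i j * x i' j = 0) :
    𝔼 σ : ι → ℤˣ, Real.exp (l * ∑ i, signDot (x i) σ ^ 2) ≤
      Real.exp (2 * l * ∑ i, ∑ j, x i j ^ 2) := by
  simpa [signDot] using expect_exp_signDot_add_sq_le x hl univ (fun i _ => hx i)
    (fun i _ i' _ => horth i i') 0 (by simp)

/-- The exponential of a convex combination is at most the convex combination of exponentials. -/
lemma exp_sum_le {ι : Type*} (s : Finset ι) (w y : ι → ℝ) (hw : ∀ i ∈ s, 0 ≤ w i)
    (h1 : ∑ i ∈ s, w i = 1) :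
    Real.exp (∑ i ∈ s, w i * y i) ≤ ∑ i ∈ s, w i * Real.exp (y i) := by
  simpa using convexOn_exp.map_sum_le hw h1 (p := y) (fun i _ => Set.mem_univ _)

/-! ### Decoupling of the Gram matrix error -/

section Decoupling

variable {ι J : Type*} {m : ℕ}

/-- Multiplication of the columns of a sign matrix by the signs `σ`. -/
def flipCols (σ : J → ℤˣ) (R : Fin m → J → ℤˣ) : Fin m → J → ℤˣ := fun r j => σ j * R r j

lemma flipCols_flipCols (σ : J → ℤˣ) (R : Fin m → J → ℤˣ) :
    flipCols σ (flipCols σ R) = R := by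
  funext r j
  simp [flipCols, ← mul_assoc]

/-- `flipCols σ` as a permutation of the sign matrices. -/
def flipEquiv (σ : J → ℤˣ) : (Fin m → J → ℤˣ) ≃ (Fin m → J → ℤˣ) where
  toFun := flipCols σ
  invFun := flipCols σ
  left_inv := flipCols_flipCols σ
  right_inv := flipCols_flipCols σ

variable [Fintype J]

/-- The matrix with entries `m⁻¹ ∑ r, ⟨u a, R r⟩ ⟨u b, R' r⟩`, as a vector with the Frobenius
norm. -/
noncomputable def crossGram (u : ι → J → ℝ) (R R' : Fin m → J → ℤˣ) : EuclideanSpace ℝ (ι × ι) :=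
  WithLp.toLp 2 fun p => (1 / (m : ℝ)) * ∑ r, signDot (u p.1) (R r) * signDot (u p.2) (R' r)

/-- The error `Uᵀ (SᵀS - 1) U` of the sketch `S = R / √m` on the matrix `U` with columns `u a`,
as a vector with the Frobenius norm. -/
noncomputable def gramErr (u : ι → J → ℝ) (R : Fin m → J → ℤˣ) : EuclideanSpace ℝ (ι × ι) :=
  crossGram u R R - WithLp.toLp 2 fun p => ∑ j, u p.1 j * u p.2 j

/-- The form `crossGram` for the columns of `R` with `σ = 1` and the columns of `R'` with
`σ = -1`, times four. -/
noncomputable def splitGram (u : ι → J → ℝ) (σ : J → ℤˣ) (R R' : Fin m → J → ℤˣ) :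
    EuclideanSpace ℝ (ι × ι) :=
  crossGram u R R' - crossGram u R (flipCols σ R') + crossGram u (flipCols σ R) R'
    - crossGram u (flipCols σ R) (flipCols σ R')

lemma signDot_flip (x : J → ℝ) (σ : J → ℤˣ) (R : Fin m → J → ℤˣ) (r : Fin m) :
    signDot x (flipCols σ R r) = signDot (fun j => x j * ((R r j : ℤ) : ℝ)) σ := by
  unfold signDot flipCols
  exact sum_congr rfl fun j _ => by push_cast; ring

lemma sum_signDot [DecidableEq J] (x : J → ℝ) : ∑ σ : J → ℤˣ, signDot x σ = 0 := by
  have h := Equiv.sum_comp (Equiv.neg (J → ℤˣ)) (signDot x)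
  have h2 : ∀ σ : J → ℤˣ, signDot x (Equiv.neg (J → ℤˣ) σ) = - signDot x σ := fun σ => by
    simp [signDot]
  simp_rw [h2, sum_neg_distrib] at h
  linarith

lemma sum_sign_mul_sign [DecidableEq J] (j l : J) :
    ∑ σ : J → ℤˣ, ((σ j : ℤ) : ℝ) * ((σ l : ℤ) : ℝ) =
      if j = l then (Fintype.card (J → ℤˣ) : ℝ) else 0 := by
  split_ifs with h
  · subst h
    simp [← pow_two, sign_sq]
  · have h1 := Equiv.sum_comp (Equiv.mulLeft (Pi.mulSingle j (-1) : J → ℤˣ))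
      (fun σ : J → ℤˣ => ((σ j : ℤ) : ℝ) * ((σ l : ℤ) : ℝ))
    have h2 : ∀ σ : J → ℤˣ, (((Equiv.mulLeft (Pi.mulSingle j (-1) : J → ℤˣ) σ) j : ℤ) : ℝ)
        * (((Equiv.mulLeft (Pi.mulSingle j (-1) : J → ℤˣ) σ) l : ℤ) : ℝ)
        = - (((σ j : ℤ) : ℝ) * ((σ l : ℤ) : ℝ)) := fun σ => by
      simp [Pi.mulSingle_eq_of_ne (Ne.symm h)]
    simp_rw [h2, sum_neg_distrib] at h1
    linarith

lemma sum_signDot_mul_signDot [DecidableEq J] (x y : J → ℝ) :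
    ∑ σ : J → ℤˣ, signDot x σ * signDot y σ =
      (Fintype.card (J → ℤˣ) : ℝ) * ∑ j, x j * y j := by
  have : ∀ σ : J → ℤˣ, signDot x σ * signDot y σ
      = ∑ j, ∑ l, x j * y l * (((σ j : ℤ) : ℝ) * ((σ l : ℤ) : ℝ)) := fun σ => by
    simp only [signDot]
    rw [Finset.sum_mul_sum]
    exact sum_congr rfl fun j _ => sum_congr rfl fun l _ => by ring
  simp_rw [this]
  rw [sum_comm, mul_sum]
  refine sum_congr rfl fun j _ => ?_
  rw [sum_comm]
  simp_rw [← mul_sum, sum_sign_mul_sign]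
  simp
  ring

/-- The error has only off-diagonal terms `R r j * R r l` with `j ≠ l`, so it is the average over
the random splits `σ` of the parts with `σ j = 1`, `σ l = -1`. -/
lemma gramErr_eq [DecidableEq J] (hm : 0 < m) (u : ι → J → ℝ) (R : Fin m → J → ℤˣ) :
    gramErr u R = (1 / (Fintype.card (J → ℤˣ) : ℝ)) • ∑ σ : J → ℤˣ, splitGram u σ R R := by
  have hN : (Fintype.card (J → ℤˣ) : ℝ) ≠ 0 := by positivity
  have hm' : (m : ℝ) ≠ 0 := by positivity
  ext p
  simp only [gramErr, splitGram, crossGram, PiLp.sub_apply, PiLp.smul_apply, smul_eq_mul,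
    WithLp.ofLp_sum, Finset.sum_apply, PiLp.add_apply, sum_add_distrib, sum_sub_distrib,
    ← mul_sum]
  have e1 : ∑ σ : J → ℤˣ, ∑ r, signDot (u p.1) (R r) * signDot (u p.2) (flipCols σ R r) = 0 := by
    rw [sum_comm]
    refine sum_eq_zero fun r _ => ?_
    simp_rw [← mul_sum, signDot_flip, sum_signDot, mul_zero]
  have e2 : ∑ σ : J → ℤˣ, ∑ r, signDot (u p.1) (flipCols σ R r) * signDot (u p.2) (R r) = 0 := by
    rw [sum_comm]
    refine sum_eq_zero fun r _ => ?_
    simp_rw [← sum_mul, signDot_flip, sum_signDot, zero_mul]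
  have e3 : ∑ σ : J → ℤˣ, ∑ r, signDot (u p.1) (flipCols σ R r) * signDot (u p.2) (flipCols σ R r)
      = m * ((Fintype.card (J → ℤˣ) : ℝ) * ∑ j, u p.1 j * u p.2 j) := by
    rw [sum_comm]
    have : ∀ r : Fin m, ∑ σ : J → ℤˣ,
        signDot (u p.1) (flipCols σ R r) * signDot (u p.2) (flipCols σ R r)
        = (Fintype.card (J → ℤˣ) : ℝ) * ∑ j, u p.1 j * u p.2 j := fun r => by
      simp_rw [signDot_flip, sum_signDot_mul_signDot]
      congr 1
      refine sum_congr rfl fun j _ => ?_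
      have := sign_sq (R r j)
      linear_combination (u p.1 j * u p.2 j) * this
    simp [this]
  rw [e1, e2, e3, sum_const, card_univ, nsmul_eq_mul]
  field_simp
  ring

/-- Exchange of the columns with `σ = -1` between two sign matrices. -/
def swapCols [DecidableEq J] (σ : J → ℤˣ) :
    (Fin m → J → ℤˣ) × (Fin m → J → ℤˣ) ≃ (Fin m → J → ℤˣ) × (Fin m → J → ℤˣ) where
  toFun P := (fun r j => if σ j = 1 then P.1 r j else P.2 r j,
    fun r j => if σ j = 1 then P.2 r j else P.1 r j)
  invFun P := (fun r j => if σ j = 1 then P.1 r j else P.2 r j,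
    fun r j => if σ j = 1 then P.2 r j else P.1 r j)
  left_inv P := by
    ext r j <;> by_cases h : σ j = 1 <;> simp [h]
  right_inv P := by
    ext r j <;> by_cases h : σ j = 1 <;> simp [h]

lemma splitGram_apply (u : ι → J → ℝ) (σ : J → ℤˣ) (R R' : Fin m → J → ℤˣ) (p : ι × ι) :
    splitGram u σ R R' p = (1 / (m : ℝ)) *
      ∑ r, (signDot (u p.1) (R r) + signDot (u p.1) (flipCols σ R r)) *
        (signDot (u p.2) (R' r) - signDot (u p.2) (flipCols σ R' r)) := by
  simp only [splitGram, crossGram, PiLp.sub_apply, PiLp.add_apply]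
  rw [← mul_sub, ← mul_add, ← mul_sub, ← sum_sub_distrib, ← sum_add_distrib, ← sum_sub_distrib]
  congr 1
  exact sum_congr rfl fun r _ => by ring

lemma splitGram_swap [DecidableEq J] (u : ι → J → ℝ) (σ : J → ℤˣ)
    (P : (Fin m → J → ℤˣ) × (Fin m → J → ℤˣ)) :
    splitGram u σ (swapCols σ P).1 (swapCols σ P).1 = splitGram u σ P.1 P.2 := by
  ext p
  rw [splitGram_apply, splitGram_apply]
  congr 1
  refine sum_congr rfl fun r _ => ?_
  congr 1
  · simp only [signDot, ← sum_add_distrib]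
    refine sum_congr rfl fun j _ => ?_
    rcases Int.units_eq_one_or (σ j) with h | h <;> simp [swapCols, flipCols, h]
  · simp only [signDot, ← sum_sub_distrib]
    refine sum_congr rfl fun j _ => ?_
    have hne : (-1 : ℤˣ) ≠ 1 := by decide
    rcases Int.units_eq_one_or (σ j) with h | h <;> simp [swapCols, flipCols, h, hne]

variable [Fintype ι]

lemma exp_norm_splitGram_le (u : ι → J → ℝ) (σ : J → ℤˣ) (R R' : Fin m → J → ℤˣ) {θ : ℝ}
    (hθ : 0 ≤ θ) :
    Real.exp (θ * ‖splitGram u σ R R'‖) ≤ (1 / 4) *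
      (Real.exp (4 * θ * ‖crossGram u R R'‖) + Real.exp (4 * θ * ‖crossGram u R (flipCols σ R')‖)
      + Real.exp (4 * θ * ‖crossGram u (flipCols σ R) R'‖)
      + Real.exp (4 * θ * ‖crossGram u (flipCols σ R) (flipCols σ R')‖)) := by
  set a := crossGram u R R'
  set b := crossGram u R (flipCols σ R')
  set c := crossGram u (flipCols σ R) R'
  set d := crossGram u (flipCols σ R) (flipCols σ R')
  have h1 : ‖splitGram u σ R R'‖ ≤ ‖a‖ + ‖b‖ + ‖c‖ + ‖d‖ := by
    refine (norm_sub_le _ _).trans (add_le_add_left ?_ _)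
    refine (norm_add_le _ _).trans (add_le_add_left ?_ _)
    exact norm_sub_le _ _
  have h2 := exp_sum_le univ (fun _ : Fin 4 => (1 / 4 : ℝ))
    ![4 * θ * ‖a‖, 4 * θ * ‖b‖, 4 * θ * ‖c‖, 4 * θ * ‖d‖] (fun _ _ => by norm_num) (by simp)
  simp only [Fin.sum_univ_four, Matrix.cons_val] at h2
  refine (Real.exp_le_exp.2 (?_ : _ ≤ _)).trans (h2.trans (le_of_eq (by ring)))
  nlinarith [mul_le_mul_of_nonneg_left h1 hθ]

/-- Decoupling: up to a factor `4` in the exponent, the two copies of the sign matrix in the error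
may be taken to be independent. -/
lemma expect_exp_gramErr_le [DecidableEq J] (hm : 0 < m) (u : ι → J → ℝ) {θ : ℝ} (hθ : 0 ≤ θ) :
    𝔼 R : Fin m → J → ℤˣ, Real.exp (θ * ‖gramErr u R‖) ≤
      𝔼 R' : Fin m → J → ℤˣ, 𝔼 R : Fin m → J → ℤˣ, Real.exp (4 * θ * ‖crossGram u R R'‖) := by
  set N : ℝ := (Fintype.card (J → ℤˣ) : ℝ) with hN
  have hNpos : 0 < N := by positivity
  have step1 : ∀ R : Fin m → J → ℤˣ, Real.exp (θ * ‖gramErr u R‖) ≤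
      𝔼 σ : J → ℤˣ, Real.exp (θ * ‖splitGram u σ R R‖) := fun R => by
    have h1 : ‖gramErr u R‖ ≤ (1 / N) * ∑ σ : J → ℤˣ, ‖splitGram u σ R R‖ := by
      rw [gramErr_eq hm, norm_smul, Real.norm_of_nonneg (by positivity)]
      exact mul_le_mul_of_nonneg_left (norm_sum_le _ _) (by positivity)
    have h2 := exp_sum_le univ (fun _ : J → ℤˣ => 1 / N) (fun σ => θ * ‖splitGram u σ R R‖)
      (fun _ _ => by positivity) (by simp [hN])
    rw [Fintype.expect_eq_sum_div_card]
    refine (Real.exp_le_exp.2 ?_).trans (h2.trans (le_of_eq ?_))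
    · refine (mul_le_mul_of_nonneg_left h1 hθ).trans (le_of_eq ?_)
      rw [mul_sum, mul_sum]
      exact sum_congr rfl fun _ _ => by ring
    · rw [← mul_sum]
      ring
  have step2 : ∀ σ : J → ℤˣ, 𝔼 R : Fin m → J → ℤˣ, Real.exp (θ * ‖splitGram u σ R R‖) ≤
      𝔼 R' : Fin m → J → ℤˣ, 𝔼 R : Fin m → J → ℤˣ, Real.exp (4 * θ * ‖crossGram u R R'‖) := by
    intro σ
    have e1 : 𝔼 R : Fin m → J → ℤˣ, Real.exp (θ * ‖splitGram u σ R R‖)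
        = 𝔼 P : (Fin m → J → ℤˣ) × (Fin m → J → ℤˣ), Real.exp (θ * ‖splitGram u σ P.1 P.2‖) := by
      have : 𝔼 R : Fin m → J → ℤˣ, Real.exp (θ * ‖splitGram u σ R R‖)
          = 𝔼 P : (Fin m → J → ℤˣ) × (Fin m → J → ℤˣ), Real.exp (θ * ‖splitGram u σ P.1 P.1‖) := by
        rw [← univ_product_univ,
          expect_product univ univ (fun P : (Fin m → J → ℤˣ) × (Fin m → J → ℤˣ) =>
            Real.exp (θ * ‖splitGram u σ P.1 P.1‖))]
        refine expect_congr rfl fun R _ => ?_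
        exact (Fintype.expect_const _).symm
      rw [this]
      refine (Fintype.expect_equiv (swapCols σ) _ _ fun P => ?_).symm
      rw [splitGram_swap]
    have e2 : ∀ f : (Fin m → J → ℤˣ) × (Fin m → J → ℤˣ) ≃
          (Fin m → J → ℤˣ) × (Fin m → J → ℤˣ),
        𝔼 P, Real.exp (4 * θ * ‖crossGram u (f P).1 (f P).2‖)
        = 𝔼 R' : Fin m → J → ℤˣ, 𝔼 R : Fin m → J → ℤˣ,
            Real.exp (4 * θ * ‖crossGram u R R'‖) := fun f => by
      rw [Fintype.expect_equiv f _ (fun P => Real.exp (4 * θ * ‖crossGram u P.1 P.2‖))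
        fun P => rfl, ← univ_product_univ,
        expect_product univ univ (fun P : (Fin m → J → ℤˣ) × (Fin m → J → ℤˣ) =>
            Real.exp (4 * θ * ‖crossGram u P.1 P.2‖)), expect_comm]
    rw [e1]
    refine (expect_le_expect fun P _ => exp_norm_splitGram_le u σ P.1 P.2 hθ).trans (le_of_eq ?_)
    rw [← mul_expect, expect_add_distrib, expect_add_distrib, expect_add_distrib]
    have a1 := e2 (Equiv.refl _)
    have a2 := e2 (Equiv.prodCongr (Equiv.refl _) (flipEquiv σ))
    have a3 := e2 (Equiv.prodCongr (flipEquiv σ) (Equiv.refl _))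
    have a4 := e2 (Equiv.prodCongr (flipEquiv σ) (flipEquiv σ))
    simp only [Equiv.refl_apply, Equiv.prodCongr_apply, flipEquiv, Equiv.coe_fn_mk, Prod.map_fst,
      Prod.map_snd, Equiv.coe_refl, id_eq] at a1 a2 a3 a4
    rw [a1, a2, a3, a4]
    ring
  calc _ ≤ 𝔼 R : Fin m → J → ℤˣ, 𝔼 σ : J → ℤˣ, Real.exp (θ * ‖splitGram u σ R R‖) :=
        expect_le_expect fun R _ => step1 R
    _ = 𝔼 σ : J → ℤˣ, 𝔼 R : Fin m → J → ℤˣ, Real.exp (θ * ‖splitGram u σ R R‖) := expect_comm ..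
    _ ≤ _ := expect_le univ_nonempty fun σ _ => step2 σ

end Decoupling

/-! ### Concentration of the Gram matrix -/

section Concentration

variable {ι J : Type*} [Fintype ι] [Fintype J] {m : ℕ}

lemma signDot_uncurry (x : Fin m × J → ℝ) (R : Fin m → J → ℤˣ) :
    signDot x (Function.uncurry R) = ∑ r, signDot (fun j => x (r, j)) (R r) := by
  simp [signDot, Fintype.sum_prod_type, Function.uncurry]

lemma expect_uncurry [DecidableEq J] (f : (Fin m × J → ℤˣ) → ℝ) :
    𝔼 R : Fin m → J → ℤˣ, f (Function.uncurry R) = 𝔼 σ, f σ :=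
  Fintype.expect_equiv (Equiv.curry (Fin m) J ℤˣ).symm _ _ fun _ => rfl

/-- For a fixed second copy, the Frobenius norm of the decoupled error is the norm of a linear map
of independent signs. Jensen's inequality over the columns reduces it to a sum of squares of linear
forms with orthogonal coefficients. -/
lemma expect_exp_crossGram_le [DecidableEq J] (hm : 0 < m) (u : ι → J → ℝ)
    (hu : ∀ i, ∑ j, u i j ^ 2 ≤ 1) (horth : ∀ i i', i ≠ i' → ∑ j, u i j * u i' j = 0)
    (θ : ℝ) (R' : Fin m → J → ℤˣ) :
    𝔼 R : Fin m → J → ℤˣ, Real.exp (4 * θ * ‖crossGram u R R'‖) ≤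
      Real.exp ((∑ i, ∑ j, u i j ^ 2) / 2
        + 16 * θ ^ 2 / m ^ 2 * ∑ p : Fin m × ι, signDot (u p.2) (R' p.1) ^ 2) := by
  classical
  have hm' : (0 : ℝ) < m := by positivity
  set D : ι → Fin m → ℝ := fun b r => signDot (u b) (R' r) with hD
  set z : ι → ℝ := fun b => ∑ r, D b r ^ 2 with hz
  set Z : ℝ := ∑ b, z b with hZ
  have hz0 : ∀ b, 0 ≤ z b := fun b => sum_nonneg fun r _ => sq_nonneg _
  have hZ0 : 0 ≤ Z := sum_nonneg fun b _ => hz0 b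
  have hZe : ∑ p : Fin m × ι, signDot (u p.2) (R' p.1) ^ 2 = Z := by
    rw [Fintype.sum_prod_type_right]
  have hnorm : ∀ R : Fin m → J → ℤˣ, ‖crossGram u R R'‖ ^ 2
      = ∑ b, ∑ a, ((1 / (m : ℝ)) * ∑ r, signDot (u a) (R r) * D b r) ^ 2 := fun R => by
    rw [EuclideanSpace.norm_sq_eq, Fintype.sum_prod_type_right]
    simp [crossGram, hD, mul_pow]
  have hK : 0 ≤ ∑ i, ∑ j, u i j ^ 2 := sum_nonneg fun i _ => sum_nonneg fun j _ => sq_nonneg _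
  rw [hZe]
  rcases hZ0.eq_or_lt with h0 | hpos
  · have hDz : ∀ b r, D b r = 0 := fun b r => by
      have h1 := (sum_eq_zero_iff_of_nonneg fun b _ => hz0 b).1 h0.symm b (mem_univ _)
      have h2 := (sum_eq_zero_iff_of_nonneg fun r _ => sq_nonneg (D b r)).1 h1 r (mem_univ _)
      simpa using h2
    refine expect_le univ_nonempty fun R _ => Real.exp_le_exp.2 ?_
    have : ‖crossGram u R R'‖ ^ 2 = 0 := by
      rw [hnorm]
      simp [hDz]
    rw [pow_eq_zero_iff two_ne_zero] at this
    rw [this, ← h0]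
    simpa using by positivity
  · -- the parameter `l` balances the two factors of the completed square
    set l : ℝ := m ^ 2 / (4 * Z) with hl
    have hlpos : 0 < l := by positivity
    set x : ι → ι → Fin m × J → ℝ := fun b a q => u a q.2 * (D b q.1 / √(z b)) with hx
    have hD0 : ∀ b r, z b = 0 → D b r = 0 := fun b r h => by
      have h2 := (sum_eq_zero_iff_of_nonneg fun r _ => sq_nonneg (D b r)).1 h r (mem_univ _)
      simpa using h2
    have hxx : ∀ b a a', ∑ q, x b a q * x b a' q
        = (∑ j, u a j * u a' j) * (∑ r, (D b r / √(z b)) ^ 2) := fun b a a' => by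
      rw [Fintype.sum_prod_type_right, sum_mul_sum]
      exact sum_congr rfl fun j _ => sum_congr rfl fun r _ => by simp only [hx]; ring
    have hDz : ∀ b, ∑ r, (D b r / √(z b)) ^ 2 ≤ 1 := fun b => by
      simp_rw [div_pow, Real.sq_sqrt (hz0 b)]
      rw [← sum_div]
      exact div_self_le_one _
    have hxn : ∀ b a, ∑ q, x b a q ^ 2 ≤ ∑ j, u a j ^ 2 := fun b a => by
      have := hxx b a a
      simp_rw [← pow_two] at this
      rw [this]
      exact mul_le_of_le_one_right (sum_nonneg fun j _ => sq_nonneg _) (hDz b)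
    have hbound : ∀ R : Fin m → J → ℤˣ, Real.exp (4 * θ * ‖crossGram u R R'‖) ≤
        Real.exp (16 * θ ^ 2 / m ^ 2 * Z) *
          ∑ b, z b / Z * Real.exp ((1 / 4) * ∑ a, signDot (x b a) (Function.uncurry R) ^ 2) :=
        fun R => by
      have h1 : 4 * θ * ‖crossGram u R R'‖ ≤ 16 * θ ^ 2 / m ^ 2 * Z
          + l * ‖crossGram u R R'‖ ^ 2 := by
        have e : 16 * θ ^ 2 / m ^ 2 * Z = 4 * θ ^ 2 / l := by
          rw [hl]; field_simp; ring
        rw [e]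
        have e2 : 4 * θ ^ 2 / l + l * ‖crossGram u R R'‖ ^ 2 - 4 * θ * ‖crossGram u R R'‖
            = l * (‖crossGram u R R'‖ - 2 * θ / l) ^ 2 := by field_simp; ring
        nlinarith [mul_nonneg hlpos.le (sq_nonneg (‖crossGram u R R'‖ - 2 * θ / l))]
      have h2 : l * ‖crossGram u R R'‖ ^ 2
          = ∑ b, z b / Z * ((1 / 4) * ∑ a, signDot (x b a) (Function.uncurry R) ^ 2) := by
        rw [hnorm, mul_sum]
        refine sum_congr rfl fun b _ => ?_
        rw [mul_sum, mul_sum, mul_sum]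
        refine sum_congr rfl fun a _ => ?_
        have e3 : signDot (x b a) (Function.uncurry R)
            = (∑ r, signDot (u a) (R r) * D b r) / √(z b) := by
          rw [signDot_uncurry, sum_div]
          refine sum_congr rfl fun r _ => ?_
          simp only [signDot, hx, sum_mul, sum_div]
          exact sum_congr rfl fun j _ => by ring
        rw [e3, div_pow, Real.sq_sqrt (hz0 b), hl]
        rcases (hz0 b).eq_or_lt with h | h
        · simp [hD0 b _ h.symm]
        · field_simp
      have h3 := exp_sum_le univ (fun b => z b / Z)
        (fun b => (1 / 4) * ∑ a, signDot (x b a) (Function.uncurry R) ^ 2)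
        (fun b _ => div_nonneg (hz0 b) hZ0) (by rw [← sum_div, div_self hpos.ne'])
      rw [← h2] at h3
      calc _ ≤ Real.exp (16 * θ ^ 2 / m ^ 2 * Z + l * ‖crossGram u R R'‖ ^ 2) :=
            Real.exp_le_exp.2 h1
        _ = _ := Real.exp_add _ _
        _ ≤ _ := mul_le_mul_of_nonneg_left h3 (Real.exp_pos _).le
    refine (expect_le_expect fun R _ => hbound R).trans ?_
    rw [← mul_expect, expect_sum_comm, add_comm, Real.exp_add]
    refine mul_le_mul_of_nonneg_left ?_ (Real.exp_pos _).le
    calc _ ≤ ∑ b, z b / Z * Real.exp ((∑ i, ∑ j, u i j ^ 2) / 2) := by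
          refine sum_le_sum fun b _ => ?_
          rw [← mul_expect]
          refine mul_le_mul_of_nonneg_left ?_ (div_nonneg (hz0 b) hZ0)
          rw [expect_uncurry fun σ => Real.exp ((1 / 4) * ∑ a, signDot (x b a) σ ^ 2)]
          refine (expect_exp_sum_sq_le (x b) (by norm_num) (fun a => ?_) fun a a' h => ?_).trans ?_
          · have := (hxn b a).trans (hu a)
            linarith
          · rw [hxx, horth a a' h, zero_mul]
          · refine Real.exp_le_exp.2 ?_
            have := sum_le_sum fun a (_ : a ∈ univ) => hxn b a
            linarith
      _ = _ := by rw [← sum_mul, ← sum_div, div_self hpos.ne', one_mul]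

/-- Exponential moment of the Frobenius norm of the Gram matrix error, for a matrix of operator norm
at most `1`. It depends on the dimensions only through the squared Frobenius norm of the matrix. -/
theorem expect_exp_norm_gramErr_le [DecidableEq J] (hm : 0 < m) (u : ι → J → ℝ)
    (hu : ∀ i, ∑ j, u i j ^ 2 ≤ 1) (horth : ∀ i i', i ≠ i' → ∑ j, u i j * u i' j = 0)
    {θ : ℝ} (hθ : 0 ≤ θ) (hθm : θ ≤ m / 8) :
    𝔼 R : Fin m → J → ℤˣ, Real.exp (θ * ‖gramErr u R‖) ≤
      Real.exp ((∑ i, ∑ j, u i j ^ 2) * (1 / 2 + 32 * θ ^ 2 / m)) := by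
  classical
  have hm' : (0 : ℝ) < m := by positivity
  set K := ∑ i, ∑ j, u i j ^ 2 with hK
  refine (expect_exp_gramErr_le hm u hθ).trans
    ((expect_le_expect fun R' _ => expect_exp_crossGram_le hm u hu horth θ R').trans ?_)
  set l : ℝ := 16 * θ ^ 2 / m ^ 2 with hl
  have hl0 : 0 ≤ l := by positivity
  have hl4 : l ≤ 1 / 4 := by
    rw [hl, div_le_iff₀ (by positivity)]
    nlinarith
  simp_rw [Real.exp_add]
  rw [← mul_expect, mul_add, Real.exp_add, mul_one_div]
  refine mul_le_mul_of_nonneg_left ?_ (Real.exp_pos _).le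
  set x : Fin m × ι → Fin m × J → ℝ := fun p q => if p.1 = q.1 then u p.2 q.2 else 0 with hx
  have e : ∀ (R' : Fin m → J → ℤˣ) (p : Fin m × ι),
      signDot (u p.2) (R' p.1) = signDot (x p) (Function.uncurry R') := fun R' p => by
    rw [signDot_uncurry, sum_eq_single p.1]
    · simp [hx]
    · intro r _ hr
      simp [hx, signDot, Ne.symm hr]
    · simp
  have hxx : ∀ p p', ∑ q, x p q * x p' q
      = if p.1 = p'.1 then ∑ j, u p.2 j * u p'.2 j else 0 := fun p p' => by
    rw [Fintype.sum_prod_type, sum_eq_single p.1]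
    · by_cases h : p.1 = p'.1
      · simp [hx, h]
      · simp [hx, h, Ne.symm h]
    · intro r _ hr
      simp [hx, Ne.symm hr]
    · simp
  have hxn : ∀ p, ∑ q, x p q ^ 2 = ∑ j, u p.2 j ^ 2 := fun p => by
    simpa [← pow_two] using hxx p p
  simp_rw [e]
  rw [expect_uncurry fun σ => Real.exp (l * ∑ p, signDot (x p) σ ^ 2)]
  refine (expect_exp_sum_sq_le x hl0 (fun p => ?_) fun p p' h => ?_).trans (le_of_eq ?_)
  · rw [hxn]
    nlinarith [hu p.2]
  · rw [hxx]
    split_ifs with h1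
    · exact horth _ _ fun h2 => h (Prod.ext h1 h2)
    · rfl
  · congr 1
    simp_rw [hxn]
    rw [Fintype.sum_prod_type]
    simp only [sum_const, card_univ, Fintype.card_fin, nsmul_eq_mul, ← hK, hl]
    field_simp
    ring

end Concentration

/-! ### Failure probabilities of a random sign matrix -/

section Events

variable {J : Type*} [Fintype J] {m : ℕ}

open Classical in
/-- The probability of an event under the uniform distribution on sign matrices. -/
noncomputable def signProb [DecidableEq J] (p : (Fin m → J → ℤˣ) → Prop) : ℝ :=
  𝔼 R : Fin m → J → ℤˣ, if p R then 1 else 0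

lemma signProb_mono [DecidableEq J] {p q : (Fin m → J → ℤˣ) → Prop} (h : ∀ R, p R → q R) :
    signProb p ≤ signProb q := by
  refine expect_le_expect fun R _ => ?_
  by_cases hp : p R
  · simp [hp, h R hp]
  · simp only [hp, if_false]
    split_ifs <;> norm_num

lemma signProb_or_le [DecidableEq J] (p q : (Fin m → J → ℤˣ) → Prop) :
    signProb (fun R => p R ∨ q R) ≤ signProb p + signProb q := by
  unfold signProb
  rw [← expect_add_distrib]
  refine expect_le_expect fun R _ => ?_
  by_cases hp : p R <;> by_cases hq : q R <;> simp [hp, hq]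

lemma signProb_exists_le [DecidableEq J] {κ : Type*} (s : Finset κ)
    (p : κ → (Fin m → J → ℤˣ) → Prop) {b : ℝ} (hb : ∀ z ∈ s, signProb (p z) ≤ b) :
    signProb (fun R => ∃ z ∈ s, p z R) ≤ #s * b := by
  rw [← nsmul_eq_mul]
  refine le_trans ?_ (sum_le_card_nsmul s (fun z => signProb (p z)) b hb)
  classical
  unfold signProb
  rw [← expect_sum_comm]
  refine expect_le_expect fun R _ => ?_
  split_ifs with h
  · obtain ⟨z, hz, hp⟩ := h
    refine le_trans (by simp [hp]) (single_le_sum (f := fun z => if p z R then (1 : ℝ) else 0)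
      (fun z _ => ?_) hz)
    split_ifs <;> norm_num
  · exact sum_nonneg fun z _ => by split_ifs <;> norm_num

lemma signProb_le_exp [DecidableEq J] {p : (Fin m → J → ℤˣ) → Prop}
    {f : (Fin m → J → ℤˣ) → ℝ} {θ s c : ℝ} (hθ : 0 ≤ θ) (hp : ∀ R, p R → s ≤ f R)
    (hf : 𝔼 R : Fin m → J → ℤˣ, Real.exp (θ * f R) ≤ Real.exp c) :
    signProb p ≤ Real.exp (c - θ * s) := by
  classical
  have h : ∀ R, (if p R then (1 : ℝ) else 0) ≤ Real.exp (-(θ * s)) * Real.exp (θ * f R) :=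
    fun R => by
      rw [← Real.exp_add]
      split_ifs with h
      · exact Real.one_le_exp (by nlinarith [mul_le_mul_of_nonneg_left (hp R h) hθ])
      · positivity
  refine (expect_le_expect fun R _ => h R).trans ?_
  rw [← mul_expect, sub_eq_neg_add, Real.exp_add]
  exact mul_le_mul_of_nonneg_left hf (Real.exp_pos _).le

/-- The error `⟨S v, S w⟩ - ⟨v, w⟩` of the sketch `S = R / √m` on the inner product of `v`, `w`. -/
noncomputable def innerErr (R : Fin m → J → ℤˣ) (v w : J → ℝ) : ℝ :=
  (1 / (m : ℝ)) * ∑ r, signDot v (R r) * signDot w (R r) - ∑ j, v j * w j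

lemma innerErr_comm (R : Fin m → J → ℤˣ) (v w : J → ℝ) : innerErr R v w = innerErr R w v := by
  simp only [innerErr, mul_comm]

lemma innerErr_smul_smul (R : Fin m → J → ℤˣ) (a b : ℝ) (v w : J → ℝ) :
    innerErr R (a • v) (b • w) = a * b * innerErr R v w := by
  simp only [innerErr, signDot_smul, Pi.smul_apply, smul_eq_mul, mul_sub, mul_sum]
  congr 1 <;> exact sum_congr rfl fun _ _ => by ring

lemma signDot_sum {κ : Type*} (s : Finset κ) (x : κ → ℝ) (u : κ → J → ℝ) (σ : J → ℤˣ) :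
    signDot (∑ i ∈ s, x i • u i) σ = ∑ i ∈ s, x i * signDot (u i) σ := by
  simp only [signDot, Finset.sum_apply, Pi.smul_apply, smul_eq_mul, sum_mul, mul_sum]
  rw [sum_comm]
  exact sum_congr rfl fun _ _ => sum_congr rfl fun _ _ => by ring

lemma innerErr_sum_sum {κ : Type*} (s : Finset κ) (R : Fin m → J → ℤˣ) (x y : κ → ℝ)
    (u : κ → J → ℝ) :
    innerErr R (∑ a ∈ s, x a • u a) (∑ b ∈ s, y b • u b)
      = ∑ a ∈ s, ∑ b ∈ s, x a * y b * innerErr R (u a) (u b) := by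
  simp only [innerErr, signDot_sum, mul_sub, sum_sub_distrib]
  congr 1
  · simp_rw [sum_mul_sum, mul_sum]
    rw [sum_comm]
    refine sum_congr rfl fun a _ => ?_
    rw [sum_comm]
    exact sum_congr rfl fun b _ => sum_congr rfl fun r _ => by ring
  · simp only [Finset.sum_apply, Pi.smul_apply, smul_eq_mul]
    simp_rw [sum_mul_sum, mul_sum]
    rw [sum_comm]
    refine sum_congr rfl fun a _ => ?_
    rw [sum_comm]
    exact sum_congr rfl fun b _ => sum_congr rfl fun r _ => by ring

lemma norm_gramErr_sq {ι : Type*} [Fintype ι] (u : ι → J → ℝ) (R : Fin m → J → ℤˣ) :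
    ‖gramErr u R‖ ^ 2 = ∑ a, ∑ b, innerErr R (u a) (u b) ^ 2 := by
  rw [EuclideanSpace.norm_sq_eq, Fintype.sum_prod_type]
  simp [gramErr, crossGram, innerErr]

/-- The Gram matrix error has Frobenius norm at most `δ √k` outside a small event. -/
lemma signProb_gramErr_le [DecidableEq J] {ι : Type*} [Fintype ι] (hm : 0 < m) (u : ι → J → ℝ)
    (hu : ∀ i, ∑ j, u i j ^ 2 ≤ 1) (horth : ∀ i i', i ≠ i' → ∑ j, u i j * u i' j = 0)
    {k : ℕ} (hk : 1 ≤ k) (hK : ∑ i, ∑ j, u i j ^ 2 ≤ 4 * k) {δ : ℝ} (hδ : 0 < δ) (hδ1 : δ ≤ 1) :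
    signProb (fun R : Fin m → J → ℤˣ =>
      ¬ ∑ a, ∑ b, innerErr R (u a) (u b) ^ 2 ≤ δ ^ 2 * k) ≤
      Real.exp (2 * k - m * δ ^ 2 / 512) := by
  have hm' : (0 : ℝ) < m := by positivity
  have hk' : (1 : ℝ) ≤ k := by exact_mod_cast hk
  have hsk : 1 ≤ √(k : ℝ) := Real.one_le_sqrt.2 hk'
  have hsk2 : √(k : ℝ) ^ 2 = k := Real.sq_sqrt (by linarith)
  set θ : ℝ := m * δ / (256 * √(k : ℝ)) with hθ
  have hθ0 : 0 ≤ θ := by positivity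
  have hθm : θ ≤ m / 8 := by
    rw [hθ, div_le_div_iff₀ (by positivity) (by positivity)]
    nlinarith [mul_pos hm' hδ]
  have hθ2 : θ ^ 2 = m ^ 2 * δ ^ 2 / (65536 * k) := by
    rw [hθ, div_pow, mul_pow, mul_pow, hsk2]; norm_num
  have h := expect_exp_norm_gramErr_le hm u hu horth hθ0 hθm
  refine (signProb_le_exp (s := δ * √(k : ℝ)) hθ0 (fun R hR => ?_)
    (h.trans (Real.exp_le_exp.2 (mul_le_mul_of_nonneg_right hK (by positivity))))).trans
    (Real.exp_le_exp.2 (le_of_eq ?_))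
  · rw [← norm_gramErr_sq, not_le] at hR
    refine le_of_lt (lt_of_pow_lt_pow_left₀ 2 (norm_nonneg _) ?_)
    rwa [mul_pow, hsk2]
  · have e1 : θ * (δ * √(k : ℝ)) = m * δ ^ 2 / 256 := by
      rw [hθ]; field_simp
    rw [e1, hθ2]
    field_simp
    ring

/-- The squared Frobenius norm of a fixed matrix, with columns `M c`, is preserved up to a factor
`1 ± s` outside a small event. Jensen's inequality over the columns reduces this to one vector. -/
lemma signProb_sum_innerErr_le [DecidableEq J] {ι : Type*} [Fintype ι] (hm : 0 < m)
    (M : ι → J → ℝ) {s : ℝ} (hs : 0 ≤ s) (hs8 : s ≤ 8) :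
    signProb (fun R : Fin m → J → ℤˣ =>
      ¬ |∑ c, innerErr R (M c) (M c)| ≤ s * ∑ c, ∑ j, M c j ^ 2) ≤
      Real.exp (1 / 2 - m * s ^ 2 / 128) := by
  have hm' : (0 : ℝ) < m := by positivity
  set z : ι → ℝ := fun c => ∑ j, M c j ^ 2 with hz
  set T : ℝ := ∑ c, z c with hT
  have hz0 : ∀ c, 0 ≤ z c := fun c => sum_nonneg fun j _ => sq_nonneg _
  have hT0 : 0 ≤ T := sum_nonneg fun c _ => hz0 c
  have hM0 : ∀ c, z c = 0 → M c = 0 := fun c h => by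
    funext j
    have h2 := (sum_eq_zero_iff_of_nonneg fun j _ => sq_nonneg (M c j)).1 h j (mem_univ _)
    simpa using h2
  rcases hT0.eq_or_lt with h0 | hpos
  · have : ∀ c, M c = 0 := fun c =>
      hM0 c ((sum_eq_zero_iff_of_nonneg fun c _ => hz0 c).1 h0.symm c (mem_univ _))
    have e : signProb (fun R : Fin m → J → ℤˣ =>
        ¬ |∑ c, innerErr R (M c) (M c)| ≤ s * T) = 0 := by
      unfold signProb
      refine expect_eq_zero fun R _ => ?_
      rw [if_neg]
      simp [this, innerErr, signDot, ← h0]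
    rw [e]
    positivity
  set v : ι → J → ℝ := fun c => (1 / √(z c)) • M c with hv
  have hvn : ∀ c, ∑ j, v c j ^ 2 ≤ 1 := fun c => by
    simp only [hv, Pi.smul_apply, smul_eq_mul, mul_pow, ← mul_sum, div_pow, one_pow,
      Real.sq_sqrt (hz0 c)]
    rw [one_div, inv_mul_eq_div]
    exact div_self_le_one _
  have hMv : ∀ (R : Fin m → J → ℤˣ) c, innerErr R (M c) (M c) = z c * innerErr R (v c) (v c) :=
    fun R c => by
      rcases (hz0 c).eq_or_lt with h | h
      · rw [← h, hM0 c h.symm]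
        simp [innerErr, signDot]
      · have : M c = √(z c) • v c := by
          rw [hv]
          simp only [smul_smul]
          rw [mul_one_div_cancel (Real.sqrt_pos.2 h).ne', one_smul]
        conv_lhs => rw [this]
        rw [innerErr_smul_smul, Real.mul_self_sqrt (hz0 c)]
  set θ : ℝ := m * s / 64 with hθ
  have hθ0 : 0 ≤ θ := by positivity
  have hθm : θ ≤ m / 8 := by
    rw [hθ]
    nlinarith
  have hnorm : ∀ (w : J → ℝ) (R : Fin m → J → ℤˣ),
      ‖gramErr (fun _ : Unit => w) R‖ = |innerErr R w w| := fun w R => by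
    have := norm_gramErr_sq (fun _ : Unit => w) R
    simp only [univ_unique, sum_const, card_singleton, one_smul] at this
    rw [← abs_of_nonneg (norm_nonneg (gramErr (fun _ : Unit => w) R))]
    exact (sq_eq_sq_iff_abs_eq_abs _ _).1 this
  have hone : ∀ c, 𝔼 R : Fin m → J → ℤˣ, Real.exp (θ * |innerErr R (v c) (v c)|) ≤
      Real.exp (1 / 2 + 32 * θ ^ 2 / m) := fun c => by
    have h := expect_exp_norm_gramErr_le hm (fun _ : Unit => v c) (fun _ => hvn c)
      (fun i i' h => absurd (Subsingleton.elim i i') h) hθ0 hθm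
    simp_rw [hnorm] at h
    refine h.trans (Real.exp_le_exp.2 ?_)
    simp only [univ_unique, sum_const, card_singleton, one_smul]
    exact mul_le_of_le_one_left (by positivity) (hvn c)
  have hexp : 𝔼 R : Fin m → J → ℤˣ, Real.exp (θ * (|∑ c, innerErr R (M c) (M c)| / T)) ≤
      Real.exp (1 / 2 + 32 * θ ^ 2 / m) := by
    have h1 : ∀ R : Fin m → J → ℤˣ, Real.exp (θ * (|∑ c, innerErr R (M c) (M c)| / T)) ≤
        ∑ c, z c / T * Real.exp (θ * |innerErr R (v c) (v c)|) := fun R => by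
      refine le_trans (Real.exp_le_exp.2 ?_) (exp_sum_le univ (fun c => z c / T)
        (fun c => θ * |innerErr R (v c) (v c)|) (fun c _ => div_nonneg (hz0 c) hT0)
        (by rw [← sum_div, div_self hpos.ne']))
      have h2 : |∑ c, innerErr R (M c) (M c)| ≤ ∑ c, z c * |innerErr R (v c) (v c)| := by
        refine (abs_sum_le_sum_abs _ _).trans (le_of_eq (sum_congr rfl fun c _ => ?_))
        rw [hMv, abs_mul, abs_of_nonneg (hz0 c)]
      calc _ ≤ θ * ((∑ c, z c * |innerErr R (v c) (v c)|) / T) := by gcongr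
        _ = _ := by
          rw [sum_div, mul_sum]
          exact sum_congr rfl fun c _ => by ring
    refine (expect_le_expect fun R _ => h1 R).trans ?_
    rw [expect_sum_comm]
    calc _ ≤ ∑ c, z c / T * Real.exp (1 / 2 + 32 * θ ^ 2 / m) := by
          refine sum_le_sum fun c _ => ?_
          rw [← mul_expect]
          exact mul_le_mul_of_nonneg_left (hone c) (div_nonneg (hz0 c) hT0)
      _ = _ := by rw [← sum_mul, ← sum_div, div_self hpos.ne', one_mul]
  refine (signProb_le_exp (s := s) hθ0 (fun R hR => ?_) hexp).trans
    (Real.exp_le_exp.2 (le_of_eq ?_))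
  · rw [not_le] at hR
    rw [le_div_iff₀ hpos]
    exact hR.le
  · rw [hθ]
    field_simp
    ring

end Events

/-! ### A lattice net for quadratic forms -/

section Net

variable {H : Type*} [Fintype H]

/-- The quadratic form of a matrix. -/
def quad (G : H → H → ℝ) (x : H → ℝ) : ℝ := ∑ a, ∑ b, x a * x b * G a b

lemma quad_smul (G : H → H → ℝ) (c : ℝ) (x : H → ℝ) : quad G (c • x) = c ^ 2 * quad G x := by
  simp only [quad, mul_sum, Pi.smul_apply, smul_eq_mul]
  exact sum_congr rfl fun _ _ => sum_congr rfl fun _ _ => by ring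

/-- A quadratic form that is bounded by `b` at the points of the lattice `(2 √h)⁻¹ ℤ^h` in a ball
is bounded on the unit ball: a point `x` of the unit ball is within `1 / 4` of a lattice point `y`,
and the difference of the values at `x` and `y` is bounded by the supremum over the ball, with a
constant less than `1`. -/
lemma abs_quad_le_of_net (G : H → H → ℝ) (hG : ∀ a b, G a b = G b a) {b : ℝ}
    (hb : ∀ z : H → ℤ, ∑ a, z a ^ 2 ≤ 7 * (Fintype.card H : ℤ) →
      |quad G (fun a => (z a : ℝ) / (2 * √(Fintype.card H : ℝ)))| ≤ b) (x : H → ℝ) :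
    |quad G x| ≤ 16 / 7 * b * ∑ a, x a ^ 2 := by
  set h : ℝ := (Fintype.card H : ℝ) with hh
  set S : Set ℝ := {t | ∃ x : H → ℝ, ∑ a, x a ^ 2 ≤ 1 ∧ t = |quad G x|} with hS
  have hbdd : BddAbove S := by
    refine ⟨∑ a, ∑ b, |G a b|, ?_⟩
    rintro t ⟨x, hx, rfl⟩
    have hx1 : ∀ a, |x a| ≤ 1 := fun a => by
      rw [← sq_le_one_iff_abs_le_one]
      exact (single_le_sum (f := fun a => x a ^ 2) (fun a _ => sq_nonneg _) (mem_univ a)).trans hx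
    refine (abs_sum_le_sum_abs _ _).trans (sum_le_sum fun a _ =>
      (abs_sum_le_sum_abs _ _).trans (sum_le_sum fun c _ => ?_))
    rw [abs_mul, abs_mul]
    refine mul_le_of_le_one_left (abs_nonneg _) ?_
    exact mul_le_one₀ (hx1 a) (abs_nonneg _) (hx1 c)
  have hne : S.Nonempty := ⟨_, 0, by simp, rfl⟩
  set M := sSup S with hM
  have hM1 : ∀ x : H → ℝ, ∑ a, x a ^ 2 ≤ 1 → |quad G x| ≤ M := fun x hx =>
    le_csSup hbdd ⟨x, hx, rfl⟩
  have hMhom : ∀ x : H → ℝ, |quad G x| ≤ M * ∑ a, x a ^ 2 := fun x => by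
    have hn : 0 ≤ ∑ a, x a ^ 2 := sum_nonneg fun a _ => sq_nonneg _
    rcases hn.eq_or_lt with h0 | hpos
    · have : x = 0 := by
        funext a
        have h2 := (sum_eq_zero_iff_of_nonneg fun a _ => sq_nonneg (x a)).1 h0.symm a (mem_univ _)
        simpa using h2
      simp [this, quad]
    · set c := √(∑ a, x a ^ 2) with hc
      have hc2 : c ^ 2 = ∑ a, x a ^ 2 := Real.sq_sqrt hn
      have hcp : 0 < c := Real.sqrt_pos.2 hpos
      have h1 := hM1 (c⁻¹ • x) (by
        simp only [Pi.smul_apply, smul_eq_mul, mul_pow, ← mul_sum, ← hc2]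
        rw [← mul_pow, inv_mul_cancel₀ hcp.ne', one_pow])
      rw [quad_smul, abs_mul, abs_of_nonneg (by positivity), inv_pow, hc2,
        inv_mul_le_iff₀ hpos] at h1
      linarith
  have hstep : M ≤ b + 9 / 16 * M := by
    refine csSup_le hne ?_
    rintro t ⟨x, hx, rfl⟩
    set z : H → ℤ := fun a => round (2 * √h * x a) with hz
    set y : H → ℝ := fun a => (z a : ℝ) / (2 * √h) with hy
    have hM0 : 0 ≤ M := (abs_nonneg _).trans (hM1 0 (by simp))
    have he : ∀ a, (x a - y a) ^ 2 ≤ 1 / (16 * h) := fun a => by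
      have hpos : 0 < h := by
        rw [hh]
        exact_mod_cast Fintype.card_pos_iff.2 ⟨a⟩
      have hs : 0 < √h := Real.sqrt_pos.2 hpos
      have h1 : |2 * √h * x a - z a| ≤ 1 / 2 := abs_sub_round _
      have h2 : x a - y a = (2 * √h * x a - z a) / (2 * √h) := by
        rw [hy]; field_simp
      rw [h2, div_pow, mul_pow, Real.sq_sqrt hpos.le]
      have h3 := sq_le_sq' (abs_le.1 h1).1 (abs_le.1 h1).2
      rw [div_le_div_iff₀ (by positivity) (by positivity)]
      nlinarith
    have hesum : ∑ a, (x a - y a) ^ 2 ≤ 1 / 16 := by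
      refine (sum_le_card_nsmul univ _ _ fun a _ => he a).trans ?_
      rw [card_univ, nsmul_eq_mul, ← hh]
      rcases (show 0 ≤ h by positivity).eq_or_lt with h0 | h0
      · rw [← h0]; norm_num
      · rw [mul_one_div, div_le_div_iff₀ (by positivity) (by norm_num)]
        linarith
    have hysum : ∑ a, y a ^ 2 ≤ 25 / 16 := by
      have : ∑ a, y a ^ 2 ≤ ∑ a, (5 / 4 * x a ^ 2 + 5 * (x a - y a) ^ 2) :=
        sum_le_sum fun a _ => by nlinarith [sq_nonneg (x a / 2 - 2 * (y a - x a))]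
      rw [sum_add_distrib, ← mul_sum, ← mul_sum] at this
      linarith
    have hwsum : ∑ a, (x a + y a) ^ 2 ≤ 81 / 16 := by
      have : ∑ a, (x a + y a) ^ 2 ≤ ∑ a, (9 / 2 * x a ^ 2 + 9 * (x a - y a) ^ 2) :=
        sum_le_sum fun a _ => by nlinarith [sq_nonneg (x a + 4 * (x a - y a))]
      rw [sum_add_distrib, ← mul_sum, ← mul_sum] at this
      linarith
    have hyz : |quad G y| ≤ b := by
      refine hb z ?_
      rcases (show 0 ≤ h by positivity).eq_or_lt with h0 | h0
      · have : IsEmpty H := Fintype.card_eq_zero_iff.1 (by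
          rw [hh] at h0
          exact_mod_cast h0.symm)
        simp
      · have hs : 0 < √h := Real.sqrt_pos.2 h0
        have h1 : ∑ a, y a ^ 2 = (∑ a, (z a : ℝ) ^ 2) / (4 * h) := by
          rw [sum_div]
          refine sum_congr rfl fun a _ => ?_
          simp only [hy]
          rw [div_pow, mul_pow, Real.sq_sqrt h0.le]
          norm_num
        rw [h1, div_le_iff₀ (by positivity)] at hysum
        have h2 : ∑ a, (z a : ℝ) ^ 2 ≤ 7 * h := by nlinarith
        rw [hh] at h2
        exact_mod_cast h2
    have hpol : quad G x = quad G y + 1 / 4 * (quad G (fun a => 3 * (x a - y a) + (x a + y a) / 3)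
        - quad G (fun a => 3 * (x a - y a) - (x a + y a) / 3)) := by
      have hsw : ∑ a, ∑ c, x a * y c * G a c = ∑ a, ∑ c, y a * x c * G a c := by
        rw [sum_comm]
        exact sum_congr rfl fun a _ => sum_congr rfl fun c _ => by rw [hG]; ring
      have : quad G x - quad G y - 1 / 4 * (quad G (fun a => 3 * (x a - y a) + (x a + y a) / 3)
        - quad G (fun a => 3 * (x a - y a) - (x a + y a) / 3))
          = ∑ a, ∑ c, y a * x c * G a c * 0 := by
        simp only [quad, mul_sum, ← sum_sub_distrib, mul_zero, sum_const_zero]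
        have e : ∀ a c, x a * x c * G a c - y a * y c * G a c -
            (1 / 4 * ((3 * (x a - y a) + (x a + y a) / 3) * (3 * (x c - y c) + (x c + y c) / 3)
              * G a c) - 1 / 4 * ((3 * (x a - y a) - (x a + y a) / 3)
              * (3 * (x c - y c) - (x c + y c) / 3) * G a c)) = 0 := fun a c => by ring
        first
          | simp only [e, sum_const_zero]
          | (refine sum_eq_zero fun a _ => sum_eq_zero fun c _ => ?_
             ring)
      simp only [mul_zero, sum_const_zero] at this
      linarith
    have h1 := hMhom (fun a => 3 * (x a - y a) + (x a + y a) / 3)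
    have h2 := hMhom (fun a => 3 * (x a - y a) - (x a + y a) / 3)
    have h3 : ∑ a, (3 * (x a - y a) + (x a + y a) / 3) ^ 2
        + ∑ a, (3 * (x a - y a) - (x a + y a) / 3) ^ 2 ≤ 9 / 4 := by
      rw [← sum_add_distrib]
      have : ∀ a, (3 * (x a - y a) + (x a + y a) / 3) ^ 2 + (3 * (x a - y a) - (x a + y a) / 3) ^ 2
          = 18 * (x a - y a) ^ 2 + 2 / 9 * (x a + y a) ^ 2 := fun a => by ring
      simp_rw [this]
      rw [sum_add_distrib, ← mul_sum, ← mul_sum]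
      linarith
    have h4 : |quad G x| ≤ |quad G y|
        + 1 / 4 * (|quad G (fun a => 3 * (x a - y a) + (x a + y a) / 3)|
        + |quad G (fun a => 3 * (x a - y a) - (x a + y a) / 3)|) := by
      rw [hpol]
      refine (abs_add_le _ _).trans (add_le_add le_rfl ?_)
      rw [abs_mul, abs_of_pos (by norm_num : (0 : ℝ) < 1 / 4)]
      exact mul_le_mul_of_nonneg_left (abs_sub _ _) (by norm_num)
    nlinarith [mul_le_mul_of_nonneg_left h3 hM0]
  have hMb : M ≤ 16 / 7 * b := by linarith
  exact (hMhom x).trans (mul_le_mul_of_nonneg_right hMb (sum_nonneg fun a _ => sq_nonneg _))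

lemma sum_exp_neg_sq_le (B : ℕ) :
    ∑ b ∈ Finset.Icc (-(B : ℤ)) B, Real.exp (-((b : ℝ) ^ 2)) ≤ Real.exp 2 := by
  have h1 : ∀ b : ℕ, Real.exp (-((b : ℝ) ^ 2)) ≤ (1 / 2 : ℝ) ^ b := fun b => by
    have h2 : Real.exp (-1) ≤ 1 / 2 := by
      have := Real.exp_neg_one_lt_half
      linarith
    calc Real.exp (-((b : ℝ) ^ 2)) ≤ Real.exp (b * (-1)) := by
          refine Real.exp_le_exp.2 ?_
          have : (b : ℝ) ≤ (b : ℝ) ^ 2 := by exact_mod_cast Nat.le_self_pow two_ne_zero b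
          linarith
      _ = Real.exp (-1) ^ b := by rw [Real.exp_nat_mul]
      _ ≤ _ := pow_le_pow_left₀ (Real.exp_pos _).le h2 b
  have h3 : ∑ b ∈ range (B + 1), Real.exp (-((b : ℝ) ^ 2)) ≤ 2 :=
    (sum_le_sum fun b _ => h1 b).trans (sum_geometric_two_le _)
  have hsub : Finset.Icc (-(B : ℤ)) B ⊆ (range (B + 1)).image (fun n : ℕ => (n : ℤ))
      ∪ (range (B + 1)).image (fun n : ℕ => -(n : ℤ)) := by
    intro b hb
    rw [Finset.mem_Icc] at hb
    simp only [mem_union, mem_image, mem_range]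
    rcases le_total 0 b with h | h
    · exact Or.inl ⟨b.toNat, by omega, by omega⟩
    · exact Or.inr ⟨(-b).toNat, by omega, by omega⟩
  calc _ ≤ ∑ b ∈ (range (B + 1)).image (fun n : ℕ => (n : ℤ))
        ∪ (range (B + 1)).image (fun n : ℕ => -(n : ℤ)), Real.exp (-((b : ℝ) ^ 2)) :=
        sum_le_sum_of_subset_of_nonneg hsub fun _ _ _ => (Real.exp_pos _).le
    _ ≤ ∑ b ∈ (range (B + 1)).image (fun n : ℕ => (n : ℤ)), Real.exp (-((b : ℝ) ^ 2))
        + ∑ b ∈ (range (B + 1)).image (fun n : ℕ => -(n : ℤ)), Real.exp (-((b : ℝ) ^ 2)) := by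
        rw [← sum_union_inter]
        exact le_add_of_nonneg_right (sum_nonneg fun _ _ => (Real.exp_pos _).le)
    _ ≤ 2 + 2 := by
        refine add_le_add ?_ ?_
        · rw [sum_image (by intro a _ b _ h; simpa using h)]
          simpa using h3
        · rw [sum_image (by intro a _ b _ h; simpa using h)]
          simpa using h3
    _ ≤ Real.exp 2 := by
        have := Real.add_one_le_exp (1 : ℝ)
        have e : Real.exp 2 = Real.exp 1 * Real.exp 1 := by rw [← Real.exp_add]; norm_num
        nlinarith

variable (H) in
/-- The integer points `z` with `‖z‖² ≤ 7 h`, in dimension `h`. -/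
noncomputable def latticeNet [DecidableEq H] : Finset (H → ℤ) :=
  (Fintype.piFinset fun _ : H =>
    Finset.Icc (-((7 * Fintype.card H : ℕ) : ℤ)) ((7 * Fintype.card H : ℕ) : ℤ)).filter
    fun z => ∑ a, z a ^ 2 ≤ 7 * (Fintype.card H : ℤ)

lemma mem_latticeNet [DecidableEq H] (z : H → ℤ) :
    z ∈ latticeNet H ↔ ∑ a, z a ^ 2 ≤ 7 * (Fintype.card H : ℤ) := by
  refine ⟨fun h => (mem_filter.1 h).2, fun h => mem_filter.2 ⟨?_, h⟩⟩
  rw [Fintype.mem_piFinset]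
  intro a
  have h1 : z a ^ 2 ≤ 7 * (Fintype.card H : ℤ) :=
    (single_le_sum (f := fun a => z a ^ 2) (fun a _ => sq_nonneg _) (mem_univ a)).trans h
  have h2 : |z a| ≤ z a ^ 2 := by
    rw [← sq_abs]
    exact Int.le_self_sq _
  rw [Finset.mem_Icc]
  have := abs_le.1 (h2.trans h1)
  push_cast
  exact this

/-- The size of the net is estimated by the exponential moment `∑ z, exp (-‖z‖²)`. -/
lemma card_latticeNet_le [DecidableEq H] :
    (#(latticeNet H) : ℝ) ≤ Real.exp (9 * Fintype.card H) := by
  set h := Fintype.card H with hh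
  set I := Finset.Icc (-((7 * h : ℕ) : ℤ)) ((7 * h : ℕ) : ℤ) with hI
  have h1 : (#(latticeNet H) : ℝ) ≤
      ∑ z ∈ Fintype.piFinset fun _ : H => I, Real.exp (7 * h) * ∏ a, Real.exp (-((z a : ℝ) ^ 2)) := by
    rw [card_eq_sum_ones, Nat.cast_sum]
    refine le_trans (sum_le_sum fun z hz => ?_) (sum_le_sum_of_subset_of_nonneg
      (filter_subset _ _) fun _ _ _ => mul_nonneg (Real.exp_pos _).le
        (prod_nonneg fun _ _ => (Real.exp_pos _).le))
    rw [← Real.exp_sum, ← Real.exp_add, Nat.cast_one]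
    refine Real.one_le_exp ?_
    have h2 : ∑ a, (z a : ℝ) ^ 2 ≤ 7 * (h : ℝ) := by
      exact_mod_cast (mem_latticeNet z).1 hz
    rw [sum_neg_distrib]
    linarith
  refine h1.trans ?_
  rw [← mul_sum, sum_prod_piFinset I fun (_ : H) (b : ℤ) => Real.exp (-((b : ℝ) ^ 2)),
    prod_const, card_univ, ← hh]
  calc _ ≤ Real.exp (7 * h) * Real.exp 2 ^ h := by
        refine mul_le_mul_of_nonneg_left ?_ (Real.exp_pos _).le
        exact pow_le_pow_left₀ (sum_nonneg fun _ _ => (Real.exp_pos _).le) (sum_exp_neg_sq_le _) _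
    _ = _ := by
        rw [← Real.exp_nat_mul, ← Real.exp_add]
        ring_nf

/-- The sketch is a subspace embedding: outside a small event it preserves the squared norms of all
combinations of `h` orthogonal vectors of norm at most `1`, up to an error `δ`. -/
lemma signProb_quad_innerErr_le {J : Type*} [Fintype J] [DecidableEq J] {m : ℕ} (hm : 0 < m)
    (u : H → J → ℝ) (hu : ∀ i, ∑ j, u i j ^ 2 ≤ 1)
    (horth : ∀ i i', i ≠ i' → ∑ j, u i j * u i' j = 0) {δ : ℝ} (hδ : 0 ≤ δ) (hδ1 : δ ≤ 1) :
    signProb (fun R : Fin m → J → ℤˣ =>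
      ¬ ∀ x : H → ℝ, |quad (fun a b => innerErr R (u a) (u b)) x| ≤ δ * ∑ a, x a ^ 2) ≤
      Real.exp (9 * Fintype.card H + 1 / 2 - m * δ ^ 2 / 2048) := by
  classical
  set h : ℝ := (Fintype.card H : ℝ) with hh
  set v : (H → ℤ) → J → ℝ := fun z => ∑ a, ((z a : ℝ) / (2 * √h)) • u a with hv
  have hvn : ∀ z ∈ latticeNet H, ∑ j, v z j ^ 2 ≤ 7 / 4 := fun z hz => by
    have e : ∑ j, v z j ^ 2 = ∑ a, ((z a : ℝ) / (2 * √h)) ^ 2 * ∑ j, u a j ^ 2 := by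
      have e1 : ∀ j, v z j ^ 2 = ∑ a, ∑ b, ((z a : ℝ) / (2 * √h)) * ((z b : ℝ) / (2 * √h))
          * (u a j * u b j) := fun j => by
        simp only [hv, Finset.sum_apply, Pi.smul_apply, smul_eq_mul, pow_two]
        rw [sum_mul_sum]
        exact sum_congr rfl fun _ _ => sum_congr rfl fun _ _ => by ring
      simp_rw [e1]
      rw [sum_comm]
      refine sum_congr rfl fun a _ => ?_
      rw [sum_comm]
      simp_rw [← mul_sum]
      rw [sum_eq_single a]
      · simp_rw [← pow_two]
      · intro b _ hb
        rw [horth a b hb.symm, mul_zero]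
      · simp
    have h7 : ∑ a, (z a : ℝ) ^ 2 ≤ 7 * h := by
      rw [hh]
      exact_mod_cast (mem_latticeNet z).1 hz
    rw [e]
    calc _ ≤ ∑ a, ((z a : ℝ) / (2 * √h)) ^ 2 :=
          sum_le_sum fun a _ => mul_le_of_le_one_right (sq_nonneg _) (hu a)
      _ = (∑ a, (z a : ℝ) ^ 2) / (4 * h) := by
          rw [sum_div]
          refine sum_congr rfl fun a _ => ?_
          rw [div_pow, mul_pow, Real.sq_sqrt (by positivity)]
          norm_num
      _ ≤ 7 / 4 := by
          rcases (show 0 ≤ h by positivity).eq_or_lt with h0 | h0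
          · rw [← h0]; norm_num
          · rw [div_le_div_iff₀ (by positivity) (by norm_num)]
            linarith
  have hquad : ∀ (R : Fin m → J → ℤˣ) (z : H → ℤ), quad (fun a b => innerErr R (u a) (u b))
      (fun a => (z a : ℝ) / (2 * √h)) = innerErr R (v z) (v z) := fun R z => by
    rw [hv, innerErr_sum_sum]
    rfl
  refine (signProb_mono (q := fun R => ∃ z ∈ latticeNet H,
    ¬ |∑ _c : Unit, innerErr R (v z) (v z)| ≤ δ / 4 * ∑ _c : Unit, ∑ j, v z j ^ 2)
    fun R hR => ?_).trans ?_
  · by_contra! hcon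
    refine hR fun x => ?_
    refine (abs_quad_le_of_net _ (fun a b => innerErr_comm R _ _) (b := 7 / 16 * δ)
      (fun z hz => ?_) x).trans (le_of_eq (by ring))
    have hz' := (mem_latticeNet z).2 hz
    have h1 := hcon z hz'
    simp only [univ_unique, sum_const, card_singleton, one_smul] at h1
    rw [hquad]
    refine h1.trans ?_
    nlinarith [hvn z hz']
  · refine (signProb_exists_le _ _ fun z _ => signProb_sum_innerErr_le hm (fun _ : Unit => v z)
      (by positivity : 0 ≤ δ / 4) (by linarith)).trans ?_
    calc _ ≤ Real.exp (9 * h) * Real.exp (1 / 2 - m * (δ / 4) ^ 2 / 128) :=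
          mul_le_mul_of_nonneg_right card_latticeNet_le (Real.exp_pos _).le
      _ = _ := by
          rw [← Real.exp_add]
          ring_nf

end Net

/-! ### The Frobenius norm and the cost of a projection -/

lemma frob_nonneg {p q : ℕ} (M : Matrix (Fin p) (Fin q) ℝ) : 0 ≤ frob M := Real.sqrt_nonneg _

lemma frob_sq {p q : ℕ} (M : Matrix (Fin p) (Fin q) ℝ) : frob M ^ 2 = ∑ i, ∑ j, M i j ^ 2 :=
  Real.sq_sqrt (sum_nonneg fun _ _ => sum_nonneg fun _ _ => sq_nonneg _)

lemma frob_eq_norm {p q : ℕ} (M : Matrix (Fin p) (Fin q) ℝ) :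
    frob M = ‖(WithLp.toLp 2 fun r : Fin p × Fin q => M r.1 r.2 :
      EuclideanSpace ℝ (Fin p × Fin q))‖ := by
  rw [EuclideanSpace.norm_eq, frob, Fintype.sum_prod_type]
  simp

lemma frob_add_le {p q : ℕ} (M N : Matrix (Fin p) (Fin q) ℝ) :
    frob (M + N) ≤ frob M + frob N := by
  simp only [frob_eq_norm]
  exact norm_add_le (WithLp.toLp 2 fun r : Fin p × Fin q => M r.1 r.2 :
      EuclideanSpace ℝ (Fin p × Fin q)) (WithLp.toLp 2 fun r : Fin p × Fin q => N r.1 r.2)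

lemma frob_neg {p q : ℕ} (M : Matrix (Fin p) (Fin q) ℝ) : frob (-M) = frob M := by
  simp [frob]

lemma frob_sq_eq_trace {p q : ℕ} (M : Matrix (Fin p) (Fin q) ℝ) :
    frob M ^ 2 = (M * Mᵀ).trace := by
  rw [frob_sq]
  simp [Matrix.trace, Matrix.mul_apply, pow_two]

section Projection

variable {p d k : ℕ}

/-- The orthogonal projection onto the complement of the column span of `X`. -/
def coproj (X : Matrix (Fin d) (Fin k) ℝ) : Matrix (Fin d) (Fin d) ℝ := 1 - X * Xᵀ

lemma transpose_coproj (X : Matrix (Fin d) (Fin k) ℝ) : (coproj X)ᵀ = coproj X := by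
  simp [coproj]

lemma proj_mul_proj {X : Matrix (Fin d) (Fin k) ℝ} (hX : X ∈ Orthonormals d k) :
    X * Xᵀ * (X * Xᵀ) = X * Xᵀ := by
  have h : Xᵀ * X = 1 := hX
  rw [Matrix.mul_assoc, ← Matrix.mul_assoc Xᵀ, h, Matrix.one_mul]

lemma coproj_mul_coproj {X : Matrix (Fin d) (Fin k) ℝ} (hX : X ∈ Orthonormals d k) :
    coproj X * coproj X = coproj X := by
  simp only [coproj, Matrix.sub_mul, Matrix.mul_sub, proj_mul_proj hX, Matrix.one_mul,
    Matrix.mul_one]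
  abel

lemma trace_proj {X : Matrix (Fin d) (Fin k) ℝ} (hX : X ∈ Orthonormals d k) :
    ∑ c, (X * Xᵀ) c c = k := by
  have h : Xᵀ * X = 1 := hX
  have := Matrix.trace_mul_comm X Xᵀ
  rw [h, Matrix.trace_one, Fintype.card_fin] at this
  exact this

lemma proj_symm (X : Matrix (Fin d) (Fin k) ℝ) (a b : Fin d) :
    (X * Xᵀ) a b = (X * Xᵀ) b a := by
  simp [Matrix.mul_apply, mul_comm]

lemma sum_proj_sq {X : Matrix (Fin d) (Fin k) ℝ} (hX : X ∈ Orthonormals d k) (a : Fin d) :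
    ∑ b, (X * Xᵀ) a b ^ 2 = (X * Xᵀ) a a := by
  conv_rhs => rw [← proj_mul_proj hX, Matrix.mul_apply]
  exact sum_congr rfl fun b _ => by rw [pow_two, proj_symm X b a]

lemma coproj_symm (X : Matrix (Fin d) (Fin k) ℝ) (a b : Fin d) :
    coproj X a b = coproj X b a := by
  conv_lhs => rw [← transpose_coproj X, Matrix.transpose_apply]

lemma sum_coproj_mul {X : Matrix (Fin d) (Fin k) ℝ} (hX : X ∈ Orthonormals d k) (a b : Fin d) :
    ∑ c, coproj X a c * coproj X b c = coproj X a b := by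
  conv_rhs => rw [← coproj_mul_coproj hX, Matrix.mul_apply]
  exact sum_congr rfl fun c _ => by rw [coproj_symm X b c]

lemma coproj_diag_nonneg {X : Matrix (Fin d) (Fin k) ℝ} (hX : X ∈ Orthonormals d k) (a : Fin d) :
    0 ≤ coproj X a a := by
  rw [← sum_coproj_mul hX]
  exact sum_nonneg fun c _ => mul_self_nonneg _

lemma proj_diag_nonneg {X : Matrix (Fin d) (Fin k) ℝ} (hX : X ∈ Orthonormals d k) (a : Fin d) :
    0 ≤ (X * Xᵀ) a a := by
  rw [← sum_proj_sq hX]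
  exact sum_nonneg fun c _ => sq_nonneg _

lemma cost_eq (A : Matrix (Fin p) (Fin d) ℝ) (X : Matrix (Fin d) (Fin k) ℝ) :
    cost A X = frob (A * coproj X) := by
  rw [cost, coproj, Matrix.mul_sub, Matrix.mul_one, Matrix.mul_assoc]

lemma cost_nonneg (A : Matrix (Fin p) (Fin d) ℝ) (X : Matrix (Fin d) (Fin k) ℝ) :
    0 ≤ cost A X := frob_nonneg _

lemma cost_sq {X : Matrix (Fin d) (Fin k) ℝ} (hX : X ∈ Orthonormals d k)
    (A : Matrix (Fin p) (Fin d) ℝ) :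
    cost A X ^ 2 = ∑ a, ∑ b, coproj X a b * ∑ i, A i a * A i b := by
  have h : (A * coproj X * (A * coproj X)ᵀ) = A * coproj X * Aᵀ := by
    rw [Matrix.transpose_mul, transpose_coproj, Matrix.mul_assoc, ← Matrix.mul_assoc (coproj X),
      coproj_mul_coproj hX, Matrix.mul_assoc]
  rw [cost_eq, frob_sq_eq_trace, h]
  simp only [Matrix.trace, Matrix.diag_apply, Matrix.mul_apply, Matrix.transpose_apply,
    sum_mul, mul_sum]
  rw [sum_comm]
  simp_rw [sum_comm (s := (univ : Finset (Fin p))) (t := (univ : Finset (Fin d)))]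
  rw [sum_comm]
  exact sum_congr rfl fun a _ => sum_congr rfl fun b _ => sum_congr rfl fun i _ => by ring

lemma cost_le_frob {X : Matrix (Fin d) (Fin k) ℝ} (hX : X ∈ Orthonormals d k)
    (A : Matrix (Fin p) (Fin d) ℝ) : cost A X ≤ frob A := by
  refine (sq_le_sq₀ (frob_nonneg _) (frob_nonneg _)).1 ?_
  have e : frob A ^ 2 = cost A X ^ 2 + frob (A * X) ^ 2 := by
    have h : (A * coproj X * (A * coproj X)ᵀ) = A * coproj X * Aᵀ := by
      rw [Matrix.transpose_mul, transpose_coproj, Matrix.mul_assoc, ← Matrix.mul_assoc (coproj X),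
        coproj_mul_coproj hX, Matrix.mul_assoc]
    rw [cost_eq, frob_sq_eq_trace, frob_sq_eq_trace, frob_sq_eq_trace, h, ← Matrix.trace_add]
    congr 1
    simp only [coproj, Matrix.mul_sub, Matrix.sub_mul, Matrix.mul_one, Matrix.transpose_mul,
      Matrix.mul_assoc]
    abel
  rw [e]
  exact le_add_of_nonneg_right (sq_nonneg _)

lemma cost_add_le {X : Matrix (Fin d) (Fin k) ℝ} (hX : X ∈ Orthonormals d k)
    (A N : Matrix (Fin p) (Fin d) ℝ) : cost (A + N) X ≤ cost A X + frob N := by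
  refine le_trans ?_ (add_le_add le_rfl (cost_le_frob hX N))
  rw [cost_eq, cost_eq, cost_eq, Matrix.add_mul]
  exact frob_add_le _ _

/-- Changing the orthonormal basis of the row space does not change the cost. -/
lemma cost_rotate (A : Matrix (Fin p) (Fin d) ℝ) (X : Matrix (Fin d) (Fin k) ℝ)
    {V : Matrix (Fin d) (Fin d) ℝ} (hV : V * Vᵀ = 1) :
    cost (A * V) (Vᵀ * X) = cost A X := by
  have h : A * V - A * V * (Vᵀ * X) * (Vᵀ * X)ᵀ = (A - A * X * Xᵀ) * V := by
    rw [Matrix.transpose_mul, Matrix.transpose_transpose, Matrix.sub_mul]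
    congr 1
    have : A * V * (Vᵀ * X) = A * X := by
      rw [Matrix.mul_assoc, ← Matrix.mul_assoc V, hV, Matrix.one_mul]
    rw [this]
    simp only [Matrix.mul_assoc]
  rw [cost, h, cost, ← abs_of_nonneg (frob_nonneg (_ * V)), ← abs_of_nonneg (frob_nonneg (_ - _)),
    ← sq_eq_sq_iff_abs_eq_abs, frob_sq_eq_trace, frob_sq_eq_trace, Matrix.transpose_mul,
    Matrix.mul_assoc, ← Matrix.mul_assoc V, hV, Matrix.one_mul]

lemma orthonormals_rotate {X : Matrix (Fin d) (Fin k) ℝ} (hX : X ∈ Orthonormals d k)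
    {V : Matrix (Fin d) (Fin d) ℝ} (hV : V * Vᵀ = 1) : Vᵀ * X ∈ Orthonormals d k := by
  have h : Xᵀ * X = 1 := hX
  change (Vᵀ * X)ᵀ * (Vᵀ * X) = 1
  rw [Matrix.transpose_mul, Matrix.transpose_transpose, Matrix.mul_assoc, ← Matrix.mul_assoc V, hV,
    Matrix.one_mul, h]

/-- The orthonormal eigenvectors of `Aᵀ A` make the columns of `A` orthogonal. -/
lemma exists_rotation (A : Matrix (Fin p) (Fin d) ℝ) :
    ∃ V : Matrix (Fin d) (Fin d) ℝ, V * Vᵀ = 1 ∧ Vᵀ * V = 1 ∧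
      ∀ a b, a ≠ b → ∑ i, (A * V) i a * (A * V) i b = 0 := by
  have hA : (Aᵀ * A).IsHermitian := by
    simpa [conjTranspose_eq_transpose_of_trivial] using Matrix.isHermitian_conjTranspose_mul_self A
  set U := hA.eigenvectorUnitary with hU
  refine ⟨U, ?_, ?_, fun a b hab => ?_⟩
  · simpa [Matrix.star_eq_conjTranspose, conjTranspose_eq_transpose_of_trivial]
      using Unitary.coe_mul_star_self U
  · simpa [Matrix.star_eq_conjTranspose, conjTranspose_eq_transpose_of_trivial]
      using Unitary.coe_star_mul_self U
  · have h1 : ((A * (U : Matrix (Fin d) (Fin d) ℝ))ᵀ * (A * (U : Matrix (Fin d) (Fin d) ℝ)))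
        = Matrix.diagonal hA.eigenvalues := by
      have := Matrix.IsHermitian.conjStarAlgAut_star_eigenvectorUnitary hA
      rw [Unitary.conjStarAlgAut_star_apply] at this
      rw [Matrix.transpose_mul, Matrix.mul_assoc, ← Matrix.mul_assoc Aᵀ, ← Matrix.mul_assoc]
      simpa [Matrix.star_eq_conjTranspose, conjTranspose_eq_transpose_of_trivial] using this
    have h2 := congrFun (congrFun h1 a) b
    rw [Matrix.diagonal_apply_ne _ hab, Matrix.mul_apply] at h2
    simpa using h2

lemma isCompact_orthonormals (d k : ℕ) : IsCompact (Orthonormals d k) := by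
  refine (isCompact_univ_pi (s := fun _ : Fin d => Set.univ.pi fun _ : Fin k => Set.Icc (-1 : ℝ) 1)
    fun _ => isCompact_univ_pi fun _ => isCompact_Icc).of_isClosed_subset ?_
    fun (X : Matrix (Fin d) (Fin k) ℝ) hX => ?_
  · have hc : Continuous fun X : Matrix (Fin d) (Fin k) ℝ => Xᵀ * X := by fun_prop
    exact isClosed_eq hc continuous_const
  · have h : Xᵀ * X = 1 := hX
    refine fun a _ c _ => ?_
    have h1 := congrFun (congrFun h c) c
    rw [Matrix.mul_apply, Matrix.one_apply_eq] at h1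
    have h2 : X a c ^ 2 ≤ 1 := by
      rw [← h1, pow_two]
      exact single_le_sum (f := fun a => Xᵀ c a * X a c)
        (fun a _ => mul_self_nonneg (X a c)) (mem_univ a)
    exact abs_le.1 ((sq_le_one_iff_abs_le_one _).1 h2)

lemma exists_opt (hk : k ≤ d) (A : Matrix (Fin p) (Fin d) ℝ) :
    ∃ X ∈ Orthonormals d k, cost A X = opt k A ∧ ∀ X' ∈ Orthonormals d k, cost A X ≤ cost A X' := by
  have hne : (Orthonormals d k).Nonempty := by
    refine ⟨Matrix.of fun a c => if a = Fin.castLE hk c then 1 else 0, ?_⟩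
    change _ = _
    ext c c'
    simp [Matrix.mul_apply, Matrix.one_apply, Fin.castLE_inj, eq_comm]
  have hcont : Continuous fun X : Matrix (Fin d) (Fin k) ℝ => cost A X := by
    unfold cost frob
    fun_prop
  obtain ⟨X, hX, hmin⟩ := (isCompact_orthonormals d k).exists_isMinOn hne hcont.continuousOn
  have hmin' : ∀ X' ∈ Orthonormals d k, cost A X ≤ cost A X' := fun X' h => hmin h
  refine ⟨X, hX, le_antisymm ?_ ?_, hmin'⟩
  · have : Nonempty (Orthonormals d k) := ⟨⟨X, hX⟩⟩
    exact le_ciInf fun X' => hmin' X'.1 X'.2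
  · exact ciInf_le (f := fun X : Orthonormals d k => cost A X.1)
      ⟨0, by rintro _ ⟨X', rfl⟩; exact cost_nonneg _ _⟩ ⟨X, hX⟩

end Projection

/-! ### The sketch preserves the cost of every projection from below -/

section Sketch

variable {m n d k : ℕ}

/-- The sketch `S A` of `A`, with `S = R / √m`. -/
noncomputable def sketchMul (R : Fin m → Fin n → ℤˣ) (A : Matrix (Fin n) (Fin d) ℝ) :
    Matrix (Fin m) (Fin d) ℝ :=
  (1 / √(m : ℝ)) • (Matrix.of (fun r j => ((R r j : ℤ) : ℝ)) * A)

lemma sketchMul_apply (R : Fin m → Fin n → ℤˣ) (A : Matrix (Fin n) (Fin d) ℝ) (r : Fin m)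
    (c : Fin d) : sketchMul R A r c = 1 / √(m : ℝ) * signDot (Aᵀ c) (R r) := by
  simp [sketchMul, Matrix.mul_apply, signDot, mul_comm]

lemma sketchMul_mul {e : ℕ} (R : Fin m → Fin n → ℤˣ) (A : Matrix (Fin n) (Fin d) ℝ)
    (V : Matrix (Fin d) (Fin e) ℝ) : sketchMul R (A * V) = sketchMul R A * V := by
  simp [sketchMul, Matrix.mul_assoc]

lemma sum_sketchMul (R : Fin m → Fin n → ℤˣ) (A : Matrix (Fin n) (Fin d) ℝ) (a b : Fin d) :
    ∑ r, sketchMul R A r a * sketchMul R A r b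
      = ∑ j, A j a * A j b + innerErr R (Aᵀ a) (Aᵀ b) := by
  have h : √(m : ℝ) * √(m : ℝ) = m := Real.mul_self_sqrt (Nat.cast_nonneg m)
  simp only [sketchMul_apply, innerErr, Matrix.transpose_apply, add_sub_cancel, mul_sum]
  refine sum_congr rfl fun r _ => ?_
  rw [mul_mul_mul_comm, div_mul_div_comm, h, one_mul]

lemma cost_sketchMul_sq {X : Matrix (Fin d) (Fin k) ℝ} (hX : X ∈ Orthonormals d k)
    (R : Fin m → Fin n → ℤˣ) (A : Matrix (Fin n) (Fin d) ℝ) :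
    cost (sketchMul R A) X ^ 2
      = cost A X ^ 2 + ∑ a, ∑ b, coproj X a b * innerErr R (Aᵀ a) (Aᵀ b) := by
  simp_rw [cost_sq hX, sum_sketchMul, mul_add, sum_add_distrib]

lemma frob_sketchMul_sq (R : Fin m → Fin n → ℤˣ) (A : Matrix (Fin n) (Fin d) ℝ) :
    frob (sketchMul R A) ^ 2 = frob A ^ 2 + ∑ a, innerErr R (Aᵀ a) (Aᵀ a) := by
  rw [frob_sq, frob_sq, sum_comm, sum_comm (f := fun i j => A i j ^ 2)]
  simp_rw [pow_two, sum_sketchMul, sum_add_distrib]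

lemma frob_sq_eq_sum_cols (A : Matrix (Fin n) (Fin d) ℝ) :
    frob A ^ 2 = ∑ c, ∑ j, Aᵀ c j ^ 2 := by
  rw [frob_sq, sum_comm]
  rfl

/-- Outside a small event the sketch preserves the cost of a fixed projection from above. -/
lemma signProb_cost_le (hm : 0 < m) (A : Matrix (Fin n) (Fin d) ℝ) (X : Matrix (Fin d) (Fin k) ℝ)
    {δ : ℝ} (hδ : 0 ≤ δ) (hδ1 : δ ≤ 8) :
    signProb (fun R : Fin m → Fin n → ℤˣ =>
      ¬ cost (sketchMul R A) X ^ 2 ≤ (1 + δ) * cost A X ^ 2) ≤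
      Real.exp (1 / 2 - m * δ ^ 2 / 128) := by
  refine le_trans (signProb_mono ?_) (signProb_sum_innerErr_le hm (A * coproj X)ᵀ hδ hδ1)
  refine fun R hR hgood => hR ?_
  rw [cost_eq, cost_eq, ← sketchMul_mul, frob_sketchMul_sq]
  rw [← frob_sq_eq_sum_cols] at hgood
  linarith [le_abs_self (∑ c, innerErr R ((A * coproj X)ᵀ c) ((A * coproj X)ᵀ c))]

lemma sq_sum_sum_mul_le {ι : Type*} [Fintype ι] (f g : ι → ι → ℝ) :
    (∑ a, ∑ b, f a b * g a b) ^ 2 ≤ (∑ a, ∑ b, f a b ^ 2) * ∑ a, ∑ b, g a b ^ 2 := by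
  have := sum_mul_sq_le_sq_mul_sq univ (fun p : ι × ι => f p.1 p.2) (fun p => g p.1 p.2)
  simpa only [Fintype.sum_prod_type] using this

/-- Let the columns of `A` be orthogonal with squared norms `l`, and let `G` be the Gram matrix
error of the columns divided by `√(max l τ)`, with Frobenius norm at most `δ √k`. The indices with
`τ < l` form the head, on which `G` is small as a quadratic form. Then the sketch decreases the
squared cost `N` of a projection of rank `k` by at most `6 δ N`, if `N` is at least `k τ`. The three
terms are those of head with head, head with tail, and tail with tail. -/
lemma neg_le_sum_coproj {X : Matrix (Fin d) (Fin k) ℝ} (hX : X ∈ Orthonormals d k)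
    (l : Fin d → ℝ) (hl : ∀ c, 0 ≤ l c) {τ δ N : ℝ} (hτ : 0 ≤ τ) (hδ : 0 ≤ δ)
    (G : Fin d → Fin d → ℝ) (hG : ∀ a b, G a b = G b a)
    (hfro : ∑ a, ∑ b, G a b ^ 2 ≤ δ ^ 2 * k)
    (hhead : ∀ x : Fin d → ℝ, (∀ c, l c ≤ τ → x c = 0) → |quad G x| ≤ δ * ∑ a, x a ^ 2)
    (htail : |∑ c, if τ < l c then 0 else τ * G c c| ≤ δ * (2 * k * τ))
    (hN : N = ∑ c, l c * coproj X c c) (hkN : k * τ ≤ N) :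
    -(6 * δ * N) ≤ ∑ a, ∑ b, coproj X a b * (√(max (l a) τ) * √(max (l b) τ) * G a b) := by
  classical
  set Y := coproj X with hY
  set s : Fin d → ℝ := fun c => √(max (l c) τ) with hs
  have hs2 : ∀ c, s c ^ 2 = max (l c) τ := fun c => Real.sq_sqrt ((hl c).trans (le_max_left _ _))
  set χ : Fin d → ℝ := fun c => if τ < l c then 1 else 0 with hχ
  set ψ : Fin d → ℝ := fun c => if τ < l c then 0 else 1 with hψ
  have hχψ : ∀ c, χ c + ψ c = 1 := fun c => by
    simp only [hχ, hψ]; split_ifs <;> norm_num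
  have hχs : ∀ c, (χ c * s c) ^ 2 = χ c * l c := fun c => by
    rw [mul_pow, hs2]
    simp only [hχ]
    split_ifs with h
    · rw [max_eq_left h.le]; ring
    · ring
  have hψs : ∀ c, (ψ c * s c) ^ 2 = ψ c * τ := fun c => by
    rw [mul_pow, hs2]
    simp only [hψ]
    split_ifs with h
    · ring
    · rw [max_eq_right (not_lt.1 h)]; ring
  have hψs' : ∀ c, ψ c * s c = ψ c * √τ := fun c => by
    simp only [hψ, hs]
    split_ifs with h
    · ring
    · rw [max_eq_right (not_lt.1 h)]
  have hχ01 : ∀ c, 0 ≤ χ c ∧ χ c ≤ 1 := fun c => by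
    simp only [hχ]; split_ifs <;> norm_num
  have hψ01 : ∀ c, 0 ≤ ψ c ∧ ψ c ≤ 1 := fun c => by
    simp only [hψ]; split_ifs <;> norm_num
  have hYd : ∀ a, 0 ≤ Y a a := coproj_diag_nonneg hX
  have hN0 : 0 ≤ N := by
    rw [hN]
    exact sum_nonneg fun c _ => mul_nonneg (hl c) (hYd c)
  have hχN : ∑ a, χ a * l a * Y a a ≤ N := by
    rw [hN]
    refine sum_le_sum fun a _ => ?_
    rw [mul_assoc]
    exact mul_le_of_le_one_left (mul_nonneg (hl a) (hYd a)) (hχ01 a).2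
  have hYmul : ∀ a b, ∑ c, Y a c * Y b c = Y a b := sum_coproj_mul hX
  have hYsymm : ∀ a b, Y a b = Y b a := coproj_symm X
  have hYsq : ∀ a, ∑ b, Y a b ^ 2 = Y a a := fun a => by
    rw [← hYmul a a]
    exact sum_congr rfl fun b _ => pow_two _
  -- head with head: the columns of `Y` give vectors supported in the head
  have h1 : -(δ * N) ≤ ∑ a, ∑ b, (χ a * s a) * (χ b * s b) * G a b * Y a b := by
    have e : ∑ a, ∑ b, (χ a * s a) * (χ b * s b) * G a b * Y a b
        = ∑ c, quad G fun a => χ a * s a * Y a c := by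
      simp only [quad]
      rw [sum_comm]
      refine sum_comm.trans ((sum_congr rfl fun a _ => ?_).trans sum_comm)
      refine (sum_congr rfl fun b _ => ?_).trans sum_comm
      rw [← hYmul a b, mul_sum]
      exact sum_congr rfl fun c _ => by ring
    have hc : ∀ c, -(δ * ∑ a, (χ a * s a * Y a c) ^ 2) ≤ quad G fun a => χ a * s a * Y a c :=
      fun c => by
        refine (abs_le.1 (hhead _ fun a ha => ?_)).1
        simp [hχ, not_lt.2 ha]
    rw [e]
    refine le_trans ?_ (sum_le_sum fun c _ => hc c)
    rw [sum_neg_distrib, ← mul_sum, neg_le_neg_iff]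
    refine mul_le_mul_of_nonneg_left (le_trans (le_of_eq ?_) hχN) hδ
    rw [sum_comm]
    refine sum_congr rfl fun a _ => ?_
    simp_rw [mul_pow _ (Y a _), hχs]
    rw [← mul_sum, hYsq]
  -- head with tail
  have h2 : |∑ a, ∑ b, G a b * ((χ a * s a) * (ψ b * s b) * Y a b)| ≤ δ * N := by
    refine abs_le_of_sq_le_sq ?_ (mul_nonneg hδ hN0)
    refine (sq_sum_sum_mul_le _ _).trans ?_
    have hw : ∑ a, ∑ b, ((χ a * s a) * (ψ b * s b) * Y a b) ^ 2 ≤ τ * N := by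
      calc _ ≤ ∑ a, ∑ b, χ a * l a * τ * Y a b ^ 2 := by
            refine sum_le_sum fun a _ => sum_le_sum fun b _ => ?_
            rw [mul_pow, mul_pow, hχs, hψs]
            refine mul_le_mul_of_nonneg_right ?_ (sq_nonneg _)
            refine mul_le_mul_of_nonneg_left ?_ (mul_nonneg (hχ01 a).1 (hl a))
            exact mul_le_of_le_one_left hτ (hψ01 b).2
        _ = τ * ∑ a, χ a * l a * Y a a := by
            rw [mul_sum]
            refine sum_congr rfl fun a _ => ?_
            rw [← mul_sum, hYsq]
            ring
        _ ≤ _ := mul_le_mul_of_nonneg_left hχN hτ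
    calc _ ≤ (δ ^ 2 * k) * (τ * N) := mul_le_mul hfro hw
          (sum_nonneg fun _ _ => sum_nonneg fun _ _ => sq_nonneg _) (by positivity)
      _ = δ ^ 2 * N * (k * τ) := by ring
      _ ≤ δ ^ 2 * N * N := mul_le_mul_of_nonneg_left hkN (by positivity)
      _ = _ := by ring
  -- tail with tail: the identity minus a projection of rank `k`
  have h3 : -(3 * (δ * N)) ≤ ∑ a, ∑ b, (ψ a * s a) * (ψ b * s b) * G a b * Y a b := by
    set Q := X * Xᵀ with hQ
    have e : ∑ a, ∑ b, (ψ a * s a) * (ψ b * s b) * G a b * Y a b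
        = (∑ c, if τ < l c then 0 else τ * G c c)
          - ∑ a, ∑ b, G a b * (ψ a * ψ b * τ * Q a b) := by
      rw [← sum_sub_distrib]
      refine sum_congr rfl fun a _ => ?_
      have e1 : (if τ < l a then 0 else τ * G a a)
          = ∑ b, if a = b then ψ a * ψ b * τ * G a b else 0 := by
        rw [sum_ite_eq univ a, if_pos (mem_univ a)]
        simp only [hψ]
        split_ifs <;> ring
      rw [e1, ← sum_sub_distrib]
      refine sum_congr rfl fun b _ => ?_
      have e2 : Y a b = (if a = b then 1 else 0) - Q a b := by
        rw [hY, coproj, Matrix.sub_apply, Matrix.one_apply]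
      rw [e2, hψs', hψs']
      have hτ2 : √τ * √τ = τ := Real.mul_self_sqrt hτ
      split_ifs
      · linear_combination (ψ a * ψ b * G a b * (1 - Q a b)) * hτ2
      · linear_combination (ψ a * ψ b * G a b * (0 - Q a b)) * hτ2
    have hQb : |∑ a, ∑ b, G a b * (ψ a * ψ b * τ * Q a b)| ≤ δ * N := by
      refine abs_le_of_sq_le_sq ?_ (mul_nonneg hδ hN0)
      refine (sq_sum_sum_mul_le _ _).trans ?_
      have hw : ∑ a, ∑ b, (ψ a * ψ b * τ * Q a b) ^ 2 ≤ τ ^ 2 * k := by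
        calc _ ≤ ∑ a, ∑ b, τ ^ 2 * Q a b ^ 2 := by
              refine sum_le_sum fun a _ => sum_le_sum fun b _ => ?_
              rw [mul_pow, mul_pow]
              refine mul_le_mul_of_nonneg_right ?_ (sq_nonneg _)
              refine mul_le_of_le_one_left (sq_nonneg _) ?_
              exact pow_le_one₀ (mul_nonneg (hψ01 a).1 (hψ01 b).1)
                (mul_le_one₀ (hψ01 a).2 (hψ01 b).1 (hψ01 b).2)
          _ = _ := by
              simp_rw [← mul_sum]
              rw [sum_congr rfl fun a _ => sum_proj_sq hX a, trace_proj hX]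
      calc _ ≤ (δ ^ 2 * k) * (τ ^ 2 * k) := mul_le_mul hfro hw
            (sum_nonneg fun _ _ => sum_nonneg fun _ _ => sq_nonneg _) (by positivity)
        _ = δ ^ 2 * (k * τ) ^ 2 := by ring
        _ ≤ δ ^ 2 * N ^ 2 := by gcongr
        _ = _ := by ring
    rw [e]
    have a1 := (abs_le.1 htail).1
    have a2 := (abs_le.1 hQb).2
    have a3 : δ * (2 * k * τ) ≤ 2 * (δ * N) := by nlinarith [mul_le_mul_of_nonneg_left hkN hδ]
    linarith
  have etot : ∑ a, ∑ b, Y a b * (s a * s b * G a b)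
      = ∑ a, ∑ b, (χ a * s a) * (χ b * s b) * G a b * Y a b
        + 2 * ∑ a, ∑ b, G a b * ((χ a * s a) * (ψ b * s b) * Y a b)
        + ∑ a, ∑ b, (ψ a * s a) * (ψ b * s b) * G a b * Y a b := by
    have hsw : ∑ a, ∑ b, G a b * ((χ a * s a) * (ψ b * s b) * Y a b)
        = ∑ a, ∑ b, G a b * ((ψ a * s a) * (χ b * s b) * Y a b) := by
      rw [sum_comm]
      refine sum_congr rfl fun a _ => sum_congr rfl fun b _ => ?_
      rw [hG b a, hYsymm b a]
      ring
    rw [two_mul]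
    nth_rewrite 2 [hsw]
    simp_rw [← sum_add_distrib]
    refine sum_congr rfl fun a _ => sum_congr rfl fun b _ => ?_
    linear_combination (-(Y a b * s a * s b * G a b * (χ b + ψ b))) * hχψ a
      - (Y a b * s a * s b * G a b) * hχψ b
  rw [etot]
  have := (abs_le.1 h2).1
  linarith

/-- Outside a small event the sketch preserves the cost of all projections of rank `k` from below,
for a matrix with orthogonal columns. -/
lemma signProb_cost_ge_of_orthogonal (hm : 0 < m) (hk : 1 ≤ k) (A : Matrix (Fin n) (Fin d) ℝ)
    (hA : ∀ a b, a ≠ b → ∑ j, A j a * A j b = 0)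
    {X₀ : Matrix (Fin d) (Fin k) ℝ} (hX₀ : X₀ ∈ Orthonormals d k)
    (hopt : ∀ X ∈ Orthonormals d k, cost A X₀ ≤ cost A X) {δ : ℝ} (hδ : 0 < δ) (hδ1 : δ ≤ 1) :
    signProb (fun R : Fin m → Fin n → ℤˣ => ¬ ∀ X ∈ Orthonormals d k,
      (1 - 6 * δ) * cost A X ^ 2 ≤ cost (sketchMul R A) X ^ 2) ≤
      Real.exp (2 * k - m * δ ^ 2 / 512) +
        (Real.exp (18 * k + 1 / 2 - m * δ ^ 2 / 2048) + Real.exp (1 / 2 - m * δ ^ 2 / 128)) := by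
  classical
  have hk' : (0 : ℝ) < k := by exact_mod_cast hk
  set l : Fin d → ℝ := fun c => ∑ j, A j c ^ 2 with hl
  have hl0 : ∀ c, 0 ≤ l c := fun c => sum_nonneg fun j _ => sq_nonneg _
  have hcost : ∀ X ∈ Orthonormals d k, cost A X ^ 2 = ∑ c, l c * coproj X c c := fun X hX => by
    rw [cost_sq hX]
    refine sum_congr rfl fun a _ => ?_
    rw [sum_eq_single a]
    · rw [mul_comm]
      simp [hl, pow_two]
    · intro b _ hb
      rw [hA a b hb.symm, mul_zero]
    · simp
  -- the threshold between head and tail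
  set τ : ℝ := cost A X₀ ^ 2 / k with hτ
  have hτ0 : 0 ≤ τ := by positivity
  have hkτ : k * τ = cost A X₀ ^ 2 := by rw [hτ]; field_simp
  set P := X₀ * X₀ᵀ with hP
  have hP1 : ∀ c, P c c ≤ 1 := fun c => by
    have := coproj_diag_nonneg hX₀ c
    rw [coproj, Matrix.sub_apply, Matrix.one_apply_eq] at this
    linarith
  have hP0 : ∀ c, 0 ≤ P c c := proj_diag_nonneg hX₀
  have hPk : ∑ c, P c c = k := trace_proj hX₀
  have hsum : ∑ c, l c * (1 - P c c) = k * τ := by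
    rw [hkτ, hcost X₀ hX₀]
    refine sum_congr rfl fun c _ => ?_
    rw [coproj, Matrix.sub_apply, Matrix.one_apply_eq]
  have hterm0 : ∀ c, 0 ≤ l c * (1 - P c c) := fun c => mul_nonneg (hl0 c) (by linarith [hP1 c])
  set Hd : Finset (Fin d) := univ.filter fun c => τ < l c with hHd
  set Tl : Finset (Fin d) := univ.filter fun c => ¬ τ < l c with hTl
  have hPhead : ∑ c ∈ Hd, P c c ≤ k := by
    rw [← hPk]
    exact sum_le_sum_of_subset_of_nonneg (filter_subset _ _) fun c _ _ => hP0 c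
  have hheadcard : (#Hd : ℝ) ≤ 2 * k := by
    rcases hτ0.eq_or_lt with h0 | hpos
    · have h1 : ∀ c ∈ Hd, (1 : ℝ) = P c c := fun c hc => by
        have h2 : τ < l c := (mem_filter.1 hc).2
        have h3 := (sum_eq_zero_iff_of_nonneg fun c _ => hterm0 c).1
          (by rw [hsum, ← h0, mul_zero]) c (mem_univ c)
        rw [← h0] at h2
        rcases mul_eq_zero.1 h3 with h | h
        · exact absurd h h2.ne'
        · linarith
      have h2 : (#Hd : ℝ) = ∑ c ∈ Hd, P c c := by
        rw [← sum_congr rfl h1]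
        simp
      linarith
    · have h1 : ∑ c ∈ Hd, τ * (1 - P c c) ≤ k * τ := by
        rw [← hsum]
        refine (sum_le_sum fun c hc => mul_le_mul_of_nonneg_right (mem_filter.1 hc).2.le
          (by linarith [hP1 c])).trans (sum_le_sum_of_subset_of_nonneg (filter_subset _ _)
            fun c _ _ => hterm0 c)
      rw [← mul_sum, mul_comm (k : ℝ)] at h1
      have h2 := le_of_mul_le_mul_left h1 hpos
      rw [sum_sub_distrib] at h2
      simp only [sum_const, nsmul_eq_mul, mul_one] at h2
      linarith
  have htailsum : ∑ c ∈ Tl, l c ≤ 2 * k * τ := by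
    have h1 : ∑ c ∈ Tl, l c = ∑ c ∈ Tl, l c * (1 - P c c) + ∑ c ∈ Tl, l c * P c c := by
      rw [← sum_add_distrib]
      exact sum_congr rfl fun c _ => by ring
    have h2 : ∑ c ∈ Tl, l c * (1 - P c c) ≤ k * τ := by
      rw [← hsum]
      exact sum_le_sum_of_subset_of_nonneg (filter_subset _ _) fun c _ _ => hterm0 c
    have h3 : ∑ c ∈ Tl, l c * P c c ≤ k * τ := by
      calc _ ≤ ∑ c ∈ Tl, τ * P c c := sum_le_sum fun c hc =>
            mul_le_mul_of_nonneg_right (not_lt.1 (mem_filter.1 hc).2) (hP0 c)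
        _ ≤ ∑ c, τ * P c c := sum_le_sum_of_subset_of_nonneg (filter_subset _ _)
            fun c _ _ => mul_nonneg hτ0 (hP0 c)
        _ = k * τ := by rw [← mul_sum, hPk, mul_comm]
    linarith
  -- the normalized columns
  set s : Fin d → ℝ := fun c => √(max (l c) τ) with hs
  have hs2 : ∀ c, s c ^ 2 = max (l c) τ := fun c => Real.sq_sqrt ((hl0 c).trans (le_max_left _ _))
  set u : Fin d → Fin n → ℝ := fun c => (s c)⁻¹ • Aᵀ c with hu
  have hAu : ∀ c, Aᵀ c = s c • u c := fun c => by
    by_cases h : s c = 0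
    · have h1 : l c = 0 := by
        have h2 := hs2 c
        rw [h] at h2
        refine le_antisymm ?_ (hl0 c)
        have := le_max_left (l c) τ
        nlinarith
      rw [h, zero_smul]
      funext j
      have h2 := (sum_eq_zero_iff_of_nonneg fun j _ => sq_nonneg (A j c)).1 h1 j (mem_univ j)
      simpa using h2
    · rw [hu]
      simp only [smul_smul]
      rw [mul_inv_cancel₀ h, one_smul]
  have hun : ∀ c, ∑ j, u c j ^ 2 = l c / max (l c) τ := fun c => by
    simp only [hu, Pi.smul_apply, smul_eq_mul, mul_pow, ← mul_sum, inv_pow, hs2,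
      Matrix.transpose_apply, hl]
    rw [inv_mul_eq_div]
  have hu1 : ∀ c, ∑ j, u c j ^ 2 ≤ 1 := fun c => by
    rw [hun]
    exact div_le_one_of_le₀ (le_max_left _ _) ((hl0 c).trans (le_max_left _ _))
  have huorth : ∀ a b, a ≠ b → ∑ j, u a j * u b j = 0 := fun a b hab => by
    have : ∑ j, u a j * u b j = (s a)⁻¹ * (s b)⁻¹ * ∑ j, A j a * A j b := by
      rw [mul_sum]
      refine sum_congr rfl fun j _ => ?_
      simp only [hu, Pi.smul_apply, smul_eq_mul, Matrix.transpose_apply]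
      ring
    rw [this, hA a b hab, mul_zero]
  have huK : ∑ c, ∑ j, u c j ^ 2 ≤ 4 * k := by
    have h1 : ∑ c ∈ Hd, ∑ j, u c j ^ 2 ≤ 2 * k := by
      refine (sum_le_card_nsmul Hd _ 1 fun c _ => hu1 c).trans ?_
      rw [nsmul_eq_mul, mul_one]
      exact hheadcard
    have h2 : ∑ c ∈ Tl, ∑ j, u c j ^ 2 ≤ 2 * k := by
      have h3 : ∀ c ∈ Tl, ∑ j, u c j ^ 2 = l c / τ := fun c hc => by
        rw [hun, max_eq_right (not_lt.1 (mem_filter.1 hc).2)]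
      rw [sum_congr rfl h3, ← sum_div]
      rcases hτ0.eq_or_lt with h0 | hpos
      · rw [← h0, div_zero]
        positivity
      · rw [div_le_iff₀ hpos]
        exact htailsum
    have h3 := sum_filter_add_sum_filter_not univ (fun c => τ < l c) fun c => ∑ j, u c j ^ 2
    linarith
  -- the three good events
  have hE1 := signProb_gramErr_le hm u hu1 huorth hk huK hδ hδ1
  have hE2 := signProb_quad_innerErr_le (H := {c // τ < l c}) hm (fun c => u c.1)
    (fun c => hu1 c.1) (fun c c' h => huorth _ _ fun e => h (Subtype.ext e)) hδ.le hδ1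
  have hE3 := signProb_sum_innerErr_le hm
    (fun c => if τ < l c then (0 : Fin n → ℝ) else Aᵀ c) hδ.le (by linarith : δ ≤ 8)
  have hcardH : (Fintype.card {c // τ < l c} : ℝ) ≤ 2 * k := by
    rw [Fintype.card_subtype]
    exact hheadcard
  have hE2' := hE2.trans (Real.exp_le_exp.2 (by linarith :
    9 * (Fintype.card {c // τ < l c} : ℝ) + 1 / 2 - m * δ ^ 2 / 2048
      ≤ 18 * k + 1 / 2 - m * δ ^ 2 / 2048))
  refine le_trans ?_ (add_le_add hE1 (add_le_add hE2' hE3))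
  refine le_trans (signProb_mono fun R hR => ?_)
    ((signProb_or_le _ _).trans (add_le_add le_rfl (signProb_or_le _ _)))
  by_contra! hcon
  obtain ⟨g1, g2, g3⟩ := hcon
  refine hR fun X hX => ?_
  have hkN : k * τ ≤ cost A X ^ 2 := by
    rw [hkτ]
    exact pow_le_pow_left₀ (cost_nonneg _ _) (hopt X hX) 2
  have hmain := neg_le_sum_coproj hX l hl0 hτ0 hδ.le (fun a b => innerErr R (u a) (u b))
    (fun a b => innerErr_comm R _ _) g1 (fun x hx => ?_) ?_ (hcost X hX) hkN
  · rw [cost_sketchMul_sq hX]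
    have e : ∑ a, ∑ b, coproj X a b * innerErr R (Aᵀ a) (Aᵀ b)
        = ∑ a, ∑ b, coproj X a b * (√(max (l a) τ) * √(max (l b) τ) * innerErr R (u a) (u b)) := by
      refine sum_congr rfl fun a _ => sum_congr rfl fun b _ => ?_
      rw [hAu a, hAu b, innerErr_smul_smul]
    rw [e]
    linarith
  · have h1 := g2 fun c => x c.1
    have hsub : ∀ f : Fin d → ℝ, (∀ c, l c ≤ τ → f c = 0) →
        ∑ c : {c // τ < l c}, f c.1 = ∑ c, f c := fun f hf => by
      rw [← sum_subtype (univ.filter fun c => τ < l c) (by simp) f]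
      refine sum_subset (subset_univ _) fun c _ hc => hf c ?_
      simpa using hc
    have e1 : ∑ a : {c // τ < l c}, x a.1 ^ 2 = ∑ a, x a ^ 2 :=
      hsub (fun c => x c ^ 2) fun c hc => by simp [hx c hc]
    have e2 : quad (fun a b : {c // τ < l c} => innerErr R (u a.1) (u b.1)) (fun c => x c.1)
        = quad (fun a b => innerErr R (u a) (u b)) x := by
      simp only [quad]
      rw [← hsub (fun a => ∑ b, x a * x b * innerErr R (u a) (u b)) fun c hc => by simp [hx c hc]]
      refine sum_congr rfl fun a _ => ?_
      exact hsub (fun b => x a.1 * x b * innerErr R (u a.1) (u b)) fun c hc => by simp [hx c hc]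
    rw [e1, e2] at h1
    exact h1
  · have e1 : ∑ c, innerErr R (if τ < l c then (0 : Fin n → ℝ) else Aᵀ c)
          (if τ < l c then (0 : Fin n → ℝ) else Aᵀ c)
        = ∑ c, if τ < l c then 0 else τ * innerErr R (u c) (u c) := by
      refine sum_congr rfl fun c _ => ?_
      split_ifs with h
      · simp [innerErr, signDot]
      · rw [hAu c, innerErr_smul_smul, ← pow_two, hs2, max_eq_right (not_lt.1 h)]
    have e2 : ∑ c, ∑ j, (if τ < l c then (0 : Fin n → ℝ) else Aᵀ c) j ^ 2 = ∑ c ∈ Tl, l c := by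
      rw [hTl, sum_filter]
      refine sum_congr rfl fun c _ => ?_
      by_cases h : τ < l c
      · rw [if_neg (not_not.2 h)]
        simp [if_pos h]
      · rw [if_pos h]
        simp only [if_neg h]
        rfl
    rw [e1, e2] at g3
    exact g3.trans (mul_le_mul_of_nonneg_left htailsum hδ.le)

/-- Outside a small event the sketch preserves the cost of all projections of rank `k` from
below. -/
theorem signProb_cost_ge (hm : 0 < m) (hk : 1 ≤ k) (A : Matrix (Fin n) (Fin d) ℝ)
    {X₀ : Matrix (Fin d) (Fin k) ℝ} (hX₀ : X₀ ∈ Orthonormals d k)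
    (hopt : ∀ X ∈ Orthonormals d k, cost A X₀ ≤ cost A X) {δ : ℝ} (hδ : 0 < δ) (hδ1 : δ ≤ 1) :
    signProb (fun R : Fin m → Fin n → ℤˣ => ¬ ∀ X ∈ Orthonormals d k,
      (1 - 6 * δ) * cost A X ^ 2 ≤ cost (sketchMul R A) X ^ 2) ≤
      Real.exp (2 * k - m * δ ^ 2 / 512) +
        (Real.exp (18 * k + 1 / 2 - m * δ ^ 2 / 2048) + Real.exp (1 / 2 - m * δ ^ 2 / 128)) := by
  obtain ⟨V, hV, hV', hAV⟩ := exists_rotation A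
  refine le_trans (signProb_mono ?_) (signProb_cost_ge_of_orthogonal hm hk (A * V) hAV
    (orthonormals_rotate hX₀ hV) (fun X hX => ?_) hδ hδ1)
  · refine fun R hR hgood => hR fun X hX => ?_
    have := hgood (Vᵀ * X) (orthonormals_rotate hX hV)
    rwa [sketchMul_mul, cost_rotate _ _ hV, cost_rotate _ _ hV] at this
  · have hVt : Vᵀ * Vᵀᵀ = 1 := by rwa [Matrix.transpose_transpose]
    have h1 := hopt _ (orthonormals_rotate hX hVt)
    have h2 : Vᵀ * (Vᵀᵀ * X) = X := by rw [← Matrix.mul_assoc, hVt, Matrix.one_mul]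
    rw [cost_rotate _ _ hV]
    rwa [← cost_rotate A (Vᵀᵀ * X) hV, h2] at h1

end Sketch

end

open scoped ENNReal

/-! ### The gamma difference distribution -/

lemma integral_gammaPDFReal {a r : ℝ} (ha : 0 < a) (hr : 0 < r) :
    ∫ x, gammaPDFReal a r x = 1 := by
  rw [integral_eq_lintegral_of_nonneg_ae (Filter.Eventually.of_forall (gammaPDFReal_nonneg ha hr))
    (measurable_gammaPDFReal a r).aestronglyMeasurable]
  have := lintegral_gammaPDF_eq_one ha hr
  simp only [gammaPDF] at this
  rw [this, ENNReal.toReal_one]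

/-- The moment generating function of the gamma distribution, which is zero (a junk value) where
the exponential moment is infinite. -/
noncomputable def gammaMgf (a r t : ℝ) : ℝ := if t < r then (r / (r - t)) ^ a else 0

lemma measurable_gammaPDF (a r : ℝ) : Measurable (gammaPDF a r) :=
  (measurable_gammaPDFReal a r).ennreal_ofReal

lemma gammaPDFReal_mul_exp {a r t : ℝ} (hr : 0 < r) (ht : t < r) (x : ℝ) :
    gammaPDFReal a r x * Real.exp (t * x) = (r / (r - t)) ^ a * gammaPDFReal a (r - t) x := by
  have hrt : 0 < r - t := by linarith
  unfold gammaPDFReal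
  split_ifs with h
  · rw [mul_assoc, ← Real.exp_add, Real.div_rpow hr.le hrt.le]
    have h1 : (r - t) ^ a ≠ 0 := (Real.rpow_pos_of_pos hrt a).ne'
    have e : -(r * x) + t * x = -((r - t) * x) := by ring
    rw [e]
    field_simp
  · simp

lemma integral_exp_gammaMeasure {a r : ℝ} (ha : 0 < a) (hr : 0 < r) (t : ℝ) :
    ∫ x, Real.exp (t * x) ∂(gammaMeasure a r) = gammaMgf a r t := by
  have hd : ∫ x, Real.exp (t * x) ∂(gammaMeasure a r)
      = ∫ x, gammaPDFReal a r x * Real.exp (t * x) := by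
    rw [gammaMeasure, integral_withDensity_eq_integral_toReal_smul (measurable_gammaPDF a r)
      (Filter.Eventually.of_forall fun x => ENNReal.ofReal_lt_top)]
    refine integral_congr_ae (Filter.Eventually.of_forall fun x => ?_)
    simp only [gammaPDF, ENNReal.toReal_ofReal (gammaPDFReal_nonneg ha hr x), smul_eq_mul]
  rw [hd, gammaMgf]
  split_ifs with h
  · simp_rw [gammaPDFReal_mul_exp hr h]
    rw [integral_const_mul, integral_gammaPDFReal ha (by linarith), mul_one]
  · refine integral_undef fun hint => ?_
    refine not_integrableOn_Ioi_rpow (a - 1) ?_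
    have hc : 0 < r ^ a / Real.Gamma a := div_pos (Real.rpow_pos_of_pos hr a) (Real.Gamma_pos_of_pos ha)
    have h1 : IntegrableOn (fun x => (r ^ a / Real.Gamma a)⁻¹ *
        (gammaPDFReal a r x * Real.exp (t * x))) (Set.Ioi 0) := (hint.const_mul _).integrableOn
    refine Integrable.mono' h1 (by fun_prop) ?_
    rw [ae_restrict_iff' measurableSet_Ioi]
    refine Filter.Eventually.of_forall fun x hx => ?_
    have hx' : (0 : ℝ) < x := hx
    have hp : 0 < x ^ (a - 1) := Real.rpow_pos_of_pos hx' _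
    rw [Real.norm_of_nonneg hp.le, gammaPDFReal, if_pos hx'.le, mul_assoc, mul_assoc,
      ← Real.exp_add, inv_mul_cancel_left₀ hc.ne']
    refine le_mul_of_one_le_right hp.le (Real.one_le_exp ?_)
    nlinarith

lemma gammaMgf_mul {a a' r : ℝ} (hr : 0 < r) (t : ℝ) :
    gammaMgf a r t * gammaMgf a' r t = gammaMgf (a + a') r t := by
  unfold gammaMgf
  split_ifs with h
  · rw [Real.rpow_add (div_pos hr (by linarith))]
  · ring

section GammaDiff

variable {a a' b : ℝ}

lemma isProbabilityMeasure_gammaDiff (ha : 0 < a) (hb : 0 < b) :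
    IsProbabilityMeasure (gammaDiff a b) := by
  have := isProbabilityMeasure_gammaMeasure ha (one_div_pos.2 hb)
  exact Measure.isProbabilityMeasure_map (by fun_prop)

lemma integral_exp_gammaDiff (ha : 0 < a) (hb : 0 < b) (t : ℝ) :
    ∫ x, Real.exp (t * x) ∂(gammaDiff a b) = gammaMgf a (1 / b) t * gammaMgf a (1 / b) (-t) := by
  have := isProbabilityMeasure_gammaMeasure ha (one_div_pos.2 hb)
  rw [gammaDiff, integral_map (by fun_prop) (by fun_prop)]
  have : ∀ p : ℝ × ℝ, Real.exp (t * (p.1 - p.2)) = Real.exp (t * p.1) * Real.exp (-t * p.2) :=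
    fun p => by rw [← Real.exp_add]; ring_nf
  simp_rw [this]
  rw [integral_prod_mul (fun x => Real.exp (t * x)) fun x => Real.exp (-t * x),
    integral_exp_gammaMeasure ha (one_div_pos.2 hb), integral_exp_gammaMeasure ha (one_div_pos.2 hb)]

/-- A distribution with a moment generating function that is finite near `0` is determined by it. -/
lemma ext_of_mgf {μ ν : Measure ℝ} [IsProbabilityMeasure μ] [IsProbabilityMeasure ν]
    (h : mgf id μ = mgf id ν) (h0 : 0 ∈ interior (integrableExpSet id μ)) : μ = ν := by
  refine Measure.ext_of_charFun (funext fun t => ?_)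
  have := eqOn_complexMGF_of_mgf h (x := t * Complex.I) (by simpa using h0)
  rwa [complexMGF_id_mul_I, complexMGF_id_mul_I] at this

lemma zero_mem_integrableExpSet_gammaDiff (ha : 0 < a) (hb : 0 < b) :
    0 ∈ interior (integrableExpSet id (gammaDiff a b)) := by
  have := isProbabilityMeasure_gammaDiff ha hb
  rw [mem_interior]
  refine ⟨Set.Ioo (-(1 / b)) (1 / b), fun t ht => ?_, isOpen_Ioo, ?_⟩
  · have h1 : t < 1 / b := ht.2
    have h2 : -t < 1 / b := by linarith [ht.1]
    have : 0 < mgf id (gammaDiff a b) t := by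
      simp only [mgf, id]
      rw [integral_exp_gammaDiff ha hb, gammaMgf, gammaMgf, if_pos h1, if_pos h2]
      have hb' := one_div_pos.2 hb
      exact mul_pos (Real.rpow_pos_of_pos (div_pos hb' (by linarith)) _)
        (Real.rpow_pos_of_pos (div_pos hb' (by linarith)) _)
    exact mgf_pos_iff.1 this
  · have := one_div_pos.2 hb
    exact ⟨by linarith, this⟩

lemma mgf_conv {μ ν : Measure ℝ} [SFinite μ] [SFinite ν] (t : ℝ) :
    mgf id (μ ∗ ν) t = mgf id μ t * mgf id ν t := by
  simp only [mgf, id]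
  rw [Measure.conv, integral_map (by fun_prop) (by fun_prop)]
  have : ∀ p : ℝ × ℝ, Real.exp (t * (p.1 + p.2)) = Real.exp (t * p.1) * Real.exp (t * p.2) :=
    fun p => by rw [← Real.exp_add]; ring_nf
  simp_rw [this]
  exact integral_prod_mul (fun x => Real.exp (t * x)) fun x => Real.exp (t * x)

/-- The family of gamma difference distributions of a fixed scale is additive in the shape. -/
lemma gammaDiff_conv (ha : 0 < a) (ha' : 0 < a') (hb : 0 < b) :
    gammaDiff a b ∗ gammaDiff a' b = gammaDiff (a + a') b := by
  have := isProbabilityMeasure_gammaDiff ha hb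
  have := isProbabilityMeasure_gammaDiff ha' hb
  have := isProbabilityMeasure_gammaDiff (add_pos ha ha') hb
  refine (ext_of_mgf ?_ (zero_mem_integrableExpSet_gammaDiff (add_pos ha ha') hb)).symm
  funext t
  rw [mgf_conv]
  simp only [mgf, id]
  rw [integral_exp_gammaDiff ha hb, integral_exp_gammaDiff ha' hb,
    integral_exp_gammaDiff (add_pos ha ha') hb, mul_mul_mul_comm,
    gammaMgf_mul (one_div_pos.2 hb), gammaMgf_mul (one_div_pos.2 hb)]

lemma gammaDiff_map_neg (ha : 0 < a) (hb : 0 < b) :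
    (gammaDiff a b).map (fun x => -x) = gammaDiff a b := by
  have := isProbabilityMeasure_gammaMeasure ha (one_div_pos.2 hb)
  rw [gammaDiff, Measure.map_map (by fun_prop) (by fun_prop)]
  conv_rhs => rw [← Measure.prod_swap, Measure.map_map (by fun_prop) (by fun_prop)]
  congr 1
  funext p
  simp

/-! ### Likelihood ratios of shifted noise -/

/-- For shape at least `1`, the density of the gamma distribution at `y - s` is at most
`exp (r s)` times the density at `y`. -/
lemma gammaPDF_sub_le {r s : ℝ} (ha : 1 ≤ a) (hr : 0 < r) (hs : 0 ≤ s) (y : ℝ) :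
    gammaPDF a r (y - s) ≤ ENNReal.ofReal (Real.exp (r * s)) * gammaPDF a r y := by
  rcases lt_or_ge (y - s) 0 with h | h
  · rw [gammaPDF_of_neg h]
    exact zero_le
  · rw [gammaPDF_of_nonneg h, gammaPDF_of_nonneg (by linarith : 0 ≤ y),
      ← ENNReal.ofReal_mul (Real.exp_pos _).le]
    refine ENNReal.ofReal_le_ofReal ?_
    have e : Real.exp (-(r * (y - s))) = Real.exp (r * s) * Real.exp (-(r * y)) := by
      rw [← Real.exp_add]; ring_nf
    have h1 : (y - s) ^ (a - 1) ≤ y ^ (a - 1) :=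
      Real.rpow_le_rpow h (by linarith) (by linarith)
    have hc : 0 ≤ r ^ a / Real.Gamma a :=
      (div_pos (Real.rpow_pos_of_pos hr a) (Real.Gamma_pos_of_pos (by linarith))).le
    rw [e]
    calc _ = Real.exp (r * s) * (r ^ a / Real.Gamma a * Real.exp (-(r * y))) * (y - s) ^ (a - 1) := by
          ring
      _ ≤ Real.exp (r * s) * (r ^ a / Real.Gamma a * Real.exp (-(r * y))) * y ^ (a - 1) :=
          mul_le_mul_of_nonneg_left h1 (by positivity)
      _ = _ := by ring

lemma gammaMeasure_shift_le {r s : ℝ} (ha : 1 ≤ a) (hr : 0 < r) (hs : 0 ≤ s) {F : Set ℝ}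
    (hF : MeasurableSet F) :
    gammaMeasure a r ((fun x => x + s) ⁻¹' F)
      ≤ ENNReal.ofReal (Real.exp (r * s)) * gammaMeasure a r F := by
  have hF' : MeasurableSet ((fun x => x + s) ⁻¹' F) := hF.preimage (by fun_prop)
  rw [gammaMeasure, withDensity_apply _ hF', withDensity_apply _ hF,
    ← lintegral_indicator hF', ← lintegral_indicator hF,
    ← lintegral_const_mul _ ((measurable_gammaPDF a r).indicator hF),
    ← lintegral_sub_right_eq_self _ s]
  refine lintegral_mono fun y => ?_
  by_cases hy : y ∈ F
  · have h1 : y - s ∈ (fun x => x + s) ⁻¹' F := by simpa using hy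
    rw [Set.indicator_of_mem h1, Set.indicator_of_mem hy]
    exact gammaPDF_sub_le ha hr hs y
  · have h1 : y - s ∉ (fun x => x + s) ⁻¹' F := by simpa using hy
    rw [Set.indicator_of_notMem h1]
    exact zero_le

/-- A shift of the gamma difference distribution by `s` changes probabilities at most by the factor
`exp (|s| / b)`: according to the sign of `s`, the shift is one of the minuend or the
subtrahend. -/
lemma gammaDiff_map_add_le (ha : 1 ≤ a) (hb : 0 < b) {s c : ℝ} (hs : |s| ≤ c) :
    (gammaDiff a b).map (fun x => x + s)
      ≤ ENNReal.ofReal (Real.exp (c / b)) • gammaDiff a b := by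
  have hr : 0 < 1 / b := one_div_pos.2 hb
  have := isProbabilityMeasure_gammaMeasure (by linarith : 0 < a) hr
  have hexp : ENNReal.ofReal (Real.exp (1 / b * |s|)) ≤ ENNReal.ofReal (Real.exp (c / b)) := by
    refine ENNReal.ofReal_le_ofReal (Real.exp_le_exp.2 ?_)
    rw [one_div_mul_eq_div]
    exact div_le_div_of_nonneg_right hs hb.le
  refine Measure.le_iff.2 fun E hE => ?_
  have hm : Measurable fun p : ℝ × ℝ => p.1 - p.2 := by fun_prop
  have hE' : MeasurableSet ((fun x => x + s) ⁻¹' E) := hE.preimage (by fun_prop)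
  rw [Measure.map_apply (by fun_prop) hE, Measure.smul_apply, smul_eq_mul, gammaDiff,
    Measure.map_apply hm hE', Measure.map_apply hm hE]
  refine le_trans ?_ (mul_le_mul_left hexp _)
  rcases le_total 0 s with h | h
  · rw [Measure.prod_apply_symm (hE'.preimage hm), Measure.prod_apply_symm (hE.preimage hm),
      ← lintegral_const_mul _ (measurable_measure_prodMk_right (hE.preimage hm))]
    refine lintegral_mono fun y => ?_
    have := gammaMeasure_shift_le ha hr h (F := (fun x => x - y) ⁻¹' E)
      (hE.preimage (by fun_prop))
    rw [abs_of_nonneg h]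
    refine le_trans (le_of_eq ?_) this
    congr 1
    ext x
    simp only [Set.mem_preimage]
    rw [show x - y + s = x + s - y by ring]
  · rw [Measure.prod_apply (hE'.preimage hm), Measure.prod_apply (hE.preimage hm),
      ← lintegral_const_mul _ (measurable_measure_prodMk_left (hE.preimage hm))]
    refine lintegral_mono fun x => ?_
    have := gammaMeasure_shift_le ha hr (neg_nonneg.2 h) (F := (fun y => x - y) ⁻¹' E)
      (hE.preimage (by fun_prop))
    rw [abs_of_nonpos h]
    refine le_trans (le_of_eq ?_) this
    congr 1
    ext y
    simp only [Set.mem_preimage]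
    rw [show x - y + s = x - (y + -s) by ring]

end GammaDiff

/-! ### Product measures -/

lemma measure_pi_le {α : Type*} [MeasurableSpace α] {c : ℝ≥0∞} (hc : c ≠ ∞) :
    ∀ {n : ℕ} (μ ν : Fin n → Measure α) [∀ i, IsFiniteMeasure (μ i)] [∀ i, IsFiniteMeasure (ν i)],
      (∀ i, ν i ≤ c • μ i) → Measure.pi ν ≤ c ^ n • Measure.pi μ
  | 0, μ, ν, _, _, _ => by
    simp [Measure.pi_of_empty μ, Measure.pi_of_empty ν]
  | n + 1, μ, ν, _, _, h => by
    have ih := measure_pi_le hc (fun i => μ i.succ) (fun i => ν i.succ) fun i => h i.succ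
    have eμ := (measurePreserving_piFinSuccAbove μ 0).symm.map_eq
    have eν := (measurePreserving_piFinSuccAbove ν 0).symm.map_eq
    simp only [Fin.zero_succAbove] at eμ eν
    rw [← eμ, ← eν, ← Measure.map_smul]
    refine Measure.map_mono ?_ (MeasurableEquiv.measurable _)
    have hfin : ∀ k : ℕ, c ^ k ≠ ∞ := fun k => ENNReal.pow_ne_top hc
    refine (Measure.prod_mono (h 0) ih).trans (le_of_eq ?_)
    rw [Measure.prod_smul_left, Measure.prod_smul_right, smul_smul, pow_succ, mul_comm]

lemma pi_conv_pi {ι α : Type*} [Fintype ι] [MeasurableSpace α] [AddMonoid α] [MeasurableAdd₂ α]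
    (μ ν : ι → Measure α) [∀ i, IsProbabilityMeasure (μ i)] [∀ i, IsProbabilityMeasure (ν i)] :
    Measure.pi μ ∗ Measure.pi ν = Measure.pi fun i => μ i ∗ ν i := by
  have e := (measurePreserving_arrowProdEquivProdArrow α α ι μ ν).map_eq
  rw [Measure.conv, ← e, Measure.map_map (by fun_prop) (MeasurableEquiv.measurable _)]
  exact Measure.pi_map_pi (f := fun _ (p : α × α) => p.1 + p.2) fun i => by fun_prop

/-! ### The law of the aggregated noise -/

/-- In every entry of the sign matrix exactly one of the parts is non-zero, and the index of that
part runs over all parts as the row varies: an odd number of parts is non-zero in each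
entry, and each part is non-zero in exactly one entry of a column. -/
lemma DenseSketch.exists_perm {m n : ℕ} (S : DenseSketch m n) (j : Fin n) :
    ∃ ρ : Fin m ≃ Fin m, ∀ i r,
      ((S.part i r j : SignType) : ℝ) = if i = ρ r then (((S.sign r j : ℤˣ) : ℤ) : ℝ) else 0 := by
  choose f hf hu using fun i => S.one_per_col i j
  have hsurj : Function.Surjective f := fun r => by
    by_contra! h
    have h0 : ∀ i, S.part i r j = 0 := fun i => by
      by_contra hne
      exact h i (hu i r hne).symm
    have := S.sum_part r j
    simp only [h0, SignType.coe_zero, Finset.sum_const_zero] at this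
    exact (S.sign r j).ne_zero this.symm
  let e := Equiv.ofBijective f ⟨Finite.injective_iff_surjective.2 hsurj, hsurj⟩
  have h0 : ∀ i r, i ≠ e.symm r → S.part i r j = 0 := fun i r hi => by
    by_contra hne
    exact hi (e.eq_symm_apply.2 (hu i r hne).symm)
  refine ⟨e.symm, fun i r => ?_⟩
  split_ifs with hi
  · have := S.sum_part r j
    rw [Finset.sum_eq_single (e.symm r) (fun i _ h => by rw [h0 i r h, SignType.coe_zero])
      (by simp)] at this
    rw [hi, ← this]
    cases S.part (e.symm r) r j <;> simp
  · rw [h0 i r hi, SignType.coe_zero]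

/-- The contribution to the output, up to the factor `1 / √m`, of the message `g` of client `j`. -/
def localSketch {m n d : ℕ} (S : DenseSketch m n) (j : Fin n) (g : Fin m → Fin d → ℝ) :
    Fin m → Fin d → ℝ :=
  fun r c => ∑ i, ((S.part i r j : SignType) : ℝ) * g i c

/-- The aggregated noise of the clients in `J`, up to the factor `1 / √m`. -/
def noiseSum {m n d : ℕ} (S : DenseSketch m n) (J : Finset (Fin n))
    (g : Fin n → Fin m → Fin d → ℝ) : Fin m → Fin d → ℝ :=
  ∑ j ∈ J, localSketch S j (g j)

section Law

variable {m n d : ℕ} (S : DenseSketch m n)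

lemma measurable_localSketch (j : Fin n) :
    Measurable (localSketch S j : (Fin m → Fin d → ℝ) → Fin m → Fin d → ℝ) := by
  unfold localSketch
  fun_prop

lemma measurable_noiseSum (J : Finset (Fin n)) :
    Measurable (noiseSum S J : (Fin n → Fin m → Fin d → ℝ) → Fin m → Fin d → ℝ) := by
  unfold noiseSum
  have := fun j => measurable_localSketch (d := d) S j
  fun_prop

/-- A symmetric product measure is invariant under signed permutations of the rows. -/
lemma map_localSketch (D : Measure ℝ) [IsProbabilityMeasure D] (hD : D.map (fun x => -x) = D)
    (j : Fin n) :
    (Measure.pi fun _ : Fin m => Measure.pi fun _ : Fin d => D).map (localSketch S j)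
      = Measure.pi fun _ : Fin m => Measure.pi fun _ : Fin d => D := by
  obtain ⟨ρ, hρ⟩ := S.exists_perm j
  have hL : (localSketch S j : (Fin m → Fin d → ℝ) → Fin m → Fin d → ℝ)
      = (fun g r c => (((S.sign r j : ℤˣ) : ℤ) : ℝ) * g r c) ∘ (fun g r => g (ρ r)) := by
    funext g r c
    simp [localSketch, hρ]
  have hperm : (Measure.pi fun _ : Fin m => Measure.pi fun _ : Fin d => D).map
      (fun g r => g (ρ r)) = Measure.pi fun _ : Fin m => Measure.pi fun _ : Fin d => D := by
    have := (measurePreserving_piCongrLeft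
      (fun _ : Fin m => Measure.pi fun _ : Fin d => D) ρ.symm).map_eq
    convert this using 2
    funext g r
    have := (Equiv.piCongrLeft_apply_apply (fun _ : Fin m => Fin d → ℝ) ρ.symm g (ρ r)).symm
    simpa [MeasurableEquiv.coe_piCongrLeft] using this
  have hsign : ∀ u : ℤˣ, D.map (fun x => ((u : ℤ) : ℝ) * x) = D := fun u => by
    rcases Int.units_eq_one_or u with rfl | rfl
    · simp
    · simpa using hD
  rw [hL, ← Measure.map_map (by fun_prop) (by fun_prop), hperm,
    Measure.pi_map_pi (f := fun r (x : Fin d → ℝ) c => (((S.sign r j : ℤˣ) : ℤ) : ℝ) * x c)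
      fun r => (measurable_pi_lambda _ fun c =>
        (measurable_pi_apply c).const_mul _).aemeasurable]
  congr 1
  funext r
  have hp : ∀ _ : Fin d, IsProbabilityMeasure (D.map fun x => (((S.sign r j : ℤˣ) : ℤ) : ℝ) * x) :=
    fun _ => Measure.isProbabilityMeasure_map (by fun_prop)
  rw [Measure.pi_map_pi (f := fun (_ : Fin d) x => (((S.sign r j : ℤˣ) : ℤ) : ℝ) * x)
    fun r => by fun_prop]
  simp_rw [hsign]

variable {s b : ℝ}

/-- Summing the noise of the clients in `J` adds up the shapes. -/
lemma map_noiseSum (hs : 0 < s) (hb : 0 < b) {J : Finset (Fin n)} (hJ : J.Nonempty) :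
    (Measure.pi fun _ : Fin n => Measure.pi fun _ : Fin m => Measure.pi fun _ : Fin d =>
        gammaDiff s b).map (noiseSum S J)
      = Measure.pi fun _ : Fin m => Measure.pi fun _ : Fin d => gammaDiff (J.card * s) b := by
  have := isProbabilityMeasure_gammaDiff hs hb
  set μ := Measure.pi fun _ : Fin n => Measure.pi fun _ : Fin m => Measure.pi fun _ : Fin d =>
    gammaDiff s b with hμ
  have hmeas : ∀ j : Fin n, Measurable
      fun g : Fin n → Fin m → Fin d → ℝ => localSketch S j (g j) :=
    fun j => (measurable_localSketch S j).comp (measurable_pi_apply j)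
  have hind : iIndepFun (fun (j : Fin n) (g : Fin n → Fin m → Fin d → ℝ) =>
      localSketch S j (g j)) μ :=
    iIndepFun_pi fun j => (measurable_localSketch S j).aemeasurable
  have hone : ∀ j, μ.map (fun g => localSketch S j (g j))
      = Measure.pi fun _ : Fin m => Measure.pi fun _ : Fin d => gammaDiff s b := fun j => by
    rw [← map_localSketch S _ (gammaDiff_map_neg hs hb) j,
      ← (measurePreserving_eval (fun _ : Fin n => Measure.pi fun _ : Fin m =>
        Measure.pi fun _ : Fin d => gammaDiff s b) j).map_eq,
      Measure.map_map (measurable_localSketch S j) (measurable_pi_apply j)]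
    rfl
  induction hJ using Finset.Nonempty.cons_induction with
  | singleton j =>
    have e : (noiseSum S {j} : (Fin n → Fin m → Fin d → ℝ) → _)
        = fun g => localSketch S j (g j) := by
      funext g
      simp [noiseSum]
    rw [e, hone, Finset.card_singleton, Nat.cast_one, one_mul]
  | cons j J hj hJ ih =>
    have hpos : 0 < (J.card : ℝ) * s := mul_pos (by exact_mod_cast hJ.card_pos) hs
    have := isProbabilityMeasure_gammaDiff hpos hb
    have hfun : (noiseSum S (Finset.cons j J hj) : (Fin n → Fin m → Fin d → ℝ) → _)
        = (∑ j ∈ J, fun g => localSketch S j (g j)) + fun g => localSketch S j (g j) := by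
      funext g
      simp [noiseSum, Finset.sum_insert hj, add_comm]
    have hJ' : (noiseSum S J : (Fin n → Fin m → Fin d → ℝ) → _)
        = ∑ j ∈ J, fun g => localSketch S j (g j) := by
      funext g
      simp [noiseSum]
    rw [hfun, (hind.indepFun_finsetSum_of_notMem hmeas hj).map_add_eq_map_conv_map
      (by rw [← hJ']; exact measurable_noiseSum S J) (hmeas j), hone, ← hJ', ih, pi_conv_pi]
    simp_rw [pi_conv_pi, gammaDiff_conv hpos hs hb]
    rw [Finset.card_cons]
    push_cast
    rw [add_mul, one_mul]

/-- The messages of the corrupt clients are independent of the noise of the others. -/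
lemma map_noiseSum_prod (hs : 0 < s) (hb : 0 < b) (Cor : Finset (Fin n))
    (hC : Corᶜ.Nonempty) :
    (Measure.pi fun _ : Fin n => Measure.pi fun _ : Fin m => Measure.pi fun _ : Fin d =>
        gammaDiff s b).map (fun g => (noiseSum S Corᶜ g, fun j : Cor => g j))
      = (Measure.pi fun _ : Fin m => Measure.pi fun _ : Fin d =>
          gammaDiff (Corᶜ.card * s) b).prod
        ((Measure.pi fun _ : Fin n => Measure.pi fun _ : Fin m => Measure.pi fun _ : Fin d =>
          gammaDiff s b).map fun g (j : Cor) => g j) := by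
  have := isProbabilityMeasure_gammaDiff hs hb
  have hind := (iIndepFun_pi (μ := fun _ : Fin n => Measure.pi fun _ : Fin m =>
    Measure.pi fun _ : Fin d => gammaDiff s b) (X := fun _ g => g)
    fun j => aemeasurable_id).indepFun_finset Corᶜ Cor
      (Finset.disjoint_left.2 fun j hj => Finset.mem_compl.1 hj) fun j => by fun_prop
  have hφ : Measurable fun (h : (Corᶜ : Finset (Fin n)) → Fin m → Fin d → ℝ) =>
      ∑ j : (Corᶜ : Finset (Fin n)), localSketch S j (h j) := by
    have := fun j => measurable_localSketch (d := d) S j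
    fun_prop
  have h2 := hind.comp hφ measurable_id
  have e : (fun h : (Corᶜ : Finset (Fin n)) → Fin m → Fin d → ℝ =>
        ∑ j : (Corᶜ : Finset (Fin n)), localSketch S j (h j)) ∘
      (fun (g : Fin n → Fin m → Fin d → ℝ) (j : (Corᶜ : Finset (Fin n))) => g j)
      = noiseSum S Corᶜ := by
    funext g
    simp only [Function.comp, noiseSum]
    exact Finset.sum_coe_sort Corᶜ fun j => localSketch S j (g j)
  rw [e] at h2
  rw [← map_noiseSum S hs hb hC]
  exact h2.map_prod_eq_prod_map_map (measurable_noiseSum S _).aemeasurable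
    (measurable_pi_lambda _ fun j => measurable_pi_apply _).aemeasurable

end Law

/-! ### Privacy -/

instance (m n : ℕ) : Countable (DenseSketch m n) := by
  have : Function.Injective fun S : DenseSketch m n => (S.sign, S.part) := by
    rintro ⟨s, p, _, _, _⟩ ⟨s', p', _, _, _⟩ h
    simp only [Prod.mk.injEq] at h
    obtain ⟨rfl, rfl⟩ := h
    rfl
  exact this.countable

instance (m n : ℕ) : DiscreteMeasurableSpace (DenseSketch m n) := ⟨fun _ => trivial⟩

section Output

variable {m n d : ℕ} (S : DenseSketch m n)

lemma localSketch_add_const (j : Fin n) (a : Fin d → ℝ) (g : Fin m → Fin d → ℝ) (r : Fin m)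
    (c : Fin d) :
    localSketch S j (fun i c => a c + g i c) r c
      = (((S.sign r j : ℤˣ) : ℤ) : ℝ) * a c + localSketch S j g r c := by
  have h : ∑ i, ((S.part i r j : SignType) : ℝ) = (((S.sign r j : ℤˣ) : ℤ) : ℝ) := by
    obtain ⟨ρ, hρ⟩ := S.exists_perm j
    simp [hρ]
  simp only [localSketch, mul_add, Finset.sum_add_distrib, ← Finset.sum_mul, h]

lemma transform_apply (y : Fin n → Fin m → Fin d → ℝ) (r : Fin m) (c : Fin d) :
    transform S y r c = 1 / √(m : ℝ) * ∑ j, localSketch S j (y j) r c := by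
  simp only [transform, localSketch, Matrix.smul_apply, Matrix.sum_apply, Matrix.mul_apply,
    Matrix.map_apply, Matrix.of_apply, smul_eq_mul]
  rw [Finset.sum_comm]

lemma transform_apply_add (A : Matrix (Fin n) (Fin d) ℝ) (g : Fin n → Fin m → Fin d → ℝ)
    (r : Fin m) (c : Fin d) :
    transform S (fun j i c => A j c + g j i c) r c = 1 / √(m : ℝ) *
      (∑ j, (((S.sign r j : ℤˣ) : ℤ) : ℝ) * A j c + ∑ j, localSketch S j (g j) r c) := by
  rw [transform_apply, ← Finset.sum_add_distrib]
  simp_rw [localSketch_add_const S]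

lemma pi_randomizer (D : Measure ℝ) [IsProbabilityMeasure D] (A : Matrix (Fin n) (Fin d) ℝ) :
    (Measure.pi fun j => randomizer m D (A j))
      = (Measure.pi fun _ : Fin n => Measure.pi fun _ : Fin m => Measure.pi fun _ : Fin d => D).map
        fun g j i c => A j c + g j i c := by
  have hp : ∀ j, IsProbabilityMeasure ((Measure.pi fun _ : Fin m => Measure.pi fun _ : Fin d =>
      D).map fun g i c => A j c + g i c) :=
    fun j => Measure.isProbabilityMeasure_map (Measurable.aemeasurable (by fun_prop))
  exact (Measure.pi_map_pi (f := fun j (g : Fin m → Fin d → ℝ) i c => A j c + g i c)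
    fun j => Measurable.aemeasurable (by fun_prop)).symm

lemma measurable_transform :
    Measurable fun y : Fin n → Fin m → Fin d → ℝ => fun r c => transform S y r c := by
  simp_rw [transform_apply]
  have := fun j => measurable_localSketch (d := d) S j
  fun_prop

/-- The adversary's observations in terms of the noise `w` of the honest clients and the noise `h`
of the corrupt clients. -/
noncomputable def viewMap (Cor : Finset (Fin n)) (A : Matrix (Fin n) (Fin d) ℝ)
    (p : (Fin m → Fin d → ℝ) × (Cor → Fin m → Fin d → ℝ)) :
    (Fin m → Fin d → ℝ) × (Cor → Fin m → Fin d → ℝ) :=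
  (fun r c => 1 / √(m : ℝ) * (∑ j, (((S.sign r j : ℤˣ) : ℤ) : ℝ) * A j c
    + (∑ j : Cor, localSketch S j (p.2 j) r c + p.1 r c)), fun j i c => A j c + p.2 j i c)

lemma measurable_viewMap (Cor : Finset (Fin n)) (A : Matrix (Fin n) (Fin d) ℝ) :
    Measurable (viewMap S Cor A) := by
  unfold viewMap
  have := fun j => measurable_localSketch (d := d) S j
  fun_prop

lemma viewMap_noiseSum (Cor : Finset (Fin n)) (A : Matrix (Fin n) (Fin d) ℝ)
    (g : Fin n → Fin m → Fin d → ℝ) :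
    viewMap S Cor A (noiseSum S Corᶜ g, fun j : Cor => g j)
      = (fun r c => transform S (fun j i c => A j c + g j i c) r c,
        fun j : Cor => fun i c => A j c + g j i c) := by
  refine Prod.ext (funext fun r => funext fun c => ?_) rfl
  simp only [viewMap, transform_apply_add, noiseSum, Finset.sum_apply]
  rw [Finset.sum_coe_sort Cor fun j => localSketch S j (g j) r c, Finset.sum_add_sum_compl]

/-- A change of the input of an honest client has the effect of a shift of the honest noise. -/
lemma viewMap_of_neighbours {η : ℝ} {Cor : Finset (Fin n)} {A A' : Matrix (Fin n) (Fin d) ℝ}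
    (h : Neighbours η Cor A A') :
    ∃ v : Fin m → Fin d → ℝ, (∀ r c, |v r c| ≤ 2 * η) ∧
      ∀ p, viewMap S Cor A p = viewMap S Cor A' (fun r c => p.1 r c + v r c, p.2) := by
  obtain ⟨hA, hA', j, hj, hne⟩ := h
  refine ⟨fun r c => (((S.sign r j : ℤˣ) : ℤ) : ℝ) * (A j c - A' j c), fun r c => ?_, fun p => ?_⟩
  · have h1 : |A j c - A' j c| ≤ 2 * η := by
      have := abs_sub (A j c) (A' j c)
      linarith [hA j c, hA' j c]
    rcases Int.units_eq_one_or (S.sign r j) with h | h <;> simpa [h, abs_sub_comm] using h1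
  · refine Prod.ext (funext fun r => funext fun c => ?_) ?_
    · have : ∑ j', (((S.sign r j' : ℤˣ) : ℤ) : ℝ) * A j' c
          = ∑ j', (((S.sign r j' : ℤˣ) : ℤ) : ℝ) * A' j' c
            + (((S.sign r j : ℤˣ) : ℤ) : ℝ) * (A j c - A' j c) := by
        rw [← sub_eq_iff_eq_add', ← Finset.sum_sub_distrib, Finset.sum_eq_single j]
        · ring
        · intro j' _ hj'
          rw [hne j' hj', sub_self]
        · simp
      simp only [viewMap, this]
      ring
    · funext j' i c
      simp only [viewMap]
      rw [hne j' fun h => hj (h ▸ j'.2)]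

end Output

variable {m n d : ℕ}

/-- For a fixed sketch, the probabilities of the adversary's observations on neighbouring datasets
differ at most by the factor `exp (2 η / b)` for each of the `m d` entries of the output. -/
lemma map_view_le {s b η : ℝ} (S : DenseSketch m n) (hs : 0 < s) (hb : 0 < b)
    {Cor : Finset (Fin n)} (hκ : 1 ≤ (Corᶜ.card : ℝ) * s) {A A' : Matrix (Fin n) (Fin d) ℝ}
    (h : Neighbours η Cor A A') {F : Set ((Fin m → Fin d → ℝ) × (Cor → Fin m → Fin d → ℝ))}
    (hF : MeasurableSet F) :
    (Measure.pi fun j => randomizer m (gammaDiff s b) (A j))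
        ((fun y => (fun r c => transform S y r c, fun j : Cor => y j)) ⁻¹' F)
      ≤ ENNReal.ofReal (Real.exp (2 * η / b)) ^ (d * m) *
        (Measure.pi fun j => randomizer m (gammaDiff s b) (A' j))
          ((fun y => (fun r c => transform S y r c, fun j : Cor => y j)) ⁻¹' F) := by
  have := isProbabilityMeasure_gammaDiff hs hb
  have := isProbabilityMeasure_gammaDiff (by linarith : 0 < (Corᶜ.card : ℝ) * s) hb
  have hC : Corᶜ.Nonempty := by
    obtain ⟨_, _, j, hj, _⟩ := h
    exact ⟨j, Finset.mem_compl.2 hj⟩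
  have hm : Measurable fun y : Fin n → Fin m → Fin d → ℝ =>
      ((fun r c => transform S y r c, fun j => y j) :
        (Fin m → Fin d → ℝ) × (Cor → Fin m → Fin d → ℝ)) :=
    (measurable_transform S).prodMk (measurable_pi_lambda _ fun j => measurable_pi_apply _)
  have hm' : Measurable fun g : Fin n → Fin m → Fin d → ℝ =>
      ((noiseSum S Corᶜ g, fun j => g j) :
        (Fin m → Fin d → ℝ) × (Cor → Fin m → Fin d → ℝ)) :=
    (measurable_noiseSum S _).prodMk (measurable_pi_lambda _ fun j => measurable_pi_apply _)
  set P := Measure.pi fun _ : Fin m => Measure.pi fun _ : Fin d => gammaDiff (Corᶜ.card * s) b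
    with hP
  set Q := (Measure.pi fun _ : Fin n => Measure.pi fun _ : Fin m => Measure.pi fun _ : Fin d =>
    gammaDiff s b).map fun g (j : Cor) => g j with hQ
  have hQp : IsProbabilityMeasure Q := Measure.isProbabilityMeasure_map
    (measurable_pi_lambda _ fun j => measurable_pi_apply _).aemeasurable
  have key : ∀ A : Matrix (Fin n) (Fin d) ℝ,
      (Measure.pi fun j => randomizer m (gammaDiff s b) (A j))
        ((fun y => (fun r c => transform S y r c, fun j : Cor => y j)) ⁻¹' F)
      = (P.prod Q) (viewMap S Cor A ⁻¹' F) := fun A => by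
    rw [pi_randomizer, Measure.map_apply (by fun_prop) (hF.preimage hm),
      ← map_noiseSum_prod S hs hb Cor hC,
      Measure.map_apply hm' (hF.preimage (measurable_viewMap S Cor A))]
    congr 1
    ext g
    simp only [Set.mem_preimage, viewMap_noiseSum]
  obtain ⟨v, hv, hA⟩ := viewMap_of_neighbours S h
  have hshift : P.map (fun w r c => w r c + v r c)
      ≤ ENNReal.ofReal (Real.exp (2 * η / b)) ^ (d * m) • P := by
    have hp1 : ∀ r c, IsProbabilityMeasure ((gammaDiff (Corᶜ.card * s) b).map (· + v r c)) :=
      fun r c => Measure.isProbabilityMeasure_map (Measurable.aemeasurable (by fun_prop))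
    have hp2 : ∀ r, IsProbabilityMeasure ((Measure.pi fun _ : Fin d =>
        gammaDiff (Corᶜ.card * s) b).map fun w c => w c + v r c) :=
      fun r => Measure.isProbabilityMeasure_map (Measurable.aemeasurable (by fun_prop))
    have h2 : ∀ r, ((Measure.pi fun _ : Fin d => gammaDiff (Corᶜ.card * s) b).map
        fun w c => w c + v r c) ≤ ENNReal.ofReal (Real.exp (2 * η / b)) ^ d •
          Measure.pi fun _ : Fin d => gammaDiff (Corᶜ.card * s) b := fun r => by
      rw [Measure.pi_map_pi (f := fun (c : Fin d) x => x + v r c) fun r => Measurable.aemeasurable (by fun_prop)]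
      exact measure_pi_le ENNReal.ofReal_ne_top _ _ fun c => gammaDiff_map_add_le hκ hb (hv r c)
    rw [hP, Measure.pi_map_pi (f := fun r (x : Fin d → ℝ) c => x c + v r c)
      (fun r => Measurable.aemeasurable (by fun_prop)), pow_mul]
    exact measure_pi_le (ENNReal.pow_ne_top ENNReal.ofReal_ne_top) _ _ h2
  rw [key, key]
  have hpre : viewMap S Cor A ⁻¹' F
      = Prod.map (fun w r c => w r c + v r c) id ⁻¹' (viewMap S Cor A' ⁻¹' F) := by
    ext p
    simp only [Set.mem_preimage, hA]
    rfl
  have hF' := hF.preimage (measurable_viewMap S Cor A')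
  have hpm : IsProbabilityMeasure (P.map fun w r c => w r c + v r c) :=
    Measure.isProbabilityMeasure_map (Measurable.aemeasurable (by fun_prop))
  rw [hpre, ← Measure.map_apply (by fun_prop) hF', ← Measure.map_prod_map _ _ (by fun_prop)
    measurable_id, Measure.map_id]
  refine (Measure.prod_mono hshift le_rfl _).trans_eq ?_
  rw [Measure.prod_smul_left, Measure.smul_apply, smul_eq_mul]

lemma shape_pos {t : ℕ} (hm : 1 ≤ m) (ht : m * t < n) : 0 < 1 / ((n : ℝ) / m - t) := by
  have hm' : (0 : ℝ) < m := by exact_mod_cast hm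
  have h : (m : ℝ) * t < n := by exact_mod_cast ht
  refine one_div_pos.2 (sub_pos.2 ?_)
  rw [lt_div_iff₀ hm']
  linarith

/-- The honest clients, of whom there are at least `n / m - t`, have noise of total shape at
least `1`. -/
lemma one_le_card_mul_shape {t : ℕ} (hm : 1 ≤ m) (ht : m * t < n) {Cor : Finset (Fin n)}
    (hC : Cor.card ≤ t) : 1 ≤ (Corᶜ.card : ℝ) * (1 / ((n : ℝ) / m - t)) := by
  have hm' : (1 : ℝ) ≤ m := by exact_mod_cast hm
  have h := one_div_pos.1 (shape_pos hm ht)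
  rw [mul_one_div, le_div_iff₀ h, one_mul]
  have h1 : (Corᶜ.card : ℝ) + Cor.card = n := by
    have := Finset.card_add_card_compl Cor
    rw [Fintype.card_fin] at this
    exact_mod_cast (add_comm _ _).trans this
  have h2 : (Cor.card : ℝ) ≤ t := by exact_mod_cast hC
  have h3 : (n : ℝ) / m ≤ n := div_le_self (Nat.cast_nonneg n) hm'
  linarith

/-- The adversary's view is differentially private. -/
lemma isDP_view {t : ℕ} {η ε : ℝ} (ν : PMF (DenseSketch m n)) {Cor : Finset (Fin n)}
    (hd : 1 ≤ d) (hm : 1 ≤ m) (ht : m * t < n) (hη : 0 < η) (hε : 0 < ε) (hC : Cor.card ≤ t) :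
    IsDP ε 0 (Neighbours η Cor)
      (fun A : Matrix (Fin n) (Fin d) ℝ => view ν (noise n d m t η ε) Cor A) := by
  intro A A' h E hE
  have hm' : (1 : ℝ) ≤ m := by exact_mod_cast hm
  have hd' : (0 : ℝ) < d := by exact_mod_cast hd
  have hs := shape_pos hm ht
  have hb : 0 < 2 * η * (m : ℝ) ^ 2 * d / ε := by positivity
  have := isProbabilityMeasure_gammaDiff hs hb
  have hr : ∀ (A : Matrix (Fin n) (Fin d) ℝ) j,
      IsProbabilityMeasure (randomizer m (noise n d m t η ε) (A j)) := fun A j => by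
    unfold noise randomizer
    exact Measure.isProbabilityMeasure_map (Measurable.aemeasurable (by fun_prop))
  have hmeas : Measurable fun ω : DenseSketch m n × (Fin n → Fin m → Fin d → ℝ) =>
      ((ω.1, fun r c => transform ω.1 ω.2 r c, fun j => ω.2 j) :
        DenseSketch m n × (Fin m → Fin d → ℝ) × (Cor → Fin m → Fin d → ℝ)) :=
    measurable_from_prod_countable_right fun S => measurable_const.prodMk
      ((measurable_transform S).prodMk (measurable_pi_lambda _ fun j => measurable_pi_apply _))
  simp only [view, experiment]
  rw [Measure.map_apply hmeas hE, Measure.map_apply hmeas hE,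
    Measure.prod_apply (hE.preimage hmeas), Measure.prod_apply (hE.preimage hmeas),
    ENNReal.ofReal_zero, add_zero, ← lintegral_const_mul _ Measurable.of_discrete]
  refine lintegral_mono fun S => ?_
  refine (map_view_le S hs hb (one_le_card_mul_shape hm ht hC) h
    (hE.preimage (measurable_prodMk_left (x := S)))).trans (mul_le_mul_left ?_ _)
  rw [← ENNReal.ofReal_pow (Real.exp_pos _).le, ← Real.exp_nat_mul]
  refine ENNReal.ofReal_le_ofReal (Real.exp_le_exp.2 ?_)
  have : ((d * m : ℕ) : ℝ) * (2 * η / (2 * η * (m : ℝ) ^ 2 * d / ε)) = ε / m := by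
    push_cast
    field_simp
  rw [this]
  exact div_le_self hε.le hm'

/-! ### Tail bound for the noise -/

/-- Jensen's inequality for the convex function `x ↦ cosh √x`, whose power series has non-negative
coefficients. -/
lemma cosh_sqrt_mean_sq_le {ι : Type*} [Fintype ι] [Nonempty ι] (x : ι → ℝ) :
    Real.cosh √((∑ i, x i ^ 2) / Fintype.card ι) ≤ (∑ i, Real.cosh (x i)) / Fintype.card ι := by
  have hN : (0 : ℝ) < Fintype.card ι := by exact_mod_cast Fintype.card_pos
  have h0 : 0 ≤ (∑ i, x i ^ 2) / Fintype.card ι :=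
    div_nonneg (Finset.sum_nonneg fun i _ => sq_nonneg _) hN.le
  have h2 : HasSum (fun k => (∑ i, x i ^ (2 * k) / ((2 * k).factorial : ℝ)) / Fintype.card ι)
      ((∑ i, Real.cosh (x i)) / Fintype.card ι) :=
    (hasSum_sum fun i _ => Real.hasSum_cosh (x i)).div_const _
  refine hasSum_le (fun k => ?_) (Real.hasSum_cosh _) h2
  have hw := Real.pow_arith_mean_le_arith_mean_pow Finset.univ
    (fun _ : ι => (1 : ℝ) / Fintype.card ι) (fun i => x i ^ 2) (fun _ _ => by positivity)
    (by simp [Finset.card_univ, hN.ne']) (fun i _ => sq_nonneg _) k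
  rw [pow_mul, Real.sq_sqrt h0, ← Finset.sum_div, div_div, mul_comm ((2 * k).factorial : ℝ),
    ← div_div]
  refine div_le_div_of_nonneg_right ?_ (Nat.cast_nonneg _)
  simp_rw [← Finset.mul_sum, ← pow_mul, one_div_mul_eq_div] at hw
  exact hw

section Cosh

variable {a b : ℝ}

/-- The exponential moments of the gamma difference distribution at an argument `t` that is small
compared with the inverse of its standard deviation are bounded by a constant. -/
lemma gammaMgf_mul_neg_le (ha : 1 ≤ a) (hb : 0 < b) {t : ℝ} (ht : 0 < t)
    (hat : (t * b) ^ 2 * (2 * a) = 1) :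
    t < 1 / b ∧ gammaMgf a (1 / b) t * gammaMgf a (1 / b) (-t) ≤ Real.exp 1 := by
  have ha0 : 0 < a := by linarith
  have htb : 0 < t * b := mul_pos ht hb
  have hsq : (t * b) ^ 2 = 1 / (2 * a) := by field_simp; linarith
  have hhalf : (t * b) ^ 2 ≤ 1 / 2 := by
    rw [hsq]
    exact one_div_le_one_div_of_le (by norm_num) (by linarith)
  have h1 : t * b < 1 := by nlinarith
  have hlt : t < 1 / b := by rwa [lt_div_iff₀ hb]
  have h1' : -t < 1 / b := by have := one_div_pos.2 hb; linarith
  refine ⟨hlt, ?_⟩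
  rw [gammaMgf, gammaMgf, if_pos hlt, if_pos h1']
  have hb' := one_div_pos.2 hb
  have hp1 : 0 < 1 / b - t := by linarith
  have hp2 : 0 < 1 / b - -t := by linarith
  rw [← Real.mul_rpow (by positivity) (by positivity)]
  have e : 1 / b / (1 / b - t) * (1 / b / (1 / b - -t)) = 1 / (1 - (t * b) ^ 2) := by
    have e1 : 1 / b - t = (1 - t * b) / b := by field_simp
    have e2 : 1 / b - -t = (1 + t * b) / b := by field_simp; ring
    have h3 : 1 - t * b ≠ 0 := by linarith
    have h4 : 1 + t * b ≠ 0 := by linarith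
    have h5 : 1 - (t * b) ^ 2 = (1 - t * b) * (1 + t * b) := by ring
    rw [e1, e2, h5]
    field_simp
  have h2 : 1 / (1 - (t * b) ^ 2) ≤ Real.exp (1 / a) := by
    have h6 : 1 / a = 2 * (t * b) ^ 2 := by rw [hsq]; field_simp
    rw [h6]
    refine le_trans ?_ (Real.add_one_le_exp _)
    rw [div_le_iff₀ (by linarith)]
    nlinarith [sq_nonneg (t * b)]
  rw [e]
  have h0 : 0 ≤ 1 / (1 - (t * b) ^ 2) := one_div_nonneg.2 (by linarith)
  refine (Real.rpow_le_rpow h0 h2 ha0.le).trans_eq ?_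
  rw [← Real.exp_mul, one_div_mul_cancel ha0.ne']

lemma integrable_exp_gammaDiff (ha : 0 < a) (hb : 0 < b) {t : ℝ} (ht : |t| < 1 / b) :
    Integrable (fun x => Real.exp (t * x)) (gammaDiff a b) := by
  have h := abs_lt.1 ht
  have hb' := one_div_pos.2 hb
  refine not_imp_comm.1 integral_undef (ne_of_gt ?_)
  rw [integral_exp_gammaDiff ha hb, gammaMgf, gammaMgf, if_pos h.2, if_pos (by linarith)]
  exact mul_pos (Real.rpow_pos_of_pos (div_pos hb' (by linarith)) _)
    (Real.rpow_pos_of_pos (div_pos hb' (by linarith)) _)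

lemma integral_cosh_gammaDiff_le (ha : 1 ≤ a) (hb : 0 < b) {t : ℝ} (ht : 0 < t)
    (hat : (t * b) ^ 2 * (2 * a) = 1) :
    Integrable (fun x => Real.cosh (t * x)) (gammaDiff a b) ∧
      ∫ x, Real.cosh (t * x) ∂(gammaDiff a b) ≤ Real.exp 1 := by
  have ha0 : 0 < a := by linarith
  obtain ⟨hlt, hle⟩ := gammaMgf_mul_neg_le ha hb ht hat
  have i1 := integrable_exp_gammaDiff ha0 hb (t := t) (by rwa [abs_of_pos ht])
  have i2 := integrable_exp_gammaDiff ha0 hb (t := -t) (by rwa [abs_neg, abs_of_pos ht])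
  have e : ∀ x, Real.cosh (t * x) = (Real.exp (t * x) + Real.exp (-t * x)) / 2 := fun x => by
    rw [Real.cosh_eq, neg_mul]
  simp_rw [e]
  refine ⟨(i1.add i2).div_const 2, ?_⟩
  rw [integral_div, integral_add i1 i2, integral_exp_gammaDiff ha0 hb,
    integral_exp_gammaDiff ha0 hb, neg_neg]
  linarith

end Cosh

/-- The Frobenius norm of a matrix of independent gamma differences of shape `a` and scale `b`
exceeds the root mean square `√(m d) · b √(2 a)` by a factor `l` with exponentially small
probability. -/
lemma pi_gammaDiff_frob_le {m d : ℕ} (hm : 0 < m) (hd : 0 < d) {a b : ℝ} (ha : 1 ≤ a)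
    (hb : 0 < b) {l : ℝ} (hl : 0 ≤ l) :
    (Measure.pi fun _ : Fin m => Measure.pi fun _ : Fin d => gammaDiff a b)
      {w | √((m : ℝ) * d) * (b * √(2 * a)) * l < frob (Matrix.of w)}
      ≤ ENNReal.ofReal (2 * Real.exp (1 - l)) := by
  have ha0 : 0 < a := by linarith
  have := isProbabilityMeasure_gammaDiff ha0 hb
  have : Nonempty (Fin m) := ⟨⟨0, hm⟩⟩
  have : Nonempty (Fin d) := ⟨⟨0, hd⟩⟩
  have hmd : (0 : ℝ) < (m : ℝ) * d := mul_pos (by exact_mod_cast hm) (by exact_mod_cast hd)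
  have hκ : 0 < b * √(2 * a) := by positivity
  set P := Measure.pi fun _ : Fin m => Measure.pi fun _ : Fin d => gammaDiff a b with hP
  -- This `t` is the inverse of the standard deviation of an entry.
  set t := 1 / (b * √(2 * a)) with ht
  have ht0 : 0 < t := one_div_pos.2 hκ
  have hat : (t * b) ^ 2 * (2 * a) = 1 := by
    have h2 : √(2 * a) ^ 2 = 2 * a := Real.sq_sqrt (by linarith)
    rw [ht, div_mul_eq_mul_div, one_mul, div_pow, mul_pow, h2]
    field_simp
  obtain ⟨hint, hle⟩ := integral_cosh_gammaDiff_le ha hb ht0 hat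
  have hmp : ∀ p : Fin m × Fin d, MeasurePreserving (fun w : Fin m → Fin d → ℝ => w p.1 p.2) P
      (gammaDiff a b) := fun p =>
    (measurePreserving_eval (fun _ : Fin d => gammaDiff a b) p.2).comp
      (measurePreserving_eval (fun _ : Fin m => Measure.pi fun _ : Fin d => gammaDiff a b) p.1)
  have hcosh : Measurable fun x : ℝ => Real.cosh (t * x) :=
    Real.measurable_cosh.comp (measurable_const_mul t)
  have hint' : ∀ p : Fin m × Fin d, Integrable (fun w => Real.cosh (t * w p.1 p.2)) P :=
    fun p => (hmp p).integrable_comp_of_integrable hint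
  have hval : ∀ p : Fin m × Fin d, ∫ w, Real.cosh (t * w p.1 p.2) ∂P ≤ Real.exp 1 := fun p => by
    rw [← integral_map (f := fun x => Real.cosh (t * x)) (hmp p).measurable.aemeasurable
      hcosh.aestronglyMeasurable, (hmp p).map_eq]
    exact hle
  have hcard : (Fintype.card (Fin m × Fin d) : ℝ) = m * d := by simp
  set f : (Fin m → Fin d → ℝ) → ℝ :=
    fun w => (∑ p : Fin m × Fin d, Real.cosh (t * w p.1 p.2)) / (m * d) with hf
  have hf0 : ∀ w, 0 ≤ f w := fun w =>
    div_nonneg (Finset.sum_nonneg fun p _ => (Real.cosh_pos _).le) hmd.le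
  have hfi : Integrable f P := (integrable_finsetSum _ fun p _ => hint' p).div_const _
  have hfv : ∫ w, f w ∂P ≤ Real.exp 1 := by
    rw [hf, integral_div, integral_finsetSum _ fun p _ => hint' p, div_le_iff₀ hmd]
    refine (Finset.sum_le_sum fun p _ => hval p).trans_eq ?_
    rw [Finset.sum_const, Finset.card_univ, nsmul_eq_mul, hcard, mul_comm]
  have hsub : {w | √((m : ℝ) * d) * (b * √(2 * a)) * l < frob (Matrix.of w)}
      ⊆ {w | Real.exp l / 2 ≤ f w} := fun w hw => by
    have hw : √((m : ℝ) * d) * (b * √(2 * a)) * l < frob (Matrix.of w) := hw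
    have h1 := cosh_sqrt_mean_sq_le fun p : Fin m × Fin d => t * w p.1 p.2
    rw [hcard] at h1
    have h2 : √((∑ p : Fin m × Fin d, (t * w p.1 p.2) ^ 2) / (m * d))
        = t * frob (Matrix.of w) / √((m : ℝ) * d) := by
      rw [Real.sqrt_div' _ hmd.le]
      simp_rw [mul_pow]
      rw [← Finset.mul_sum, Real.sqrt_mul (sq_nonneg t), Real.sqrt_sq ht0.le,
        Fintype.sum_prod_type]
      rfl
    rw [h2] at h1
    have h3 : l ≤ t * frob (Matrix.of w) / √((m : ℝ) * d) := by
      rw [le_div_iff₀ (Real.sqrt_pos.2 hmd), ht, div_mul_eq_mul_div, one_mul, le_div_iff₀ hκ]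
      linarith
    have h4 : Real.cosh l ≤ Real.cosh (t * frob (Matrix.of w) / √((m : ℝ) * d)) := by
      rw [Real.cosh_le_cosh, abs_of_nonneg hl, abs_of_nonneg (hl.trans h3)]
      exact h3
    refine le_trans ?_ (h4.trans h1)
    rw [Real.cosh_eq]
    have := Real.exp_pos (-l)
    linarith
  refine (measure_mono hsub).trans ?_
  have hmk := mul_meas_ge_le_integral_of_nonneg (Filter.Eventually.of_forall hf0) hfi
    (Real.exp l / 2)
  have hreal : P.real {w | Real.exp l / 2 ≤ f w} ≤ 2 * Real.exp (1 - l) := by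
    rw [Real.exp_sub, ← mul_div_assoc, le_div_iff₀ (Real.exp_pos l)]
    linarith
  rw [← ofReal_measureReal]
  exact ENNReal.ofReal_le_ofReal hreal

/-! ### Uniform sign matrices -/

lemma toMeasure_sign {m n : ℕ} {ν : PMF (DenseSketch m n)} (hν : IsRademacher ν)
    (p : (Fin m → Fin n → ℤˣ) → Prop) :
    ν.toMeasure {S | p S.sign} = ENNReal.ofReal (signProb p) := by
  classical
  have h1 : ν.toMeasure {S | p S.sign}
      = (PMF.uniformOfFintype (Matrix (Fin m) (Fin n) ℤˣ)).toOuterMeasure {R | p R} := by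
    rw [PMF.toMeasure_apply_eq_toOuterMeasure_apply _ MeasurableSet.of_discrete, ← hν,
      PMF.toOuterMeasure_map_apply]
    rfl
  rw [h1, PMF.toOuterMeasure_uniformOfFintype_apply, signProb, Fintype.expect_eq_sum_div_card,
    Finset.sum_boole, ENNReal.ofReal_div_of_pos (by exact_mod_cast Fintype.card_pos),
    ENNReal.ofReal_natCast, ENNReal.ofReal_natCast]
  congr 2
  rw [← Fintype.card_subtype]
  exact Fintype.card_congr (Equiv.refl _)

/-! ### Utility -/

/-- A minimizer of the cost of a noisy sketch is an approximate minimizer of the cost of the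
matrix, if the sketch hardly increases the cost of an optimal projection and hardly decreases
the cost of any projection. -/
lemma cost_argmin_le {n m d k : ℕ} {A : Matrix (Fin n) (Fin d) ℝ}
    {M B : Matrix (Fin m) (Fin d) ℝ} {X₀ X' : Matrix (Fin d) (Fin k) ℝ} {δ : ℝ}
    (hδ : 0 ≤ δ) (hδ1 : δ ≤ 1 / 12) (h₀ : X₀ ∈ Orthonormals d k) (hX' : X' ∈ Orthonormals d k)
    (hmin : cost B X' ^ 2 ≤ cost B X₀ ^ 2)
    (hup : cost M X₀ ^ 2 ≤ (1 + δ) * cost A X₀ ^ 2)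
    (hlow : (1 - 6 * δ) * cost A X' ^ 2 ≤ cost M X' ^ 2) :
    cost A X' ≤ (1 + 14 * δ) * cost A X₀ + 4 * frob (B - M) := by
  have hA' : 0 ≤ cost A X' := cost_nonneg _ _
  have hA₀ : 0 ≤ cost A X₀ := cost_nonneg _ _
  have hN := frob_nonneg (B - M)
  have h1 : cost B X' ≤ cost B X₀ := (sq_le_sq₀ (cost_nonneg _ _) (cost_nonneg _ _)).1 hmin
  have h2 : cost B X₀ ≤ cost M X₀ + frob (B - M) := by
    simpa using cost_add_le h₀ M (B - M)
  have h3 : cost M X' ≤ cost B X' + frob (B - M) := by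
    have := cost_add_le hX' B (-(B - M))
    rw [frob_neg] at this
    simpa using this
  have h4 : cost M X₀ ≤ (1 + δ) * cost A X₀ := by
    refine (sq_le_sq₀ (cost_nonneg _ _) (by positivity)).1 (hup.trans ?_)
    rw [mul_pow]
    exact mul_le_mul_of_nonneg_right (by nlinarith) (sq_nonneg _)
  have h5 : (1 - 6 * δ) * cost A X' ≤ cost M X' := by
    refine (sq_le_sq₀ (mul_nonneg (by linarith) hA') (cost_nonneg _ _)).1 (le_trans ?_ hlow)
    rw [mul_pow]
    exact mul_le_mul_of_nonneg_right (by nlinarith) (sq_nonneg _)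
  have h6 : (1 - 6 * δ) * cost A X' ≤ (1 + δ) * cost A X₀ + 2 * frob (B - M) := by linarith
  have h7 : 0 < 1 - 6 * δ := by linarith
  refine le_of_mul_le_mul_left (h6.trans ?_) h7
  have h8 : 0 ≤ (7 * δ - 84 * δ ^ 2) * cost A X₀ := mul_nonneg (by nlinarith) hA₀
  nlinarith [mul_nonneg (by linarith : 0 ≤ 2 - 24 * δ) hN]

/-- With probability at least `1 - β / 2`, the sketch preserves the costs of projections. -/
lemma signProb_sketch_le {n m d k : ℕ} (hk : 1 ≤ k) (A : Matrix (Fin n) (Fin d) ℝ)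
    {X₀ : Matrix (Fin d) (Fin k) ℝ} (h₀ : X₀ ∈ Orthonormals d k)
    (hopt : ∀ X ∈ Orthonormals d k, cost A X₀ ≤ cost A X) {α β : ℝ} (hα : 0 < α) (hα1 : α ≤ 1)
    (hβ : 0 < β) (hβ1 : β < 1)
    (hm : 10 ^ 7 * ((k + Real.log (1 / β)) / α ^ 2) ≤ m) :
    signProb (fun R : Fin m → Fin n → ℤˣ =>
      ¬ cost (sketchMul R A) X₀ ^ 2 ≤ (1 + α / 12) * cost A X₀ ^ 2 ∨
      ¬ ∀ X ∈ Orthonormals d k,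
        (1 - 6 * (α / 12)) * cost A X ^ 2 ≤ cost (sketchMul R A) X ^ 2) ≤ β / 2 := by
  have hk' : (1 : ℝ) ≤ k := by exact_mod_cast hk
  have hL : 0 < Real.log (1 / β) := Real.log_pos (by rw [lt_div_iff₀ hβ]; linarith)
  have hm0 : 0 < m := by
    have : (0 : ℝ) < m := lt_of_lt_of_le (by positivity) hm
    exact_mod_cast this
  -- The weakest of the exponents is `m (α / 12) ^ 2 / 2048 - 18 k`, and `10 ^ 7 / (144 * 2048) > 33`.
  have hM : 33 * (k + Real.log (1 / β)) ≤ m * (α / 12) ^ 2 / 2048 := by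
    rw [mul_div_assoc', div_le_iff₀ (by positivity)] at hm
    have : m * (α / 12) ^ 2 / 2048 = (m * α ^ 2) / 294912 := by ring
    rw [this, le_div_iff₀ (by norm_num)]
    nlinarith
  set M := m * (α / 12) ^ 2 / 2048 with hMdef
  have e1 : m * (α / 12) ^ 2 / 512 = 4 * M := by rw [hMdef]; ring
  have e2 : m * (α / 12) ^ 2 / 128 = 16 * M := by rw [hMdef]; ring
  have hsmall : ∀ x : ℝ, x ≤ 18 * k + 1 / 2 - M → Real.exp x ≤ β / 8 := fun x hx => by
    have h1 : x ≤ -Real.log (1 / β) - 3 := by linarith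
    refine (Real.exp_le_exp.2 h1).trans ?_
    have h8 : (8 : ℝ) ≤ Real.exp 3 := by
      have : Real.exp 3 = Real.exp 1 ^ 3 := by rw [← Real.exp_nat_mul]; norm_num
      rw [this]
      have := Real.exp_one_gt_d9
      calc (8 : ℝ) = 2 ^ 3 := by norm_num
        _ ≤ _ := pow_le_pow_left₀ (by norm_num) (by linarith) 3
    rw [Real.exp_sub, one_div, Real.log_inv, neg_neg, Real.exp_log hβ]
    exact div_le_div_of_nonneg_left hβ.le (by norm_num) h8
  have hup := signProb_cost_le hm0 A X₀ (δ := α / 12) (by positivity) (by linarith)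
  have hlow := signProb_cost_ge hm0 hk A h₀ hopt (δ := α / 12) (by positivity) (by linarith)
  rw [e2] at hup hlow
  rw [e1] at hlow
  refine (signProb_or_le _ _).trans ((add_le_add hup hlow).trans ?_)
  have s1 := hsmall (1 / 2 - 16 * M) (by linarith)
  have s2 := hsmall (2 * k - 4 * M) (by linarith)
  have s3 := hsmall (18 * k + 1 / 2 - M) le_rfl
  linarith

/-- For a fixed sketch, the noise in the output is the sum of the noise of all clients, and its
entries are independent gamma differences. -/
lemma pi_randomizer_noise_le {n m d : ℕ} (S : DenseSketch m n) (hm : 0 < m) (hn : 0 < n)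
    (hd : 0 < d) {s b : ℝ} (hs : 0 < s) (hb : 0 < b) (hκ : 1 ≤ (n : ℝ) * s)
    (A : Matrix (Fin n) (Fin d) ℝ) {l : ℝ} (hl : 0 ≤ l) :
    (Measure.pi fun j => randomizer m (gammaDiff s b) (A j))
      {y | √(d : ℝ) * (b * √(2 * (n * s))) * l < frob (transform S y - sketchMul S.sign A)}
      ≤ ENNReal.ofReal (2 * Real.exp (1 - l)) := by
  have := isProbabilityMeasure_gammaDiff hs hb
  have hm' : (0 : ℝ) < m := by exact_mod_cast hm
  have hJ : (Finset.univ : Finset (Fin n)).Nonempty := ⟨⟨0, hn⟩, Finset.mem_univ _⟩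
  have hfrob : Measurable fun w : Fin m → Fin d → ℝ => frob (Matrix.of w) := by
    unfold frob
    simp only [Matrix.of_apply]
    fun_prop
  have hset : MeasurableSet {w : Fin m → Fin d → ℝ |
      √((m : ℝ) * d) * (b * √(2 * (n * s))) * l < frob (Matrix.of w)} :=
    measurableSet_lt measurable_const hfrob
  have hdiff : ∀ g : Fin n → Fin m → Fin d → ℝ,
      frob (transform S (fun j i c => A j c + g j i c) - sketchMul S.sign A)
        = 1 / √(m : ℝ) * frob (Matrix.of (noiseSum S Finset.univ g)) := fun g => by
    have : ∀ r c, (transform S (fun j i c => A j c + g j i c) - sketchMul S.sign A) r c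
        = 1 / √(m : ℝ) * noiseSum S Finset.univ g r c := fun r c => by
      have h := sketchMul_apply S.sign A r c
      have h' : noiseSum S Finset.univ g r c = ∑ j, localSketch S j (g j) r c := by
        simp only [noiseSum, Finset.sum_apply]
      have h'' : signDot (Aᵀ c) (S.sign r) = ∑ j, (((S.sign r j : ℤˣ) : ℤ) : ℝ) * A j c :=
        Finset.sum_congr rfl fun j _ => mul_comm _ _
      rw [Matrix.sub_apply, transform_apply_add, h, h', h'']
      ring
    simp only [frob, this, mul_pow, Matrix.of_apply]
    simp_rw [← Finset.mul_sum]
    rw [Real.sqrt_mul (sq_nonneg _), Real.sqrt_sq (by positivity)]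
  have hT : MeasurableSet {y : Fin n → Fin m → Fin d → ℝ |
      √(d : ℝ) * (b * √(2 * (n * s))) * l < frob (transform S y - sketchMul S.sign A)} := by
    have h1 := measurable_transform (d := d) S
    have h2 : ∀ r c, Measurable fun y : Fin n → Fin m → Fin d → ℝ => transform S y r c :=
      fun r c => (measurable_pi_apply c).comp ((measurable_pi_apply r).comp h1)
    refine measurableSet_lt measurable_const ?_
    unfold frob
    simp only [Matrix.sub_apply]
    fun_prop
  rw [pi_randomizer, Measure.map_apply (by fun_prop) hT]
  refine le_trans (le_of_eq ?_) (pi_gammaDiff_frob_le hm hd hκ hb hl)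
  have hlaw := map_noiseSum (d := d) S hs hb hJ
  rw [Finset.card_univ, Fintype.card_fin] at hlaw
  rw [← hlaw, Measure.map_apply (measurable_noiseSum S _) hset]
  congr 1
  ext g
  simp only [Set.mem_preimage, Set.mem_ofPred_eq, hdiff]
  rw [one_div_mul_eq_div, lt_div_iff₀ (Real.sqrt_pos.2 hm'), Real.sqrt_mul hm'.le]
  constructor <;> intro h <;> linarith

/-- A property of the sketch matrix and the messages fails with probability at most `β`, if it
follows from events, one on the sign matrix and one on the messages for each fixed sketch, that
fail with probability at most `β / 2`. -/
lemma experiment_le {n m d : ℕ} {ν : PMF (DenseSketch m n)} (hν : IsRademacher ν)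
    {D : Measure ℝ} [IsProbabilityMeasure D] (A : Matrix (Fin n) (Fin d) ℝ) {β T : ℝ}
    (hβ : 0 ≤ β) {p : (Fin m → Fin n → ℤˣ) → Prop} (hp : signProb p ≤ β / 2)
    (hT : ∀ S : DenseSketch m n, (Measure.pi fun j => randomizer m D (A j))
      {y | T < frob (transform S y - sketchMul S.sign A)} ≤ ENNReal.ofReal (β / 2))
    {E : Set (DenseSketch m n × (Fin n → Fin m → Fin d → ℝ))}
    (hE : ∀ ω ∈ E, ¬ p ω.1.sign → T < frob (transform ω.1 ω.2 - sketchMul ω.1.sign A)) :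
    experiment ν D A E ≤ ENNReal.ofReal β := by
  have hr : ∀ j, IsProbabilityMeasure (randomizer m D (A j)) := fun j =>
    Measure.isProbabilityMeasure_map (Measurable.aemeasurable (by fun_prop))
  have hmeas : MeasurableSet {ω : DenseSketch m n × (Fin n → Fin m → Fin d → ℝ) |
      T < frob (transform ω.1 ω.2 - sketchMul ω.1.sign A)} := by
    refine measurableSet_lt measurable_const (measurable_from_prod_countable_right fun S => ?_)
    have h2 : ∀ r c, Measurable fun y : Fin n → Fin m → Fin d → ℝ => transform S y r c :=
      fun r c => (measurable_pi_apply c).comp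
        ((measurable_pi_apply r).comp (measurable_transform S))
    unfold frob
    simp only [Matrix.sub_apply]
    fun_prop
  have hsub : E ⊆ ({S | p S.sign} ×ˢ Set.univ)
      ∪ {ω | T < frob (transform ω.1 ω.2 - sketchMul ω.1.sign A)} := fun ω hω => by
    by_cases h : p ω.1.sign
    · exact Or.inl ⟨h, trivial⟩
    · exact Or.inr (hE ω hω h)
  refine (measure_mono hsub).trans ((measure_union_le _ _).trans ?_)
  have e : ENNReal.ofReal β = ENNReal.ofReal (β / 2) + ENNReal.ofReal (β / 2) := by
    rw [← ENNReal.ofReal_add (by linarith) (by linarith), add_halves]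
  rw [e]
  refine add_le_add ?_ ?_
  · rw [experiment, Measure.prod_prod, measure_univ, mul_one, toMeasure_sign hν]
    exact ENNReal.ofReal_le_ofReal hp
  · rw [experiment, Measure.prod_apply hmeas]
    refine (lintegral_mono fun S => hT S).trans_eq ?_
    rw [lintegral_const, measure_univ, mul_one]

section Utility

variable {n m d k t : ℕ} {η ε α β : ℝ}

/-- The output is an approximate solution unless the sketch or the noise misbehaves; here the
failure probability of the noise is small because `m` is large. -/
lemma experiment_isApprox_le {ν : PMF (DenseSketch m n)} (hν : IsRademacher ν)
    {solve : Matrix (Fin m) (Fin d) ℝ → Matrix (Fin d) (Fin k) ℝ} (hsolve : IsArgmin solve)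
    (A : Matrix (Fin n) (Fin d) ℝ) (hk : 1 ≤ k) (hkd : k ≤ d) (ht : m * t < n) (hη : 0 < η)
    (hε : 0 < ε) (hα : 0 < α) (hα1 : α ≤ 1) (hβ : 0 < β) (hβ1 : β < 1)
    (hm : 10 ^ 7 * ((k + Real.log (1 / β)) / α ^ 2) ≤ m) {mul add : ℝ}
    (hmul : 1 + 14 * (α / 12) ≤ mul)
    (hadd : 4 * (√(d : ℝ) * (2 * η * (m : ℝ) ^ 2 * d / ε *
      √(2 * (n * (1 / ((n : ℝ) / m - t))))) * Real.log (m / β)) ≤ add) :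
    experiment ν (noise n d m t η ε) A
      {ω | ¬ IsApprox A mul add (solve (transform ω.1 ω.2))} ≤ ENNReal.ofReal β := by
  have hL : 0 < Real.log (1 / β) := Real.log_pos (by rw [lt_div_iff₀ hβ]; linarith)
  have hk' : (1 : ℝ) ≤ k := by exact_mod_cast hk
  have hm7 : (10 : ℝ) ^ 7 ≤ m := by
    refine le_trans ?_ hm
    refine le_mul_of_one_le_right (by norm_num) ?_
    rw [le_div_iff₀ (by positivity)]
    nlinarith
  have hm0 : (0 : ℝ) < m := by linarith
  have hm1 : 1 ≤ m := by exact_mod_cast hm0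
  have hd : 0 < d := by omega
  have hd' : (0 : ℝ) < d := by exact_mod_cast hd
  have hn : 0 < n := by omega
  have hs := shape_pos hm1 ht
  have hb : 0 < 2 * η * (m : ℝ) ^ 2 * d / ε := by positivity
  have hprob := isProbabilityMeasure_gammaDiff hs hb
  have hprob' : IsProbabilityMeasure (noise n d m t η ε) := hprob
  have hκ : 1 ≤ (n : ℝ) * (1 / ((n : ℝ) / m - t)) := by
    simpa using one_le_card_mul_shape hm1 ht (Cor := ∅) (by simp)
  have hmβ : (1 : ℝ) ≤ m / β := by
    rw [le_div_iff₀ hβ]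
    linarith
  have hl : 0 ≤ Real.log (m / β) := Real.log_nonneg hmβ
  have htail : 2 * Real.exp (1 - Real.log (m / β)) ≤ β / 2 := by
    rw [Real.exp_sub, Real.exp_log (by linarith), div_div_eq_mul_div, ← mul_div_assoc,
      div_le_iff₀ hm0]
    have := Real.exp_one_lt_d9
    nlinarith
  obtain ⟨X₀, h₀, hopt, hmin⟩ := exists_opt hkd A
  refine experiment_le hν A hβ.le (signProb_sketch_le hk A h₀ hmin hα hα1 hβ hβ1 hm)
    (fun S => (pi_randomizer_noise_le S hm1 hn hd hs hb hκ A hl).trans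
      (ENNReal.ofReal_le_ofReal htail)) fun ω hω hp => ?_
  rw [not_or, not_not, not_not] at hp
  by_contra! hN
  refine hω ⟨(hsolve _).1, ?_⟩
  have := cost_argmin_le (by positivity) (by linarith) h₀ (hsolve _).1
    ((hsolve (transform ω.1 ω.2)).2 X₀ h₀) hp.1 (hp.2 _ (hsolve _).1)
  rw [hopt] at this
  have h1 : (1 + 14 * (α / 12)) * opt k A ≤ mul * opt k A :=
    mul_le_mul_of_nonneg_right hmul (hopt ▸ cost_nonneg _ _)
  linarith

/-- The bound on the noise in terms of the parameters. -/
lemma noise_bound_le (hm : 1 ≤ m) (ht : m * t < n) (hη : 0 < η) (hε : 0 < ε) {l : ℝ}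
    (hl : 0 ≤ l) :
    4 * (√(d : ℝ) * (2 * η * (m : ℝ) ^ 2 * d / ε *
      √(2 * (n * (1 / ((n : ℝ) / m - t))))) * l)
      ≤ 12 * (m : ℝ) ^ 3 * (η * √((n : ℝ) / (n - m * t)) * ((d : ℝ) ^ (3 / 2 : ℝ) * ε⁻¹ * l)) := by
  have hm' : (1 : ℝ) ≤ m := by exact_mod_cast hm
  have hm0 : (m : ℝ) ≠ 0 := by linarith
  have hlt : (0 : ℝ) < n - m * t := sub_pos.2 (by exact_mod_cast ht)
  have e1 : 2 * ((n : ℝ) * (1 / ((n : ℝ) / m - t))) = 2 * m * (n / (n - m * t)) := by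
    have : (n : ℝ) / m - t = (n - m * t) / m := by field_simp
    rw [this, one_div_div]
    ring
  have e2 : (d : ℝ) ^ (3 / 2 : ℝ) = d * √(d : ℝ) := by
    rw [show (3 / 2 : ℝ) = 1 + 1 / 2 by norm_num, Real.rpow_add' (Nat.cast_nonneg d) (by norm_num),
      Real.rpow_one, Real.sqrt_eq_rpow]
  have h1 : √(2 * (m : ℝ)) ≤ 3 / 2 * m := by
    rw [Real.sqrt_le_left (by positivity)]
    nlinarith
  rw [e1, e2, Real.sqrt_mul (by positivity)]
  have hK : 0 ≤ 8 * (m : ℝ) ^ 2 * (η * √((n : ℝ) / (n - m * t)) * (d * √(d : ℝ) * ε⁻¹ * l)) := by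
    positivity
  calc _ = 8 * (m : ℝ) ^ 2 * (η * √((n : ℝ) / (n - m * t)) * (d * √(d : ℝ) * ε⁻¹ * l))
        * √(2 * (m : ℝ)) := by
        rw [div_eq_mul_inv _ ε]; ring
    _ ≤ 8 * (m : ℝ) ^ 2 * (η * √((n : ℝ) / (n - m * t)) * (d * √(d : ℝ) * ε⁻¹ * l))
        * (3 / 2 * m) := mul_le_mul_of_nonneg_left h1 hK
    _ = _ := by ring

end Utility

end LTM

theorem mainTheorem2 :
    (∀ (n d m t : ℕ) (η ε : ℝ) (ν : PMF (LTM.DenseSketch m n)) (Cor : Finset (Fin n)),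
      1 ≤ d → 1 ≤ m → m * t < n → 0 < η → 0 < ε → LTM.IsRademacher ν → Cor.card ≤ t →
      LTM.IsDP ε 0 (LTM.Neighbours η Cor)
        (fun A : Matrix (Fin n) (Fin d) ℝ => LTM.view ν (LTM.noise n d m t η ε) Cor A)) ∧
    (∃ c₀ : ℝ, 0 < c₀ ∧ ∀ c₁ : ℝ, c₀ ≤ c₁ → ∃ C : ℝ, 0 < C ∧
      ∀ (n d k m t : ℕ) (η ε α β : ℝ) (ν : PMF (LTM.DenseSketch m n))
        (solve : Matrix (Fin m) (Fin d) ℝ → Matrix (Fin d) (Fin k) ℝ)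
        (A : Matrix (Fin n) (Fin d) ℝ),
        1 ≤ k → k ≤ d → m * t < n → 0 < η → 0 < ε → 0 < α → α ≤ 1 → 0 < β → β < 1 →
        c₀ * ((k + Real.log (1 / β)) / α ^ 2) ≤ m →
        m ≤ c₁ * ((k + Real.log (1 / β)) / α ^ 2) →
        LTM.IsRademacher ν → LTM.IsArgmin solve →
        LTM.experiment ν (LTM.noise n d m t η ε) A
            {ω | ¬ LTM.IsApprox A (1 + C * α)
              (C * η * √((n : ℝ) / (n - m * t)) *
                ((k + Real.log (1 / β)) ^ 3 * (d : ℝ) ^ (3 / 2 : ℝ) / α ^ 6 * ε⁻¹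
                  * Real.log (m / β)))
              (solve (LTM.transform ω.1 ω.2))} ≤ ENNReal.ofReal β ∧
        (Real.log (1 / β) ≤ k → 2 * (m * t) ≤ n →
          LTM.experiment ν (LTM.noise n d m t η ε) A
            {ω | ¬ LTM.IsApprox A (1 + C * α)
              (C * η *
                ((k : ℝ) ^ 3 * (d : ℝ) ^ (3 / 2 : ℝ) / α ^ 6 * ε⁻¹ * Real.log (m / β)))
              (solve (LTM.transform ω.1 ω.2))} ≤ ENNReal.ofReal β)) := by
  -- The noise bound is `12 m ^ 3` times the parameters of the claim, with `m ≤ c₁ L / α ^ 2` and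
  -- `L = k + log (1 / β)`. In the second claim the square root is at most `3 / 2` and `L` is at
  -- most `2 k`, which gives a further factor `12`.
  refine ⟨fun n d m t η ε ν Cor hd hm ht hη hε _ hC => LTM.isDP_view ν hd hm ht hη hε hC,
    10 ^ 7, by norm_num, fun c₁ hc₁ => ⟨144 * c₁ ^ 3, by positivity, ?_⟩⟩
  intro n d k m t η ε α β ν solve A hk hkd ht hη hε hα hα1 hβ hβ1 hm hm' hν hsolve
  have hL : 0 < Real.log (1 / β) := Real.log_pos (by rw [lt_div_iff₀ hβ]; linarith)
  have hk' : (1 : ℝ) ≤ k := by exact_mod_cast hk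
  have hc0 : 0 < c₁ := lt_of_lt_of_le (by norm_num) hc₁
  have hc1 : 1 ≤ c₁ ^ 3 := one_le_pow₀ (le_trans (by norm_num) hc₁)
  have hm0 : (0 : ℝ) < m := lt_of_lt_of_le (by positivity) hm
  have hm1 : 1 ≤ m := by exact_mod_cast hm0
  have hm1' : (1 : ℝ) ≤ m := by exact_mod_cast hm1
  have hlt : (0 : ℝ) < n - m * t := sub_pos.2 (by exact_mod_cast ht)
  have hl : 0 ≤ Real.log (m / β) := Real.log_nonneg (by rw [le_div_iff₀ hβ]; linarith)
  have hmul : 1 + 14 * (α / 12) ≤ 1 + 144 * c₁ ^ 3 * α := by nlinarith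
  have hbound := LTM.noise_bound_le (d := d) hm1 ht hη hε hl
  set l := Real.log (m / β)
  set L := (k : ℝ) + Real.log (1 / β)
  set q := √((n : ℝ) / (n - m * t))
  have hq : 0 ≤ q := Real.sqrt_nonneg _
  set D := (d : ℝ) ^ (3 / 2 : ℝ)
  have hD : 0 ≤ D := Real.rpow_nonneg (Nat.cast_nonneg d) _
  have hL0 : 0 < L := by positivity
  have hm3 : (m : ℝ) ^ 3 ≤ c₁ ^ 3 * (L ^ 3 / α ^ 6) := by
    refine (pow_le_pow_left₀ hm0.le hm' 3).trans_eq ?_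
    rw [mul_pow, div_pow, ← pow_mul]
  have hm3' : 12 * (m : ℝ) ^ 3 * (η * q * (D * ε⁻¹ * l))
      ≤ 12 * c₁ ^ 3 * η * q * (L ^ 3 * D / α ^ 6 * ε⁻¹ * l) := by
    have : 0 ≤ 12 * (η * q * (D * ε⁻¹ * l)) := by positivity
    have := mul_le_mul_of_nonneg_left hm3 this
    calc _ = 12 * (η * q * (D * ε⁻¹ * l)) * (m : ℝ) ^ 3 := by ring
      _ ≤ _ := this
      _ = _ := by ring
  refine ⟨LTM.experiment_isApprox_le hν hsolve A hk hkd ht hη hε hα hα1 hβ hβ1 hm hmul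
    (hbound.trans (hm3'.trans ?_)), fun hβk htn => LTM.experiment_isApprox_le hν hsolve A hk hkd ht
      hη hε hα hα1 hβ hβ1 hm hmul (hbound.trans (hm3'.trans ?_))⟩
  · have : 0 ≤ c₁ ^ 3 * η * q * (L ^ 3 * D / α ^ 6 * ε⁻¹ * l) := by positivity
    linarith
  · have hq2 : q ≤ 3 / 2 := by
      refine Real.sqrt_le_iff.2 ⟨by norm_num, ?_⟩
      have : (2 : ℝ) * (m * t) ≤ n := by exact_mod_cast htn
      rw [div_le_iff₀ hlt]
      linarith
    have hL3 : L ^ 3 ≤ 8 * (k : ℝ) ^ 3 := by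
      have h2 : L ≤ 2 * k := by
        change (k : ℝ) + Real.log (1 / β) ≤ 2 * k
        linarith
      refine (pow_le_pow_left₀ hL0.le h2 3).trans_eq ?_
      ring
    have hqL : q * L ^ 3 ≤ 3 / 2 * (8 * (k : ℝ) ^ 3) :=
      mul_le_mul hq2 hL3 (by positivity) (by norm_num)
    have h0 : 0 ≤ 12 * c₁ ^ 3 * η * (D / α ^ 6 * ε⁻¹ * l) := by positivity
    calc _ = 12 * c₁ ^ 3 * η * (D / α ^ 6 * ε⁻¹ * l) * (q * L ^ 3) := by ring
      _ ≤ 12 * c₁ ^ 3 * η * (D / α ^ 6 * ε⁻¹ * l) * (3 / 2 * (8 * (k : ℝ) ^ 3)) :=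
        mul_le_mul_of_nonneg_left hqL h0
      _ = _ := by ring
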